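/- **Setting.** Let $p$ be a prime, $F/\mathbb{Q}_p$ a finite extension with ring of integers $\mathcal{O}_F$, uniformizer $\pi$ and residue field $\mathbb{F}_q$, $q=p^f$; fix an embedding $\mathbb{F}_q\hookrightarrow\overline{\mathbb{F}}_p$. Let $G=\mathrm{GL}_2(F)$, $K=\mathrm{GL}_2(\mathcal{O}_F)$, $Z$ the centre of $G$, and let $I(1)\subset K$ be the subgroup of matrices that are upper triangular unipotent modulo $\pi$. Let $2<r_j<p-3$ for $0\le j\le f-1$ and $0\le w\le q-2$, and let $$\sigma=\bigotimes_{j=0}^{f-1}\bigl(\mathrm{Sym}^{r_j}\,\overline{\mathbb{F}}_p^{\,2}\bigr)^{\mathrm{Frob}^j}\otimes\det{}^{w},$$ with basis the vectors $\bigotimes_j x_j^{r_j-i_j}y_j^{i_j}$ ($0\le i_j\le r_j$). Here $\left(\begin{smallmatrix}a&b\\c&d\end{smallmatrix}\right)\in K$ acts, apart from the factor $\det^w$, by $x_j\mapsto a^{p^j}x_j+c^{p^j}y_j$ and $y_j\mapsto b^{p^j}x_j+d^{p^j}y_j$ (entries reduced modulo $\pi$), and $\sigma$ is extended to $KZ$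 by letting $\pi\cdot\mathrm{Id}$ act trivially. Let $\mathrm{ind}_{KZ}^G\sigma$ be the compact induction: the functions $\varphi:G\to\sigma$ with $\varphi(hg)=\sigma(h)\varphi(g)$ for $h\in KZ$, supported on finitely many cosets $KZg$, with $G$ acting by right translation. For $g\in G$, $v\in\sigma$, let $g\otimes v$ be the function supported on $KZg^{-1}$ with $hg^{-1}\mapsto\sigma(h)v$. Let $T$ be the $G$-equivariant Hecke operator $$(T\varphi)(x)=\sum_{c\in K/(K\cap\delta K\delta^{-1})}\sigma(c)\,U\,\varphi\bigl((c\delta)^{-1}x\bigr),\qquad \delta=\begin{pmatrix}\pi&0\\0&1\end{pmatrix},$$ where $U$ is the projection of $\sigma$ that fixes $\bigotimes_j y_j^{r_j}$ and kills the other basis vectors. Let $\mathrm{ind}_{KZ}^G\sigma/(T)$ be the quotient by the image of $T$. For $n\ge1$ let $I_n=\{\sum_{i=0}^{n-1}\pi^i[\mu_i]:\mu_i\in\mathbb{F}_q\}$, where $[\cdot]$ is the Teichmüller lift, and put $g^0_{n,\mu}=\left(\begin{smallmatrix}\pi^n&\mu\\0&1\end{smallmatrix}\right)$. For $m\ge 1$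 and $0\le k\le f-1$ put $$s_n^{m}=\sum_{\mu\in I_n}g^0_{n,\mu}\otimes\mu_{n-1}^{m}\bigotimes_{j}x_j^{r_j},\qquad t_n^k=\sum_{\mu\in I_n}g^0_{n,\mu}\otimes\Bigl(\bigotimes_{j\ne k}x_j^{r_j}\Bigr)\otimes x_k^{r_k-1}y_k .$$ **Proposition 3.7.** In $\mathrm{ind}_{KZ}^G\sigma/(T)$ the following hold (elements of $\mathrm{ind}_{KZ}^G\sigma$ stand for their images, and the index $k+1$ is read modulo $f$). i) $\mathrm{Id}\otimes\bigotimes_j x_j^{r_j}$ generates an irreducible $KZ$-submodule isomorphic to $\sigma$, of dimension $\prod_{j}(r_j+1)$. ii) Let $0\le k\le f-1$ and $1\le t\le p-1-r_k$. If $f>1$ and $n\ge1$, and the image of $s_n^{p^k(r_k+t)}$ is $I(1)$-invariant, then it generates an irreducible $KZ$-submodule of dimension $$\Bigl(\prod_{j\ne k,k+1}(r_j+1)\Bigr)(p-r_k-t)\,r_{k+1}.$$ If $f=1$ (so that $k=0$; write $r=r_0$) and $n\ge2$, and the image of $s_n^{r+t}$ is $I(1)$-invariant, then it generates an irreducible $KZ$-submodule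 of dimension $p-r-t-1$. iii) Let $0\le k\le f-1$ and $n\ge1$. If the image of $t_n^k$ is $I(1)$-invariant, then it generates an irreducible $KZ$-submodule of dimension $\Bigl(\prod_{j\ne k}(r_j+1)\Bigr)(r_k-1)$. -/

import Mathlib

open IsLocalRing
open scoped MatrixGroups

set_option linter.unusedSectionVars false
set_option linter.unusedSimpArgs false

noncomputable section

section RingOfIntegers

variable (p : ℕ) [Fact p.Prime] (F : Type*) [Field F] [Algebra ℚ_[p] F]
  [FiniteDimensional ℚ_[p] F] [Algebra ℤ_[p] F] [IsScalarTower ℤ_[p] ℚ_[p] F]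

/-- The ring of integers `𝓞_F` of a finite extension `F` of `ℚ_[p]`: the integral closure of `ℤ_[p]`
in `F`. It is a discrete valuation ring with finite residue field, as shown below. -/
abbrev PadicRingOfIntegers : Type _ := integralClosure ℤ_[p] F

namespace PadicRingOfIntegers

instance instIsFractionRing : IsFractionRing (PadicRingOfIntegers p F) F :=
  integralClosure.isFractionRing_of_finite_extension ℚ_[p] F

theorem isIntegral_of_spectralNorm_le_one {x : F} (hx : spectralNorm ℚ_[p] F x ≤ 1) :
    IsIntegral ℤ_[p] x := by
  have halg : IsIntegral ℚ_[p] x := Algebra.IsIntegral.isIntegral x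
  have hmonic : (minpoly ℚ_[p] x).Monic := minpoly.monic halg
  rw [spectralNorm, spectralValue_le_one_iff hmonic] at hx
  have hlift : minpoly ℚ_[p] x ∈ Polynomial.lifts (algebraMap ℤ_[p] ℚ_[p]) := by
    rw [Polynomial.lifts_iff_coeff_lifts]
    intro n
    exact ⟨⟨_, hx n⟩, rfl⟩
  obtain ⟨P, hP, -, hPm⟩ := Polynomial.lifts_and_natDegree_eq_and_monic hlift hmonic
  refine ⟨P, hPm, ?_⟩
  rw [IsScalarTower.algebraMap_eq ℤ_[p] ℚ_[p] F, ← Polynomial.eval₂_map, hP]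
  exact minpoly.aeval _ _

instance instValuationRing : ValuationRing (PadicRingOfIntegers p F) := by
  rw [ValuationRing.iff_isInteger_or_isInteger _ F]
  intro x
  have key : ∀ y : F, spectralNorm ℚ_[p] F y ≤ 1 →
      IsLocalization.IsInteger (PadicRingOfIntegers p F) y := fun y hy =>
    ⟨⟨y, isIntegral_of_spectralNorm_le_one p F hy⟩, rfl⟩
  rcases eq_or_ne x 0 with rfl | hx
  · exact Or.inl (key 0 (by simp [spectralNorm_zero]))
  rcases le_total (spectralNorm ℚ_[p] F x) 1 with h | h
  · exact Or.inl (key x h)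
  · refine Or.inr (key _ ?_)
    have hm := spectralAlgNorm_mul (K := ℚ_[p]) x x⁻¹
    rw [mul_inv_cancel₀ hx, spectralAlgNorm_one] at hm
    simp only [spectralAlgNorm_def] at hm
    nlinarith [spectralNorm_nonneg (K := ℚ_[p]) (L := F) x⁻¹]

instance instModuleFinite : Module.Finite ℤ_[p] (PadicRingOfIntegers p F) :=
  IsIntegralClosure.finite ℤ_[p] ℚ_[p] F _

instance instIsDiscreteValuationRing : IsDiscreteValuationRing (PadicRingOfIntegers p F) := by
  have : IsNoetherianRing (PadicRingOfIntegers p F) := IsNoetherianRing.of_finite ℤ_[p] _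
  have hF : ¬ IsField (PadicRingOfIntegers p F) := by
    intro h
    have hinj : Function.Injective (algebraMap ℤ_[p] (PadicRingOfIntegers p F)) := by
      have h2 : Function.Injective (algebraMap ℤ_[p] F) := by
        rw [IsScalarTower.algebraMap_eq ℤ_[p] ℚ_[p] F]
        exact (algebraMap ℚ_[p] F).injective.comp (IsFractionRing.injective ℤ_[p] ℚ_[p])
      exact fun a b hab => h2 (congrArg Subtype.val hab)
    exact IsDiscreteValuationRing.not_isField ℤ_[p] (isField_of_isIntegral_of_isField hinj h)
  have h01 : IsDiscreteValuationRing (PadicRingOfIntegers p F) ↔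
      ValuationRing (PadicRingOfIntegers p F) :=
    (IsDiscreteValuationRing.TFAE (PadicRingOfIntegers p F) hF).out 0 1
  exact h01.mpr (instValuationRing p F)

instance instFiniteResidueField : Finite (ResidueField (PadicRingOfIntegers p F)) := by
  have : Finite (ResidueField ℤ_[p]) := Finite.of_equiv _ (PadicInt.residueField (p := p)).symm.toEquiv
  exact Module.finite_of_finite (ResidueField ℤ_[p])

end PadicRingOfIntegers
end RingOfIntegers
namespace SerreWeight

section Weight

variable {k : Type*} [Field k] (p : ℕ) [Fact p.Prime] [CharP k p] {f : ℕ}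
  {R : Type*} [CommRing R]

/-- Multidegree on polynomials in the variables `x_j = X (j, 0)` and `y_j = X (j, 1)`, for `j : Fin f`:
both `x_j` and `y_j` have multidegree the `j`-th unit vector. -/
abbrev degreeWeight (f : ℕ) (v : Fin f × Fin 2) : Fin f → ℕ := Pi.single v.1 1

/-- Polynomials that are homogeneous of degree `r j` in the pair `x_j, y_j`, for every `j`. -/
abbrev symSubmodule (k : Type*) [Field k] {f : ℕ} (r : Fin f → ℕ) :
    Submodule k (MvPolynomial (Fin f × Fin 2) k) :=
  MvPolynomial.weightedHomogeneousSubmodule k (degreeWeight f) r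

/-- The space `⨂_j Sym^{r_j} k²`, realised as the space of polynomials that are homogeneous of degree
`r j` in `x_j, y_j` for every `j`; the product of monomials `∏_j x_j^{r_j - a_j} y_j^{a_j}`
stands for the pure tensor `⨂_j x_j^{r_j - a_j} y_j^{a_j}`. -/
def SymSpace (k : Type*) [Field k] {f : ℕ} (r : Fin f → ℕ) : Type _ := symSubmodule k r

instance {k : Type*} [Field k] {f : ℕ} (r : Fin f → ℕ) : AddCommGroup (SymSpace k r) :=
  inferInstanceAs (AddCommGroup (symSubmodule k r))

instance {k : Type*} [Field k] {f : ℕ} (r : Fin f → ℕ) : Module k (SymSpace k r) :=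
  inferInstanceAs (Module k (symSubmodule k r))

/-- The ring homomorphism `χ` followed by the `j`-th power of the Frobenius of `k`. -/
def frobEmb (χ : R →+* k) (j : ℕ) : R →+* k := (iterateFrobenius k p j).comp χ

/-- The action of a `2 × 2` matrix on polynomials: `x_j ↦ a^{p^j} x_j + c^{p^j} y_j` and
`y_j ↦ b^{p^j} x_j + d^{p^j} y_j`, where `(a, b; c, d)` is the image of `g` under `χ`. -/
def substHom (f : ℕ) (χ : R →+* k) (g : Matrix (Fin 2) (Fin 2) R) :
    MvPolynomial (Fin f × Fin 2) k →ₐ[k] MvPolynomial (Fin f × Fin 2) k :=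
  MvPolynomial.aeval fun v =>
    ∑ l : Fin 2, MvPolynomial.C (frobEmb p χ v.1 (g l v.2)) * MvPolynomial.X (v.1, l)

theorem substHom_one (χ : R →+* k) : substHom p f χ 1 = AlgHom.id k _ := by
  apply MvPolynomial.algHom_ext
  rintro ⟨j, i⟩
  fin_cases i <;> simp [substHom, Fin.sum_univ_two]

theorem substHom_mul (χ : R →+* k) (g h : Matrix (Fin 2) (Fin 2) R) :
    substHom p f χ (g * h) = (substHom p f χ g).comp (substHom p f χ h) := by
  apply MvPolynomial.algHom_ext
  rintro ⟨j, i⟩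
  simp only [substHom, Fin.sum_univ_two, Matrix.mul_apply, map_add, map_mul, AlgHom.comp_apply,
    MvPolynomial.aeval_X, MvPolynomial.aeval_C, MvPolynomial.algebraMap_eq]
  ring

theorem substHom_mem (χ : R →+* k) (g : Matrix (Fin 2) (Fin 2) R) (r : Fin f → ℕ)
    {P : MvPolynomial (Fin f × Fin 2) k} (hP : P ∈ symSubmodule k r) :
    substHom p f χ g P ∈ symSubmodule k r := by
  have hX : ∀ v : Fin f × Fin 2, MvPolynomial.IsWeightedHomogeneous (degreeWeight f)
      (∑ l : Fin 2, MvPolynomial.C (frobEmb p χ v.1 (g l v.2)) * MvPolynomial.X (v.1, l) :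
        MvPolynomial (Fin f × Fin 2) k) (degreeWeight f v) := fun v =>
    MvPolynomial.IsWeightedHomogeneous.sum _ _ _ fun l _ =>
      (MvPolynomial.isWeightedHomogeneous_X k (degreeWeight f) (v.1, l)).C_mul _
  rw [P.as_sum, map_sum]
  refine Submodule.sum_mem _ fun d hd => ?_
  have hw := hP (MvPolynomial.mem_support_iff.mp hd)
  rw [MvPolynomial.monomial_eq, map_mul, MvPolynomial.mem_weightedHomogeneousSubmodule]
  simp only [substHom, Finsupp.prod, map_prod, map_pow, MvPolynomial.aeval_X,
    MvPolynomial.aeval_C, MvPolynomial.algebraMap_eq]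
  refine MvPolynomial.IsWeightedHomogeneous.C_mul ?_ _
  rw [← hw, Finsupp.weight_apply, Finsupp.sum]
  exact MvPolynomial.IsWeightedHomogeneous.prod _ _ _ fun v _ => (hX v).pow _

/-- The representation `⨂_j (Sym^{r_j} k²)^{Frob^j} ⊗ det^w` of `GL₂(R)`, through `χ : R → k`. -/
def weightRepAux (χ : R →+* k) (r : Fin f → ℕ) (w : ℕ) :
    Representation k (GL (Fin 2) R) (symSubmodule k r) where
  toFun g := χ (Matrix.GeneralLinearGroup.det g : R) ^ w •
    (substHom p f χ g).toLinearMap.restrict (p := symSubmodule k r) (q := symSubmodule k r)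
      fun _ hP => substHom_mem p χ g r hP
  map_one' := by
    ext P : 2
    simp [substHom_one, LinearMap.restrict_apply]
  map_mul' g h := by
    ext P : 2
    change χ ((g * h : GL (Fin 2) R) : Matrix (Fin 2) (Fin 2) R).det ^ w •
        substHom p f χ ((g * h : GL (Fin 2) R) : Matrix (Fin 2) (Fin 2) R) P =
      χ (g : Matrix (Fin 2) (Fin 2) R).det ^ w • substHom p f χ g
        (χ (h : Matrix (Fin 2) (Fin 2) R).det ^ w • substHom p f χ h P)
    rw [Units.val_mul, Matrix.det_mul, map_mul, mul_pow, substHom_mul, map_smul, mul_smul]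
    rfl

/-- The representation `⨂_j (Sym^{r_j} k²)^{Frob^j} ⊗ det^w` of `GL₂(R)` on `SymSpace k r`. -/
def weightRep (χ : R →+* k) (r : Fin f → ℕ) (w : ℕ) :
    Representation k (GL (Fin 2) R) (SymSpace k r) := weightRepAux p χ r w

/-- The monomial `∏_j x_j^{r_j - a_j} y_j^{a_j}`. -/
def symMonomial (k : Type*) [Field k] {f : ℕ} (r a : Fin f → ℕ) : 
  (MvPolynomial (Fin f × Fin 2) k) :=
  ∏ j, MvPolynomial.X (j, 0) ^ (r j - a j) * MvPolynomial.X (j, 1) ^ a j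

theorem symMonomial_mem (r a : Fin f → ℕ) (h : ∀ j, a j ≤ r j) : symMonomial k r a ∈ symSubmodule k r := by
  have h1 : ∀ j : Fin f, MvPolynomial.IsWeightedHomogeneous (degreeWeight f)
      (MvPolynomial.X (j, 0) ^ (r j - a j) * MvPolynomial.X (j, 1) ^ a j :
        MvPolynomial (Fin f × Fin 2) k) (Pi.single j (r j)) := by
    intro j
    have := ((MvPolynomial.isWeightedHomogeneous_X k (degreeWeight f) (j, 0)).pow (r j - a j)).mul
      ((MvPolynomial.isWeightedHomogeneous_X k (degreeWeight f) (j, 1)).pow (a j))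
    convert this using 1
    rw [← add_smul, Nat.sub_add_cancel (h j), ← Pi.single_smul]
    simp
  have := MvPolynomial.IsWeightedHomogeneous.prod Finset.univ _ _ fun j _ => h1 j
  rwa [Finset.univ_sum_single] at this

end Weight

section Weight2
variable {k : Type*} [Field k] (p : ℕ) [Fact p.Prime] [CharP k p] {f : ℕ}
  {R : Type*} [CommRing R]

/-- The vector `⨂_j x_j^{r_j - a_j} y_j^{a_j}`. -/
def symVec (k : Type*) [Field k] {f : ℕ} (r a : Fin f → ℕ) (h : ∀ j, a j ≤ r j) : SymSpace k r :=
  ⟨symMonomial k r a, symMonomial_mem r a h⟩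

/-- Evaluation of a polynomial at `x_j = 0`, `y_j = 1` for all `j`. -/
def evalY (k : Type*) [Field k] (f : ℕ) : MvPolynomial (Fin f × Fin 2) k →ₐ[k] k :=
  MvPolynomial.aeval fun v => if v.2 = 1 then 1 else 0

/-- On `SymSpace k r`, evaluation at `x_j = 0`, `y_j = 1` is the coefficient of `∏_j y_j^{r_j}`. -/
def evalYLin (k : Type*) [Field k] {f : ℕ} (r : Fin f → ℕ) : SymSpace k r →ₗ[k] k :=
  (evalY k f).toLinearMap.comp (symSubmodule k r).subtype

/-- The endomorphism of `SymSpace k r` that fixes `∏_j y_j^{r_j}` and kills the other monomials. -/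
def projY (k : Type*) [Field k] {f : ℕ} (r : Fin f → ℕ) : SymSpace k r →ₗ[k] SymSpace k r :=
  (evalYLin k r).smulRight (symVec k r r fun _ => le_rfl)

theorem evalY_substHom (χ : R →+* k) (g : Matrix (Fin 2) (Fin 2) R) (hg : χ (g 1 0) = 0)
    (r : Fin f → ℕ) {P : MvPolynomial (Fin f × Fin 2) k} (hP : P ∈ symSubmodule k r) :
    evalY k f (substHom p f χ g P) = (∏ j : Fin f, frobEmb p χ j (g 1 1) ^ r j) * evalY k f P := by
  rw [P.as_sum]
  simp only [map_sum, Finset.mul_sum]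
  refine Finset.sum_congr rfl fun d hd => ?_
  have hw := hP (MvPolynomial.mem_support_iff.mp hd)
  have hrj : ∀ j, d (j, 0) + d (j, 1) = r j := by
    intro j
    rw [← hw, Finsupp.weight_apply, Finsupp.sum_fintype _ _ (by simp), Finset.sum_apply,
      Fintype.sum_prod_type]
    simp [Pi.single_apply, Fin.sum_univ_two]
  have hg' : ∀ j, frobEmb p χ j (g 1 0) = 0 := fun j => by simp [frobEmb, hg]
  rw [MvPolynomial.monomial_eq, Finsupp.prod_fintype _ _ (by simp), Fintype.prod_prod_type]
  simp only [Fin.prod_univ_two, map_mul, map_prod, map_pow, substHom, evalY, MvPolynomial.aeval_X,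
    MvPolynomial.aeval_C, Fin.sum_univ_two, map_add, MvPolynomial.algHom_C, hg']
  have hC : (MvPolynomial.aeval fun v : Fin f × Fin 2 => if v.2 = 1 then (1 : k) else 0)
      (algebraMap k (MvPolynomial (Fin f × Fin 2) k) (MvPolynomial.coeff d P)) =
      MvPolynomial.coeff d P := by
    rw [MvPolynomial.algebraMap_eq, MvPolynomial.aeval_C, Algebra.algebraMap_self,
      RingHom.id_apply]
  rw [hC, mul_left_comm, ← Finset.prod_mul_distrib]
  congr 1
  refine Finset.prod_congr rfl fun j _ => ?_
  rw [← hrj j]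

  rcases Nat.eq_zero_or_pos (d (j, 0)) with h0 | h0
  · simp [h0]
  · simp [h0.ne']

theorem substHom_symVec (χ : R →+* k) (g : Matrix (Fin 2) (Fin 2) R) (hg : χ (g 0 1) = 0)
    (r : Fin f → ℕ) :
    substHom p f χ g (symMonomial k r r) =
      (∏ j : Fin f, frobEmb p χ j (g 1 1) ^ r j) • symMonomial k r r := by
  have hg' : ∀ j, frobEmb p χ j (g 0 1) = 0 := fun j => by simp [frobEmb, hg]
  simp only [symMonomial, substHom, map_prod, map_mul, map_pow, MvPolynomial.aeval_X,
    Fin.sum_univ_two, hg', Nat.sub_self, pow_zero, one_mul, map_zero, zero_mul, zero_add, mul_pow,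
    Finset.prod_mul_distrib, MvPolynomial.smul_eq_C_mul]

theorem weightRep_projY (χ : R →+* k) (r : Fin f → ℕ) (w : ℕ) (g h : GL (Fin 2) R)
    (hg : χ (g 0 1) = 0) (hh : χ (h 1 0) = 0) (h11 : χ (g 1 1) = χ (h 1 1))
    (hdet : χ (g : Matrix (Fin 2) (Fin 2) R).det = χ (h : Matrix (Fin 2) (Fin 2) R).det)
    (v : SymSpace k r) :
    weightRep p χ r w g (projY k r v) = projY k r (weightRep p χ r w h v) := by
  apply Subtype.ext
  have e11 : ∀ j, frobEmb p χ j (h 1 1) = frobEmb p χ j (g 1 1) := fun j => by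
    simp [frobEmb, h11]
  have A := evalY_substHom p χ (h : Matrix (Fin 2) (Fin 2) R) hh r v.2
  have B := substHom_symVec p χ (g : Matrix (Fin 2) (Fin 2) R) hg r
  change χ (g : Matrix (Fin 2) (Fin 2) R).det ^ w • substHom p f χ g
      (evalY k f v.1 • symMonomial k r r) =
    evalY k f (χ (h : Matrix (Fin 2) (Fin 2) R).det ^ w • substHom p f χ h v.1) • symMonomial k r r
  rw [map_smul, map_smul, A, B, hdet]
  simp only [e11, smul_smul, smul_eq_mul]
  congr 1
  ring
end Weight2

section CInd
variable {k G V : Type*} [Field k] [Group G] [AddCommGroup V] [Module k V]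
  (H : Subgroup G) (τ : Representation k H V)

/-- Compact induction from `H` to `G`: functions `φ` with `φ (h g) = τ h (φ g)` that are supported on
finitely many cosets `H s`. (The subgroup `H` is open where this is used, so that these functions are
automatically locally constant when `τ` is smooth.) -/
def cInd : Submodule k (G → V) where
  carrier := {φ | (∀ (h : H) (g : G), φ (h * g) = τ h (φ g)) ∧
    ∃ S : Set G, S.Finite ∧ ∀ g, φ g ≠ 0 → ∃ s ∈ S, ∃ h : H, g = h * s}
  zero_mem' := ⟨fun _ _ => by simp, ∅, Set.finite_empty, fun _ h => absurd rfl h⟩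
  add_mem' := by
    rintro φ ψ ⟨h1, S, hS, hS'⟩ ⟨h2, T, hT, hT'⟩
    refine ⟨fun h g => by simp [h1, h2], S ∪ T, hS.union hT, fun g hg => ?_⟩
    by_cases h0 : φ g = 0
    · have : ψ g ≠ 0 := fun h => hg (by simp [h0, h])
      obtain ⟨s, hs, h⟩ := hT' g this
      exact ⟨s, Or.inr hs, h⟩
    · obtain ⟨s, hs, h⟩ := hS' g h0
      exact ⟨s, Or.inl hs, h⟩
  smul_mem' := by
    rintro c φ ⟨h1, S, hS, hS'⟩
    refine ⟨fun h g => by simp [h1], S, hS, fun g hg => hS' g fun h0 => hg (by simp [h0])⟩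

/-- The group `G` acts on the compact induction by right translation. -/
def cIndRep : Representation k G (cInd H τ) where
  toFun g := (LinearMap.funLeft k V (· * g)).restrict (p := cInd H τ) (q := cInd H τ) (by
    rintro φ ⟨h1, S, hS, hS'⟩
    refine ⟨fun h x => ?_, (· * g⁻¹) '' S, hS.image _, fun x hx => ?_⟩
    · simp [LinearMap.funLeft_apply, mul_assoc, h1]
    · obtain ⟨s, hs, h, e⟩ := hS' _ hx
      exact ⟨s * g⁻¹, ⟨s, hs, rfl⟩, h, by rw [← mul_assoc, ← e]; simp⟩)
  map_one' := by ext φ x; simp [LinearMap.funLeft_apply, LinearMap.restrict_apply]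
  map_mul' a b := by
    ext φ x; simp [LinearMap.funLeft_apply, LinearMap.restrict_apply, mul_assoc]

open Classical in
/-- The element `g ⊗ v` of the compact induction: the function supported on `H g⁻¹` that sends
`h g⁻¹` to `τ h v`. -/
def tens (g : G) (v : V) : cInd H τ :=
  ⟨fun x => if hx : x * g ∈ H then τ ⟨x * g, hx⟩ v else 0, by
    refine ⟨fun h x => ?_, {g⁻¹}, Set.finite_singleton _, fun x hx => ?_⟩
    · by_cases hx : x * g ∈ H
      · have hx' : (h : G) * x * g ∈ H := by rw [mul_assoc]; exact H.mul_mem h.2 hx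
        have e : (⟨(h : G) * x * g, hx'⟩ : H) = h * ⟨x * g, hx⟩ := Subtype.ext (mul_assoc _ _ _)
        simp only [dif_pos hx, dif_pos hx', e, map_mul, Module.End.mul_apply]
      · have hx' : ¬ (h : G) * x * g ∈ H := by
          rwa [mul_assoc, Subgroup.mul_mem_cancel_left _ h.2]
        simp only [dif_neg hx, dif_neg hx', map_zero]
    · by_cases h : x * g ∈ H
      · exact ⟨g⁻¹, rfl, ⟨x * g, h⟩, by simp⟩
      · exact absurd (dif_neg h) hx⟩

/-- The `H`-subrepresentation generated by a vector `v` of a representation of `G`. -/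
def spanOf {W : Type*} [AddCommGroup W] [Module k W] (ρ : Representation k G W) (v : W) :
    Subrepresentation (ρ.comp H.subtype) where
  toSubmodule := Submodule.span k (Set.range fun h : H => ρ h v)
  apply_mem_toSubmodule g u hu := by
    induction hu using Submodule.span_induction with
    | mem u hu =>
      obtain ⟨h, rfl⟩ := hu
      exact Submodule.subset_span ⟨g * h, by simp⟩
    | zero => simp
    | add a b _ _ ha hb => rw [map_add]; exact Submodule.add_mem _ ha hb
    | smul c a _ ha => rw [map_smul]; exact Submodule.smul_mem _ c ha

end CInd

section Groups
variable (O F : Type*) [CommRing O] [IsDomain O] [IsDiscreteValuationRing O] [Field F] [Algebra O F]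
  [IsFractionRing O F]

/-- The inclusion of `K = GL₂(𝓞)` in `G = GL₂(F)`. -/
def embK : GL (Fin 2) O →* GL (Fin 2) F := Matrix.GeneralLinearGroup.map (algebraMap O F)

/-- The subgroup `KZ` of `GL₂(F)`, where `Z` is the centre. -/
def subgroupKZ : Subgroup (GL (Fin 2) F) :=
  (embK O F).range ⊔ Subgroup.center (GL (Fin 2) F)

variable {O}
/-- The uniformizer `π`, as a unit of `F`. -/
def unif {π : O} (hπ : Irreducible π) : Fˣ :=
  Units.mk0 (algebraMap O F π) (by
    rw [Ne, FaithfulSMul.algebraMap_eq_zero_iff]; exact hπ.ne_zero)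

/-- The scalar matrix `π · Id`. -/
def scalarUnif {π : O} (hπ : Irreducible π) : GL (Fin 2) F :=
  Matrix.GeneralLinearGroup.scalar (Fin 2) (unif F hπ)

variable {F}
theorem exists_unit_zpow {π : O} (hπ : Irreducible π) (z : Fˣ) :
    ∃ (u : Oˣ) (n : ℤ), z = Units.map (algebraMap O F : O →* F) u * unif F hπ ^ n := by
  obtain ⟨a, b, hb, hz⟩ := IsFractionRing.div_surjective (A := O) (z : F)
  have ha0 : a ≠ 0 := by rintro rfl; simp at hz; exact z.ne_zero hz.symm
  have hb0 : b ≠ 0 := nonZeroDivisors.ne_zero hb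
  obtain ⟨m, u, rfl⟩ := IsDiscreteValuationRing.eq_unit_mul_pow_irreducible ha0 hπ
  obtain ⟨n, v, rfl⟩ := IsDiscreteValuationRing.eq_unit_mul_pow_irreducible hb0 hπ
  refine ⟨u * v⁻¹, (m : ℤ) - n, ?_⟩
  have hπF : algebraMap O F π ≠ 0 := (unif F hπ).ne_zero
  have hv : algebraMap O F v ≠ 0 := (Units.map (algebraMap O F : O →* F) v).ne_zero
  ext
  have hvi : algebraMap O F ((v⁻¹ : Oˣ) : O) = (algebraMap O F v)⁻¹ := by
    refine eq_inv_of_mul_eq_one_left ?_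
    rw [← map_mul]; simp
  rw [← hz, zpow_sub]
  simp [unif, hvi]
  field_simp

theorem embK_injective : Function.Injective (embK O F) := by
  intro a b h
  ext i j
  have := congrArg (fun x : GL (Fin 2) F => x.val i j) h
  exact IsFractionRing.injective O F this

theorem scalarUnif_zpow_mem_range {π : O} (hπ : Irreducible π) {n : ℤ}
    (h : scalarUnif F hπ ^ n ∈ (embK O F).range) : n = 0 := by
  wlog hn : 0 ≤ n generalizing n
  · have := this (n := -n) (by rw [zpow_neg]; exact inv_mem h) (by omega)
    omega
  obtain ⟨m, rfl⟩ := Int.eq_ofNat_of_zero_le hn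
  obtain ⟨a, ha⟩ := h
  by_contra hm
  have hm' : m ≠ 0 := by simpa using hm
  have h1 : (algebraMap O F) (a : Matrix (Fin 2) (Fin 2) O).det = algebraMap O F ((π ^ m) ^ 2) := by
    have := congrArg (fun x : GL (Fin 2) F => (Matrix.GeneralLinearGroup.det x : F)) ha
    simp only [embK, Matrix.GeneralLinearGroup.map_det] at this
    simp [scalarUnif, unif] at this
    simpa [pow_right_comm] using this
  have h2 := IsFractionRing.injective O F h1
  have h3 : IsUnit ((π ^ m) ^ 2) := h2 ▸ (Matrix.GeneralLinearGroup.det a).isUnit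
  rw [isUnit_pow_iff two_ne_zero, isUnit_pow_iff hm'] at h3
  exact hπ.not_isUnit h3

theorem scalarUnif_comm {π : O} (hπ : Irreducible π) (n : ℤ) (x : GL (Fin 2) F) :
    Commute (scalarUnif F hπ ^ n) x :=
  Commute.zpow_left (Matrix.GeneralLinearGroup.scalar_commute _ _) n

theorem exists_decomp {π : O} (hπ : Irreducible π) (h : subgroupKZ O F) :
    ∃ a : GL (Fin 2) O, ∃ n : ℤ, (h : GL (Fin 2) F) = embK O F a * scalarUnif F hπ ^ n := by
  obtain ⟨x, ⟨a, rfl⟩, z, hz, e⟩ := Subgroup.mem_sup_of_normal_right.mp h.2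
  rw [Matrix.GeneralLinearGroup.center_eq_range_scalar] at hz
  obtain ⟨z, rfl⟩ := hz
  obtain ⟨u, n, rfl⟩ := exists_unit_zpow hπ z
  refine ⟨a * Matrix.GeneralLinearGroup.scalar (Fin 2) u, n, ?_⟩
  have e2 : embK O F (Matrix.GeneralLinearGroup.scalar (Fin 2) u) =
      Matrix.GeneralLinearGroup.scalar (Fin 2) (Units.map (algebraMap O F : O →* F) u) :=
    Matrix.GeneralLinearGroup.map_scalar _ _
  rw [← e, map_mul, map_mul, map_zpow, e2, mul_assoc]
  rfl

theorem decomp_unique {π : O} (hπ : Irreducible π) {a b : GL (Fin 2) O} {m n : ℤ}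
    (h : embK O F a * scalarUnif F hπ ^ m = embK O F b * scalarUnif F hπ ^ n) : a = b := by
  have h1 : scalarUnif F hπ ^ (m - n) = embK O F (a⁻¹ * b) := by
    rw [zpow_sub, map_mul, map_inv, eq_inv_mul_iff_mul_eq, ← mul_assoc, h, mul_inv_cancel_right]
  have h2 := scalarUnif_zpow_mem_range hπ (n := m - n) ⟨_, h1.symm⟩
  rw [h2, zpow_zero, ← map_one (embK O F)] at h1
  exact (inv_mul_eq_one.mp (embK_injective h1.symm))

/-- The projection `KZ → K` that is the identity on `K` and kills `π · Id`, using that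
`KZ = K × (π · Id)^ℤ`. -/
def partK {π : O} (hπ : Irreducible π) : subgroupKZ O F →* GL (Fin 2) O :=
  MonoidHom.mk' (fun h => (exists_decomp hπ h).choose) fun g h => by
    obtain ⟨m, hm⟩ := (exists_decomp hπ g).choose_spec
    obtain ⟨n, hn⟩ := (exists_decomp hπ h).choose_spec
    obtain ⟨l, hl⟩ := (exists_decomp hπ (g * h)).choose_spec
    refine decomp_unique (F := F) hπ (m := l) (n := m + n) ?_
    rw [← hl, Subgroup.coe_mul]
    conv_lhs => rw [hm, hn]
    rw [map_mul, zpow_add, mul_assoc, mul_assoc, ← mul_assoc (scalarUnif F hπ ^ m),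
      (scalarUnif_comm hπ m _).eq, mul_assoc]


theorem partK_embK {π : O} (hπ : Irreducible π) (a : GL (Fin 2) O)
    (h : embK O F a ∈ subgroupKZ O F) : partK hπ ⟨embK O F a, h⟩ = a := by
  obtain ⟨n, hn⟩ := (exists_decomp hπ (⟨embK O F a, h⟩ : subgroupKZ O F)).choose_spec
  refine decomp_unique (F := F) hπ (m := n) (n := 0) ?_
  rw [zpow_zero, mul_one]
  exact hn.symm

theorem partK_of_eq {π : O} (hπ : Irreducible π) (h : subgroupKZ O F) (a : GL (Fin 2) O) (n : ℤ)
    (e : (h : GL (Fin 2) F) = embK O F a * scalarUnif F hπ ^ n) : partK hπ h = a := by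
  obtain ⟨m, hm⟩ := (exists_decomp hπ h).choose_spec
  exact decomp_unique (F := F) hπ (hm.symm.trans e)

theorem embK_mem (a : GL (Fin 2) O) : embK O F a ∈ subgroupKZ O F :=
  Subgroup.mem_sup_left ⟨a, rfl⟩

theorem scalarUnif_zpow_mem {π : O} (hπ : Irreducible π) (n : ℤ) :
    scalarUnif F hπ ^ n ∈ subgroupKZ O F :=
  Subgroup.zpow_mem _ (Subgroup.mem_sup_right (by
    rw [Matrix.GeneralLinearGroup.center_eq_range_scalar]; exact ⟨_, rfl⟩)) n

variable (F) in
/-- The matrix `g⁰_{n, μ} = (π^n, μ; 0, 1)`. -/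
def cosetMat {π : O} (hπ : Irreducible π) (n : ℕ) (μ : O) : GL (Fin 2) F :=
  Matrix.GeneralLinearGroup.mkOfDetNeZero
    !![algebraMap O F π ^ n, algebraMap O F μ; 0, 1] (by
      rw [Matrix.det_fin_two_of, mul_one, mul_zero, sub_zero]
      exact pow_ne_zero _ (unif F hπ).ne_zero)

/-- Lower triangular matrices. -/
def lowerTri (κ : Type*) [Field κ] : Subgroup (GL (Fin 2) κ) where
  carrier := {g | g 0 1 = 0}
  one_mem' := by simp
  mul_mem' := by
    intro a b (ha : a 0 1 = 0) (hb : b 0 1 = 0)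
    simp [Matrix.mul_apply, Fin.sum_univ_two, ha, hb]
  inv_mem' := by
    intro a (ha : a 0 1 = 0)
    simp [Matrix.inv_def, Matrix.adjugate_fin_two, ha]

/-- Reduction of `GL₂(𝓞)` modulo the maximal ideal. -/
def redGL (O : Type*) [CommRing O] [IsLocalRing O] : GL (Fin 2) O →* GL (Fin 2) (ResidueField O) :=
  Matrix.GeneralLinearGroup.map (residue O)

/-- The matrices in `GL₂(𝓞)` that are lower triangular modulo the maximal ideal; this is the
intersection of `K` and `δ K δ⁻¹` for `δ = diag(π, 1)`. -/
def subgroupK₀ (O : Type*) [CommRing O] [IsLocalRing O] : Subgroup (GL (Fin 2) O) :=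
  (lowerTri (ResidueField O)).comap (redGL O)

theorem mem_subgroupK₀ (h : GL (Fin 2) O) : h ∈ subgroupK₀ O ↔ residue O (h 0 1) = 0 := Iff.rfl

instance [Finite (ResidueField O)] : Finite (GL (Fin 2) O ⧸ subgroupK₀ O) := by
  have : (subgroupK₀ O).FiniteIndex := by
    have h1 : Finite (GL (Fin 2) (ResidueField O)) :=
      Finite.of_injective (fun g => (g : Matrix (Fin 2) (Fin 2) (ResidueField O)))
        fun _ _ h => Units.ext h
    exact ⟨by
      rw [subgroupK₀, Subgroup.index_comap]
      exact Subgroup.index_ne_zero_of_finite⟩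
  infer_instance

theorem coe_mkGL {A : Type*} [CommRing A] (M : Matrix (Fin 2) (Fin 2) A) (h : IsUnit M.det) :
    ((Matrix.GeneralLinearGroup.mk'' M h : GL (Fin 2) A) : Matrix (Fin 2) (Fin 2) A) = M := rfl

theorem conj_cosetMat {π : O} (hπ : Irreducible π) (h : GL (Fin 2) O) (hh : h ∈ subgroupK₀ O) :
    ∃ h' : GL (Fin 2) O, embK O F h * cosetMat F hπ 1 0 = cosetMat F hπ 1 0 * embK O F h' ∧
      h' 1 1 = h 1 1 ∧ residue O (h' 1 0) = 0 ∧
      (h' : Matrix (Fin 2) (Fin 2) O).det = (h : Matrix (Fin 2) (Fin 2) O).det := by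
  rw [mem_subgroupK₀, residue_eq_zero_iff, hπ.maximalIdeal_eq, Ideal.mem_span_singleton] at hh
  obtain ⟨b, hb⟩ := hh
  have hdet : (!![h 0 0, b; π * h 1 0, h 1 1] : Matrix (Fin 2) (Fin 2) O).det =
      (h : Matrix (Fin 2) (Fin 2) O).det := by
    rw [Matrix.det_fin_two_of, Matrix.det_fin_two, hb]; ring
  refine ⟨Matrix.GeneralLinearGroup.mk'' !![h 0 0, b; π * h 1 0, h 1 1]
    (hdet ▸ (Matrix.GeneralLinearGroup.det h).isUnit), ?_, rfl, ?_, hdet⟩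
  · ext i j
    fin_cases i <;> fin_cases j <;>
      simp [Matrix.mul_apply, Fin.sum_univ_two, cosetMat, embK,
        Matrix.GeneralLinearGroup.mkOfDetNeZero, coe_mkGL, hb, mul_comm]
  · change residue O (π * h 1 0) = 0
    rw [residue_eq_zero_iff, hπ.maximalIdeal_eq, Ideal.mem_span_singleton]
    exact dvd_mul_right _ _

end Groups

section Teichmuller
variable {O : Type*} [CommRing O] [IsLocalRing O]

/-- The Teichmüller representative of `μ`: the unique `x` with `x^q = x` and reduction `μ`, where
`q` is the cardinality of the residue field. (It exists and is unique when `𝓞` is complete.) -/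
def teichmuller (μ : ResidueField O) : O :=
  Classical.epsilon fun x : O => x ^ Nat.card (ResidueField O) = x ∧ residue O x = μ

/-- The element `[μ_0] + π [μ_1] + ⋯ + π^{n-1} [μ_{n-1}]` of `𝓞`. When `μ` runs over all `n`-tuples, this
runs over the set `I_n` of representatives of `𝓞 / π^n`. -/
def digitSum (π : O) {n : ℕ} (μ : Fin n → ResidueField O) : O :=
  ∑ i : Fin n, π ^ (i : ℕ) * teichmuller (μ i)
end Teichmuller

section Hecke
variable {O F : Type*} [CommRing O] [IsDomain O] [IsDiscreteValuationRing O] [Field F]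
  [Algebra O F] [IsFractionRing O F]
  {k : Type*} [Field k] (p : ℕ) [Fact p.Prime] [CharP k p] {f : ℕ}
  {π : O} (hπ : Irreducible π) (ι : ResidueField O →+* k) (r : Fin f → ℕ) (w : ℕ)

/-- The weight `σ` as a representation of `K`, through the reduction of `K` modulo `π`. -/
def sigmaK : Representation k (GL (Fin 2) O) (SymSpace k r) :=
  weightRep p (ι.comp (residue O)) r w

variable (F) in
/-- The weight `σ` as a representation of `KZ`: the matrix `π · Id` acts trivially. -/
def sigma : Representation k (subgroupKZ O F) (SymSpace k r) :=
  (sigmaK p ι r w).comp (partK hπ)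

variable (F) in
/-- The compact induction of `σ` from `KZ` to `G`. -/
abbrev indSigma :=
  cInd (subgroupKZ O F) (sigma F p hπ ι r w)

variable {p hπ ι r w}

theorem indSigma_embK (φ : indSigma F p hπ ι r w) (a : GL (Fin 2) O) (x : GL (Fin 2) F) :
    φ.1 (embK O F a * x) = sigmaK p ι r w a (φ.1 x) := by
  have := φ.2.1 ⟨embK O F a, embK_mem a⟩ x
  rwa [sigma, MonoidHom.comp_apply, partK_embK] at this

theorem indSigma_scalar (φ : indSigma F p hπ ι r w) (n : ℤ) (x : GL (Fin 2) F) :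
    φ.1 (scalarUnif F hπ ^ n * x) = φ.1 x := by
  have := φ.2.1 ⟨scalarUnif F hπ ^ n, scalarUnif_zpow_mem hπ n⟩ x
  rwa [sigma, MonoidHom.comp_apply, partK_of_eq hπ _ 1 n (by simp), map_one] at this

theorem heckeTerm_well_defined (φ : indSigma F p hπ ι r w) (x : GL (Fin 2) F)
    (a h : GL (Fin 2) O) (hh : h ∈ subgroupK₀ O) :
    sigmaK p ι r w (a * h) (projY k r (φ.1 ((embK O F (a * h) * cosetMat F hπ 1 0)⁻¹ * x))) =
      sigmaK p ι r w a (projY k r (φ.1 ((embK O F a * cosetMat F hπ 1 0)⁻¹ * x))) := by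
  obtain ⟨h', e, h11, h10, hdet⟩ := conj_cosetMat (F := F) hπ h hh
  have e1 : (embK O F (a * h) * cosetMat F hπ 1 0)⁻¹ * x =
      embK O F h'⁻¹ * ((embK O F a * cosetMat F hπ 1 0)⁻¹ * x) := by
    rw [map_mul (embK O F), mul_assoc, e, ← mul_assoc, mul_inv_rev, ← map_inv, mul_assoc]
  rw [e1, indSigma_embK, map_mul (sigmaK p ι r w), Module.End.mul_apply]
  congr 1
  rw [sigmaK, weightRep_projY p _ r w h h' (by simpa [mem_subgroupK₀] using hh) (by simp [h10])
    (by simp [h11]) (by rw [hdet]), Representation.self_inv_apply]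

/-- The contribution of a coset `c K₀` to the Hecke operator, see `heckeT`. -/
def heckeTerm (φ : indSigma F p hπ ι r w) (x : GL (Fin 2) F) :
    GL (Fin 2) O ⧸ subgroupK₀ O → SymSpace k r :=
  Quotient.lift
    (fun a => sigmaK p ι r w a (projY k r (φ.1 ((embK O F a * cosetMat F hπ 1 0)⁻¹ * x))))
    (by
      intro a b hab
      have hab' : a⁻¹ * b ∈ subgroupK₀ O := QuotientGroup.leftRel_apply.mp hab
      have := heckeTerm_well_defined φ x a (a⁻¹ * b) hab'
      rw [mul_inv_cancel_left] at this
      exact this.symm)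

theorem heckeTerm_mk (φ : indSigma F p hπ ι r w) (x : GL (Fin 2) F) (a : GL (Fin 2) O) :
    heckeTerm φ x (a : GL (Fin 2) O ⧸ subgroupK₀ O) =
      sigmaK p ι r w a (projY k r (φ.1 ((embK O F a * cosetMat F hπ 1 0)⁻¹ * x))) := rfl

theorem heckeTerm_mul (φ : indSigma F p hπ ι r w) (x : GL (Fin 2) F) (a : GL (Fin 2) O) (n : ℤ)
    (c : GL (Fin 2) O ⧸ subgroupK₀ O) :
    heckeTerm φ (embK O F a * scalarUnif F hπ ^ n * x) (a • c) =
      sigmaK p ι r w a (heckeTerm φ x c) := by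
  induction c using QuotientGroup.induction_on with
  | H b =>
    have e1 : (embK O F (a * b) * cosetMat F hπ 1 0)⁻¹ * (embK O F a * scalarUnif F hπ ^ n * x) =
        scalarUnif F hπ ^ n * ((embK O F b * cosetMat F hπ 1 0)⁻¹ * x) := by
      rw [← (scalarUnif_comm hπ n (embK O F a)).eq, ← mul_assoc, ← mul_assoc,
        ← (scalarUnif_comm hπ n _).eq, map_mul]
      group
    rw [MulAction.Quotient.smul_coe, smul_eq_mul, heckeTerm_mk, heckeTerm_mk, e1, indSigma_scalar,
      map_mul (sigmaK p ι r w), Module.End.mul_apply]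

theorem cosetMat_weyl : ∃ s : GL (Fin 2) O, s * s = 1 ∧
    cosetMat F hπ 1 0 = scalarUnif F hπ ^ (1 : ℤ) *
      (embK O F s * (cosetMat F hπ 1 0)⁻¹ * embK O F s) := by
  refine ⟨Matrix.GeneralLinearGroup.mk'' !![0, 1; 1, 0] (by simp), ?_, ?_⟩
  · ext i j
    fin_cases i <;> fin_cases j <;>
      simp [Matrix.mul_apply, Fin.sum_univ_two, coe_mkGL]
  · have hπF : algebraMap O F π ≠ 0 := (unif F hπ).ne_zero
    ext i j
    fin_cases i <;> fin_cases j <;>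
      simp [Matrix.mul_apply, Fin.sum_univ_two, cosetMat, embK, Matrix.inv_def,
        Matrix.adjugate_fin_two, scalarUnif, unif,
        Matrix.GeneralLinearGroup.mkOfDetNeZero, coe_mkGL, hπF]

variable [Finite (ResidueField O)]

theorem hecke_mem (φ : indSigma F p hπ ι r w) :
    (fun x => ∑ᶠ c, heckeTerm φ x c) ∈ indSigma F p hπ ι r w := by
  obtain ⟨S, hS, hS'⟩ := φ.2.2
  refine ⟨fun h x => ?_, ⋃ c : GL (Fin 2) O ⧸ subgroupK₀ O,
    (fun s => (cosetMat F hπ 1 0)⁻¹ * ((embK O F c.out)⁻¹ * s)) '' S,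
    Set.finite_iUnion fun c => hS.image _, fun x hx => ?_⟩
  · obtain ⟨a, n, e⟩ := exists_decomp hπ h
    rw [e, sigma, MonoidHom.comp_apply, partK_of_eq hπ h a n e]
    change ∑ᶠ c, heckeTerm φ _ c = sigmaK p ι r w a (∑ᶠ c, heckeTerm φ x c)
    rw [← finsum_comp_equiv (MulAction.toPerm a), map_finsum _ (Set.toFinite _)]
    exact finsum_congr fun c => heckeTerm_mul φ x a n c
  · obtain ⟨c, hc⟩ : ∃ c, heckeTerm φ x c ≠ 0 := by
      by_contra! h0
      exact hx (finsum_eq_zero_of_forall_eq_zero h0)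
    induction c using QuotientGroup.induction_on with
    | H b =>
      have hφ : φ.1 ((embK O F b * cosetMat F hπ 1 0)⁻¹ * x) ≠ 0 := by
        intro h0
        apply hc
        rw [heckeTerm_mk, h0, map_zero, map_zero]
      obtain ⟨s, hs, h, e⟩ := hS' _ hφ
      obtain ⟨a, n, ha⟩ := exists_decomp hπ h
      obtain ⟨t, ht, et⟩ := cosetMat_weyl (F := F) (hπ := hπ)
      obtain ⟨c, hcdef⟩ : ∃ c : GL (Fin 2) O ⧸ subgroupK₀ O,
          c = QuotientGroup.mk (t * a)⁻¹ := ⟨_, rfl⟩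
      obtain ⟨⟨h0, hh0⟩, eh0⟩ := QuotientGroup.mk_out_eq_mul (subgroupK₀ O) ((t * a)⁻¹)
      obtain ⟨h1, e1, -⟩ := conj_cosetMat (F := F) hπ h0 hh0
      refine ⟨_, Set.mem_iUnion.mpr ⟨c, s, hs, rfl⟩, ?_⟩
      rw [inv_mul_eq_iff_eq_mul, ha] at e
      refine ⟨⟨embK O F (b * t * h1) * scalarUnif F hπ ^ (n + 1),
        mul_mem (embK_mem _) (scalarUnif_zpow_mem hπ _)⟩, ?_⟩
      have e3 : embK O F h1 = (cosetMat F hπ 1 0)⁻¹ * (embK O F h0 * cosetMat F hπ 1 0) := by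
        rw [e1, inv_mul_cancel_left]
      have e4 : embK O F c.out = (embK O F t * embK O F a)⁻¹ * embK O F h0 := by
        rw [hcdef, eh0, map_mul, map_inv, map_mul]
      have e5 : x = scalarUnif F hπ ^ (n + 1) * (embK O F b * embK O F t *
          (cosetMat F hπ 1 0)⁻¹ * (embK O F t * embK O F a) * s) := by
        generalize (cosetMat F hπ 1 0) = δ at et e ⊢
        have c1 := scalarUnif_comm (F := F) hπ 1
        have cn := scalarUnif_comm (F := F) hπ n
        rw [e, zpow_add]
        generalize scalarUnif F hπ ^ (1 : ℤ) = z1 at et c1 ⊢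
        generalize scalarUnif F hπ ^ n = zn at cn ⊢
        generalize embK O F a = A
        generalize embK O F b = B at *
        generalize embK O F t = T at *
        conv_lhs => rw [et]
        calc B * (z1 * (T * δ⁻¹ * T)) * (A * zn * s)
            = B * z1 * (T * δ⁻¹ * T * A) * zn * s := by simp only [mul_assoc]
          _ = zn * (B * z1 * (T * δ⁻¹ * T * A)) * s := by rw [(cn _).eq]
          _ = zn * (z1 * B * (T * δ⁻¹ * T * A)) * s := by rw [(c1 B).eq]
          _ = zn * z1 * (B * T * δ⁻¹ * (T * A) * s) := by simp only [mul_assoc]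
      change x = embK O F (b * t * h1) * scalarUnif F hπ ^ (n + 1) * _
      rw [e5, ← (scalarUnif_comm hπ (n + 1) (embK O F (b * t * h1))).eq, map_mul, map_mul, e3, e4]
      simp only [mul_inv_rev, mul_assoc, mul_inv_cancel_left, inv_inv]


variable (F p hπ ι r w) in
/-- The Hecke operator `T`. With `δ = diag(π, 1)` and with `U` the projection of the weight to
`∏_j y_j^{r_j}`, it is `(T φ)(x) = ∑_{c ∈ K / (K ∩ δ K δ⁻¹)} σ(c) U φ((c δ)⁻¹ x)`. This is the operator
that corresponds to the `KZ`-biequivariant function on `G` supported on `KZ δ KZ` with value `U` at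
`δ`; explicitly, `T (1 ⊗ v) = ∑_c c δ ⊗ V (σ(c)⁻¹ v)` with `V` the projection to `∏_j x_j^{r_j}`. -/
def heckeT : indSigma F p hπ ι r w →ₗ[k] indSigma F p hπ ι r w where
  toFun φ := ⟨fun x => ∑ᶠ c, heckeTerm φ x c, hecke_mem φ⟩
  map_add' φ ψ := by
    apply Subtype.ext
    funext x
    change ∑ᶠ c, heckeTerm (φ + ψ) x c = ∑ᶠ c, heckeTerm φ x c + ∑ᶠ c, heckeTerm ψ x c
    rw [← finsum_add_distrib (Set.toFinite _) (Set.toFinite _)]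
    refine finsum_congr fun c => ?_
    induction c using QuotientGroup.induction_on with
    | H b =>
      rw [heckeTerm_mk, heckeTerm_mk, heckeTerm_mk, ← map_add, ← map_add]
      rfl
  map_smul' c φ := by
    apply Subtype.ext
    funext x
    change ∑ᶠ d, heckeTerm (c • φ) x d = c • ∑ᶠ d, heckeTerm φ x d
    rw [smul_finsum' _ (Set.toFinite _)]
    refine finsum_congr fun d => ?_
    induction d using QuotientGroup.induction_on with
    | H b =>
      rw [heckeTerm_mk, heckeTerm_mk, ← map_smul, ← map_smul]
      rfl

theorem heckeT_comm (g : GL (Fin 2) F) (φ : indSigma F p hπ ι r w) :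
    heckeT F p hπ ι r w (cIndRep (subgroupKZ O F) (sigma F p hπ ι r w) g φ) =
      cIndRep (subgroupKZ O F) (sigma F p hπ ι r w) g (heckeT F p hπ ι r w φ) := by
  apply Subtype.ext
  funext x
  change ∑ᶠ c, heckeTerm _ x c = ∑ᶠ c, heckeTerm φ (x * g) c
  refine finsum_congr fun c => ?_
  induction c using QuotientGroup.induction_on with
  | H b =>
    rw [heckeTerm_mk, heckeTerm_mk, ← mul_assoc]
    rfl

variable (F p hπ ι r w)

/-- The quotient `ind σ / (T)` of the compact induction by the image of `T`. -/
abbrev IndModT : Type _ :=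
  indSigma F p hπ ι r w ⧸ LinearMap.range (heckeT F p hπ ι r w)

/-- The action of `G` on `ind σ / (T)`. -/
def indModTRep : Representation k (GL (Fin 2) F) (IndModT F p hπ ι r w) :=
  (cIndRep (subgroupKZ O F) (sigma F p hπ ι r w)).quotient
    (LinearMap.range (heckeT F p hπ ι r w)) (by
      rintro g _ ⟨φ, rfl⟩
      exact ⟨_, heckeT_comm g φ⟩)

/-- Invariance under `I(1)`, the subgroup of matrices in `K` that are upper triangular unipotent modulo
the maximal ideal. -/
def IsI1Invariant (v : IndModT F p hπ ι r w) : Prop :=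
  ∀ a : GL (Fin 2) O, residue O (a 0 0) = 1 → residue O (a 1 0) = 0 → residue O (a 1 1) = 1 →
    indModTRep F p hπ ι r w (embK O F a) v = v

/-- The `KZ`-submodule of `ind σ / (T)` generated by the image of `φ`. -/
def genKZ (φ : indSigma F p hπ ι r w) :
    Subrepresentation ((indModTRep F p hπ ι r w).comp (subgroupKZ O F).subtype) :=
  spanOf (subgroupKZ O F) (indModTRep F p hπ ι r w) (Submodule.Quotient.mk φ)

variable {F} in
/-- The element `g ⊗ v` of the compact induction of `σ`. -/
def tensor (g : GL (Fin 2) F) (v : SymSpace k r) : indSigma F p hπ ι r w :=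
  tens (subgroupKZ O F) (sigma F p hπ ι r w) g v

/-- The vector `⨂_j x_j^{r_j}`. -/
def highestVec : SymSpace k r := symVec k r 0 fun _ => Nat.zero_le _

/-- The element `Id ⊗ ⨂_j x_j^{r_j}`. -/
def elt₀ : indSigma F p hπ ι r w := tensor p hπ ι r w 1 (highestVec r)

/-- The element `s_n^m = ∑_{μ ∈ I_n} g⁰_{n, μ} ⊗ μ_{n-1}^m ⨂_j x_j^{r_j}`. -/
def sElt (n : ℕ) (hn : 1 ≤ n) (m : ℕ) : indSigma F p hπ ι r w :=
  ∑ᶠ μ : Fin n → ResidueField O,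
    tensor p hπ ι r w (cosetMat F hπ n (digitSum π μ))
      (ι (μ ⟨n - 1, Nat.sub_lt hn one_pos⟩) ^ m • highestVec r)

/-- The element `t_n^j = ∑_{μ ∈ I_n} g⁰_{n, μ} ⊗ (⨂_{i ≠ j} x_i^{r_i}) ⊗ x_j^{r_j - 1} y_j`. -/
def tElt (n : ℕ) (j : Fin f) (hj : 1 ≤ r j) : indSigma F p hπ ι r w :=
  ∑ᶠ μ : Fin n → ResidueField O,
    tensor p hπ ι r w (cosetMat F hπ n (digitSum π μ))
      (symVec k r (Pi.single j 1) fun i => by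
        rcases eq_or_ne i j with rfl | h
        · simpa using hj
        · simp [h])

end Hecke
end SerreWeight
end

/-!
All the submodules are recognised by one criterion, `exists_embedding_of_expansion`. Let `v ≠ 0` be
an `I(1)`-invariant vector of a representation of `K` on which the torus acts by the character
`diag(a, d) ↦ a^A (ad)^w'`, where `A` stands for `∑_j A_j p^j` with `A_j < p - 1`. If the translates
`(λ, -1; 1, 0) v`, for Teichmüller representatives `λ`, are a polynomial in `λ` whose exponents are
`∑_j b_j p^j` with `b_j ≤ A_j`, then `v` generates a copy of the weight with exponents `A_j` and
twist `w'`: the linear map that sends the expansion of the big cell on `⨂_j x_j^{A_j}` to the one on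
`v` is `K`-equivariant. The weight is irreducible of dimension `∏_j (A_j + 1)`; as `Z` acts by
scalars, `K` may be replaced by `KZ`.

**The quotient by `T`.** The operator `T` enlarges supports on the tree of `GL₂(F)`
(`InBall.of_heckeT`), and on the outermost sphere the values of `T ψ` on the neighbours of a vertex
are polynomials with exponents at most `r`, times `⨂_j x_j^{r_j}` (`exists_of_mem_range`). So `σ`
embeds in the quotient, which is the first part, and the elements `s_n^m` and `t_n^k` are nonzero.
Conversely, let `fib n x P` be the combination with coefficients `P(t)` of the outer neighbours
`g_{n+1, x + π^n [t]} ⊗ ⨂_j x_j^{r_j}` of `g_{n,x}`. Then `T (g_{n,x} ⊗ v) = 0` in the quotient says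
that `fib n x` kills the power `t^i` for each multi-exponent `i ≤ r`, `i ≠ r` (`fib_pow_eq_zero`),
and takes `t^r` to the sphere of radius `n - 1` (`fib_succ_pow`).

**Invariance.** Translations `x ↦ x + π^n` give strong consequences. If `s_{n+1}^{p^k (r_k + t)}` is
invariant under them, the binomial expansion of `(t - 1)^{r_k + t}` has a term with exponent
`r_k + 1`, which cannot be killed unless it is the leading term: thus `t = 1`
(`eq_succ_of_sElt_invariant`). For `t_n^k`, and for `s_n^m` if `f = 1`, the translation by `-π^(n-1)`,
respectively `-π^(n-2)`, produces the carries `z_s` in `[s + 1] = [s] + 1 + π z_s`, which are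
nonzero modulo `π` when `p` is a uniformizer; invariance forces `π^2 ∣ p`
(`sq_dvd_of_tElt_invariant`, `sq_dvd_of_sElt_invariant`).

**The action of the big cell.** In each case the generator is a sum `∑_x Z(x)` over the residues `x`
modulo a power of `π`, where `K` acts on the summands by Möbius transformations with a weight:
`g Z(x) = (c x + d)^{-A} Z(g x)` if `det g = 1` and `c x + d` is a unit (`kRep_fib_mobius`). If `Z`
can be made periodic modulo the same power of `π` as the sum, then for units `x` the substitution
`y = λ - 1/x` turns `(λ, -1; 1, 0) ∑_x Z(x)` into `∑_y (λ - y)^A Z(y)`, and the non-units contribute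
a constant, so that the criterion applies (`exists_expansion_of_mobius`). For `s_n^m` with `f > 1`
the function `Z(x) = fib n x (t^m)` is periodic modulo `π^n` since the lower terms of `(t - c)^m` are
killed (on the first sphere, the translate of the sum is computed directly, in
`kRep_bigMat_fib_zero`); the carry `p · p^k = p^{k+1}` in the exponents explains the digits of `A`
at `k` and `k + 1`.
For `t_n^k`, and for `s_n^m` with `f = 1`, one sums over the last digit of `x` first. Möbius
transformations act on the last digits by quadratic substitutions, since Teichmüller representatives
are additive modulo `π^2` if `π^2 ∣ p`; the errors are polynomials of degree at most `2` in the
digit, which are killed because `r_k > 2`, respectively because `r + 2 < p - 1`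
(`exists_expansion_of_quadratic`).
-/

noncomputable section

namespace SerreWeight

/-! ### Digits in base `p` and power sums over the residue field -/

section Digits
variable (p : ℕ) {f : ℕ}

/-- The natural number `∑_j i_j p^j` with digits `i_j`. -/
def digVal (i : Fin f → ℕ) : ℕ := ∑ j, i j * p ^ (j : ℕ)

theorem digVal_mono {i j : Fin f → ℕ} (h : i ≤ j) : digVal p i ≤ digVal p j :=
  Finset.sum_le_sum fun l _ => Nat.mul_le_mul_right _ (h l)

theorem digVal_add (i j : Fin f → ℕ) : digVal p (i + j) = digVal p i + digVal p j := by
  simp [digVal, add_mul, Finset.sum_add_distrib]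

theorem digVal_single (j : Fin f) (a : ℕ) : digVal p (Pi.single j a) = a * p ^ (j : ℕ) := by
  rw [digVal, Finset.sum_eq_single j]
  · simp
  · intro b _ hb; simp [hb]
  · simp

theorem digVal_injOn (i j : Fin f → ℕ) (hi : ∀ l, i l < p) (hj : ∀ l, j l < p)
    (h : digVal p i = digVal p j) : i = j := by
  have := finFunctionFinEquiv.injective (a₁ := fun l => (⟨i l, hi l⟩ : Fin p))
    (a₂ := fun l => ⟨j l, hj l⟩) (Fin.ext (by simpa [finFunctionFinEquiv_apply, digVal] using h))
  funext l
  simpa using congrArg Fin.val (congrFun this l)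

theorem digVal_lt_pow (i : Fin f → ℕ) (hi : ∀ l, i l < p) : digVal p i < p ^ f := by
  have := (finFunctionFinEquiv (fun l => (⟨i l, hi l⟩ : Fin p))).2
  rwa [finFunctionFinEquiv_apply] at this

theorem eq_of_digVal_eq [Fact p.Prime] {i j : Fin f → ℕ} (h : i ≤ j)
    (e : digVal p i = digVal p j) : i = j := by
  funext l
  have := (Finset.sum_eq_sum_iff_of_le (fun (l : Fin f) _ => Nat.mul_le_mul_right (p ^ (l : ℕ)) (h l))).mp e l
    (Finset.mem_univ l)
  exact Nat.eq_of_mul_eq_mul_right (pow_pos (Fact.out : p.Prime).pos _) this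

/-- If no digit is maximal, the value is less than `p ^ f - 1`, unless there are no digits. -/
theorem digVal_add_one_lt_pow (hf : 0 < f) (i : Fin f → ℕ) (hi : ∀ l, i l + 1 < p) :
    digVal p i + 1 < p ^ f := by
  have h0 : digVal p (i + Pi.single ⟨0, hf⟩ 1) < p ^ f := by
    refine digVal_lt_pow p _ fun l => ?_
    rcases eq_or_ne l ⟨0, hf⟩ with rfl | h
    · simpa using hi _
    · simpa [h] using (Nat.lt_succ_self _).trans (hi l)
  rwa [digVal_add, digVal_single, pow_zero, mul_one] at h0

end Digits

section PowerSums
variable {κ k : Type*} [Field κ] [Fintype κ] [Field k] (ι : κ →+* k)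

theorem sum_map_pow_eq_zero {e : ℕ} (he : e < 2 * (Fintype.card κ - 1))
    (h : e ≠ Fintype.card κ - 1) : ∑ t : κ, ι t ^ e = 0 := by
  classical
  simp only [← map_pow, ← map_sum]
  rw [map_eq_zero]
  rcases lt_or_gt_of_ne h with h1 | h1
  · exact FiniteField.sum_pow_lt_card_sub_one κ e h1
  · have h2 : ∑ t : κ, t ^ e = ∑ t : κ, t ^ (e - (Fintype.card κ - 1)) := by
      refine Finset.sum_congr rfl fun t _ => ?_
      rcases eq_or_ne t 0 with rfl | ht
      · rw [zero_pow (by omega), zero_pow (by omega)]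
      · conv_lhs => rw [← Nat.sub_add_cancel h1.le, pow_add, FiniteField.pow_card_sub_one_eq_one t ht,
          mul_one]
    rw [h2]
    exact FiniteField.sum_pow_lt_card_sub_one κ _ (by omega)

theorem sum_map_pow_card_sub_one : ∑ t : κ, ι t ^ (Fintype.card κ - 1) = -1 := by
  classical
  simp only [← map_pow, ← map_sum]
  have h1 : ∑ t : κ, t ^ (Fintype.card κ - 1) = ∑ t : κ, ((1 : κ) - if t = 0 then 1 else 0) := by
    refine Finset.sum_congr rfl fun t _ => ?_
    rcases eq_or_ne t 0 with rfl | ht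
    · rw [zero_pow (by have := Fintype.one_lt_card (α := κ); omega)]; simp
    · simp [ht, FiniteField.pow_card_sub_one_eq_one t ht]
  rw [h1, Finset.sum_sub_distrib]
  simp

end PowerSums

/-! ### The weights -/

section Matrices
variable {R : Type*} [CommRing R]

/-- The unipotent matrix `(1, x; 0, 1)`. -/
def uniMat (x : R) : GL (Fin 2) R := Matrix.GeneralLinearGroup.mk'' !![1, x; 0, 1] (by simp)

/-- The matrix `(x, -1; 1, 0) = (1, x; 0, 1) (0, -1; 1, 0)`, which represents the big Bruhat cell. -/
def bigMat (x : R) : GL (Fin 2) R := Matrix.GeneralLinearGroup.mk'' !![x, -1; 1, 0] (by simp)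

/-- The lower triangular matrix `(1, 0; x, 1)`. -/
def lowMat (x : R) : GL (Fin 2) R := Matrix.GeneralLinearGroup.mk'' !![1, 0; x, 1] (by simp)

/-- The diagonal matrix `(a, 0; 0, d)`. -/
def diaMat (a d : Rˣ) : GL (Fin 2) R :=
  Matrix.GeneralLinearGroup.mk'' !![(a : R), 0; 0, d] (by simp)

end Matrices

section Basis
variable {k : Type*} [Field k] {f : ℕ}

/-- The exponents `b` with `0 ≤ b_j ≤ A_j`. -/
abbrev Exps (A : Fin f → ℕ) : Type := ∀ j, Fin (A j + 1)

/-- The exponents as natural numbers. -/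
def Exps.val {A : Fin f → ℕ} (b : Exps A) : Fin f → ℕ := fun j => b j

theorem Exps.val_le {A : Fin f → ℕ} (b : Exps A) : b.val ≤ A := fun j => Nat.lt_succ_iff.mp (b j).2

theorem Exps.val_injective {A : Fin f → ℕ} : Function.Injective (Exps.val : Exps A → Fin f → ℕ) :=
  fun _ _ h => funext fun j => Fin.ext (congrFun h j)

/-- The exponent with a given value. -/
def Exps.mk {A : Fin f → ℕ} (b : Fin f → ℕ) (h : b ≤ A) : Exps A :=
  fun j => ⟨b j, Nat.lt_succ_of_le (h j)⟩

theorem Exps.val_mk {A : Fin f → ℕ} (b : Fin f → ℕ) (h : b ≤ A) : (Exps.mk b h).val = b := rfl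

/-- The inclusion of `SymSpace k A` in the polynomial ring. -/
def symIncl (k : Type*) [Field k] {f : ℕ} (A : Fin f → ℕ) :
    SymSpace k A →ₗ[k] MvPolynomial (Fin f × Fin 2) k := (symSubmodule k A).subtype

theorem symIncl_injective (A : Fin f → ℕ) : Function.Injective (symIncl k A) :=
  Subtype.val_injective

theorem symIncl_symVec (A a : Fin f → ℕ) (h) : symIncl k A (symVec k A a h) = symMonomial k A a := rfl

/-- The exponent vector of `∏_j x_j^{b_j} y_j^{A_j - b_j}`. -/
def expVec (A b : Fin f → ℕ) : Fin f × Fin 2 →₀ ℕ :=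
  Finsupp.equivFunOnFinite.symm fun v => if v.2 = 0 then b v.1 else A v.1 - b v.1

theorem symMonomial_eq (A b : Fin f → ℕ) (h : b ≤ A) :
    symMonomial k A (A - b) = MvPolynomial.monomial (expVec A b) 1 := by
  rw [MvPolynomial.monomial_eq, Finsupp.prod_fintype _ _ (by simp), Fintype.prod_prod_type]
  simp only [symMonomial, Fin.prod_univ_two, expVec, Finsupp.equivFunOnFinite_symm_apply_apply,
    Pi.sub_apply, map_one, one_mul]
  refine Finset.prod_congr rfl fun j _ => ?_
  have := h j
  simp [Nat.sub_sub_self this]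

theorem expVec_injective (A b c : Fin f → ℕ) (h : expVec A b = expVec A c) : b = c := by
  funext j
  simpa [expVec] using DFunLike.congr_fun h (j, 0)

theorem eq_expVec {A : Fin f → ℕ} {d : Fin f × Fin 2 →₀ ℕ}
    (h : Finsupp.weight (degreeWeight f) d = A) :
    (fun j => d (j, 0)) ≤ A ∧ d = expVec A fun j => d (j, 0) := by
  have hrj : ∀ j, d (j, 0) + d (j, 1) = A j := by
    intro j
    rw [← h, Finsupp.weight_apply, Finsupp.sum_fintype _ _ (by simp), Finset.sum_apply,
      Fintype.sum_prod_type]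
    simp [Pi.single_apply, Fin.sum_univ_two]
  refine ⟨fun j => ?_, ?_⟩
  · have := hrj j
    simp only
    omega
  · ext ⟨j, l⟩
    have := hrj j
    fin_cases l
    · simp [expVec]
    · simp [expVec]; omega

/-- The coordinates of an element of `SymSpace k A`: the coefficients of its monomials. -/
def symCoord (k : Type*) [Field k] {f : ℕ} (A : Fin f → ℕ) : SymSpace k A →ₗ[k] (Exps A → k) :=
  LinearMap.pi fun b => MvPolynomial.lcoeff k (expVec A b.val) ∘ₗ symIncl k A

/-- The vector `⨂_j x_j^{b_j} y_j^{A_j - b_j}`. -/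
def monVec (k : Type*) [Field k] {f : ℕ} {A : Fin f → ℕ} (b : Exps A) : SymSpace k A :=
  symVec k A (A - b.val) fun _ => Nat.sub_le _ _

theorem symCoord_monVec {A : Fin f → ℕ} (b : Exps A) :
    symCoord k A (monVec k b) = Pi.single b 1 := by
  classical
  funext c
  have h : symCoord k A (monVec k b) c =
      MvPolynomial.coeff (expVec A c.val) (symMonomial k A (A - b.val)) := rfl
  rw [h, symMonomial_eq A b.val b.val_le, MvPolynomial.coeff_monomial, Pi.single_apply]
  refine if_congr ⟨fun h => ?_, fun h => ?_⟩ rfl rfl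
  · exact (Exps.val_injective (expVec_injective A _ _ h)).symm
  · rw [h]

theorem symCoord_injective (A : Fin f → ℕ) : Function.Injective (symCoord k A) := by
  rw [← LinearMap.ker_eq_bot, LinearMap.ker_eq_bot']
  intro P hP
  apply symIncl_injective
  rw [map_zero]
  ext d
  rw [MvPolynomial.coeff_zero]
  by_contra hd
  obtain ⟨h1, h2⟩ := eq_expVec (P.2 hd)
  have h3 := congrFun hP (Exps.mk _ h1)
  change MvPolynomial.coeff (expVec A fun j => d (j, 0)) (symIncl k A P) = 0 at h3
  rw [← h2] at h3
  exact hd h3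

theorem symCoord_surjective (A : Fin f → ℕ) : Function.Surjective (symCoord k A) := by
  intro c
  refine ⟨∑ b, c b • monVec k b, ?_⟩
  simp only [map_sum, map_smul, symCoord_monVec]
  funext b
  simp [Finset.sum_apply, Pi.single_apply]

theorem symCoord_bijective (A : Fin f → ℕ) : Function.Bijective (symCoord k A) :=
  ⟨symCoord_injective A, symCoord_surjective A⟩

/-- The monomial basis of `SymSpace k A`, indexed by the exponents of the variables `x_j`. -/
def monBasis (k : Type*) [Field k] {f : ℕ} (A : Fin f → ℕ) : Module.Basis (Exps A) k (SymSpace k A) :=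
  Module.Basis.ofEquivFun
    (LinearEquiv.ofBijective (symCoord k A) (symCoord_bijective A))

theorem monBasis_apply {A : Fin f → ℕ} (b : Exps A) : monBasis k A b = monVec k b := by
  rw [monBasis, Module.Basis.coe_ofEquivFun, LinearEquiv.symm_apply_eq]
  exact (symCoord_monVec b).symm

theorem finrank_symSpace (A : Fin f → ℕ) : Module.finrank k (SymSpace k A) = ∏ j, (A j + 1) := by
  rw [Module.finrank_eq_card_basis (monBasis k A)]
  simp

/-- The largest exponent. -/
def Exps.top (A : Fin f → ℕ) : Exps A := Exps.mk A le_rfl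

theorem monVec_top (A : Fin f → ℕ) : monVec k (Exps.top A) = highestVec A := by
  apply symIncl_injective
  rw [highestVec, monVec, symIncl_symVec, symIncl_symVec, Exps.top, Exps.val_mk, tsub_self]
  

end Basis

section Action
variable {k : Type*} [Field k] (p : ℕ) [Fact p.Prime] [CharP k p] {f : ℕ}
  {R : Type*} [CommRing R] (χ : R →+* k)

theorem frobEmb_apply (j : ℕ) (a : R) : frobEmb p χ j a = χ a ^ p ^ j := by
  simp [frobEmb, iterateFrobenius_def]

theorem frobEmb_eq_zero {a : R} (h : χ a = 0) (j : ℕ) : frobEmb p χ j a = 0 := by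
  simp [frobEmb, h]

theorem prod_frobEmb_pow (a : R) (i : Fin f → ℕ) :
    ∏ j : Fin f, frobEmb p χ j a ^ i j = χ a ^ digVal p i := by
  simp only [frobEmb_apply, ← pow_mul, digVal, Finset.prod_pow_eq_pow_sum]
  congr 1
  exact Finset.sum_congr rfl fun j _ => mul_comm _ _

theorem prod_pow_pow (x : k) (i : Fin f → ℕ) :
    ∏ j : Fin f, (x ^ p ^ (j : ℕ)) ^ i j = x ^ digVal p i := by
  simp only [← pow_mul, digVal, Finset.prod_pow_eq_pow_sum]
  congr 1
  exact Finset.sum_congr rfl fun j _ => mul_comm _ _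

theorem symIncl_weightRep (A : Fin f → ℕ) (w : ℕ) (g : GL (Fin 2) R) (v : SymSpace k A) :
    symIncl k A (weightRep p χ A w g v) = χ (g : Matrix (Fin 2) (Fin 2) R).det ^ w •
      substHom p f χ (g : Matrix (Fin 2) (Fin 2) R) (symIncl k A v) := rfl

theorem substHom_symMonomial (A a : Fin f → ℕ) (g : Matrix (Fin 2) (Fin 2) R) :
    substHom p f χ g (symMonomial k A a) = ∏ j : Fin f,
      (MvPolynomial.C (frobEmb p χ j (g 0 0)) * MvPolynomial.X (j, 0) +
        MvPolynomial.C (frobEmb p χ j (g 1 0)) * MvPolynomial.X (j, 1)) ^ (A j - a j) *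
      (MvPolynomial.C (frobEmb p χ j (g 0 1)) * MvPolynomial.X (j, 0) +
        MvPolynomial.C (frobEmb p χ j (g 1 1)) * MvPolynomial.X (j, 1)) ^ a j := by
  simp only [symMonomial, substHom, map_prod, map_mul, map_pow, MvPolynomial.aeval_X,
    Fin.sum_univ_two]

theorem weightRep_upper_highestVec (A : Fin f → ℕ) (w : ℕ) (g : GL (Fin 2) R)
    (hg : χ (g 1 0) = 0) : weightRep p χ A w g (highestVec A) =
      (χ (g : Matrix (Fin 2) (Fin 2) R).det ^ w * χ (g 0 0) ^ digVal p A) • highestVec A := by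
  apply symIncl_injective
  rw [symIncl_weightRep, map_smul, highestVec, symIncl_symVec, substHom_symMonomial, mul_smul]
  congr 1
  simp only [frobEmb_eq_zero p χ hg, symMonomial, Pi.zero_apply, Nat.sub_zero, pow_zero, mul_one,
    map_zero, zero_mul, add_zero, mul_pow, Finset.prod_mul_distrib, MvPolynomial.smul_eq_C_mul,
    ← prod_frobEmb_pow, map_prod, map_pow]

theorem weightRep_diag (A : Fin f → ℕ) (w : ℕ) (g : GL (Fin 2) R)
    (hg : χ (g 1 0) = 0) (hg' : χ (g 0 1) = 0) (a : Fin f → ℕ) (h) :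
    weightRep p χ A w g (symVec k A a h) =
      (χ (g : Matrix (Fin 2) (Fin 2) R).det ^ w * (χ (g 0 0) ^ digVal p (A - a) *
        χ (g 1 1) ^ digVal p a)) • symVec k A a h := by
  apply symIncl_injective
  rw [symIncl_weightRep, map_smul, symIncl_symVec, substHom_symMonomial, mul_smul]
  congr 1
  simp only [frobEmb_eq_zero p χ hg, frobEmb_eq_zero p χ hg', symMonomial, map_zero, zero_mul,
    add_zero, zero_add, mul_pow, Finset.prod_mul_distrib, MvPolynomial.smul_eq_C_mul, map_mul,
    ← prod_frobEmb_pow, map_prod, map_pow, Pi.sub_apply]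
  ring

theorem add_pow_fin {S : Type*} [CommRing S] (x y : S) (n : ℕ) :
    (x + y) ^ n = ∑ e : Fin (n + 1), x ^ (e : ℕ) * y ^ (n - e) * n.choose e := by
  rw [add_pow, Finset.sum_range]

/-- The product of binomial coefficients `∏_j (A_j choose b_j)`. -/
def multiChoose (A b : Fin f → ℕ) : ℕ := ∏ j, (A j).choose (b j)

theorem multiChoose_ne_zero {A : Fin f → ℕ} (hA : ∀ j, A j < p) (b : Exps A) :
    (multiChoose A b.val : k) ≠ 0 := by
  rw [multiChoose, Nat.cast_prod]
  refine Finset.prod_ne_zero_iff.mpr fun j _ h => ?_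
  rw [CharP.cast_eq_zero_iff k p] at h
  have h2 : p ∣ (A j).factorial := by
    rw [← Nat.choose_mul_factorial_mul_factorial (b.val_le j), mul_assoc]
    exact Dvd.dvd.mul_right h _
  exact absurd ((Fact.out : p.Prime).dvd_factorial.mp h2) (not_le.mpr (hA j))

theorem multiChoose_self (A : Fin f → ℕ) : multiChoose A A = 1 := by simp [multiChoose]

/-- The expansion of `⨂_j (λ^{p^j} x_j + y_j)^{A_j}`. -/
theorem weightRep_bigMat (A : Fin f → ℕ) (w : ℕ) (x : R) :
    weightRep p χ A w (bigMat x) (highestVec A) =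
      ∑ b : Exps A, χ x ^ digVal p b.val • ((multiChoose A b.val : k) • monVec k b) := by
  apply symIncl_injective
  rw [symIncl_weightRep, highestVec, symIncl_symVec, substHom_symMonomial, map_sum]
  simp only [bigMat, coe_mkGL, map_smul, monVec, symIncl_symVec]
  simp only [Matrix.det_fin_two_of, Matrix.of_apply, Matrix.cons_val', Matrix.cons_val_zero,
    Matrix.cons_val_one, Matrix.cons_val_fin_one, Pi.zero_apply, Nat.sub_zero, pow_zero, mul_one, mul_zero,
    zero_sub, neg_neg, map_one, one_pow, one_smul, one_mul, add_pow_fin, Fintype.prod_sum]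
  refine Finset.sum_congr rfl fun b _ => ?_
  rw [smul_smul, ← prod_frobEmb_pow, multiChoose, Nat.cast_prod, ← Finset.prod_mul_distrib,
    MvPolynomial.smul_eq_C_mul, map_prod, symMonomial, ← Finset.prod_mul_distrib]
  refine Finset.prod_congr rfl fun j _ => ?_
  have := Exps.val_le b j
  simp only [Exps.val] at this
  simp only [Pi.sub_apply, Nat.sub_sub_self this, mul_pow, map_mul, map_pow, map_natCast, Exps.val]
  ring

/-- The expansion of `n(λ) v` for a monomial `v`. -/
theorem weightRep_uniMat_monVec (A : Fin f → ℕ) (w : ℕ) (b : Exps A) :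
    ∃ u : Exps (A - b.val) → SymSpace k A, u (Exps.top _) = highestVec A ∧ ∀ x,
      weightRep p χ A w (uniMat x) (monVec k b) =
        ∑ e : Exps (A - b.val), χ x ^ digVal p e.val • u e := by
  have hle : ∀ e : Exps (A - b.val), ∀ j, A j - (b j + e j) ≤ A j := fun e j => Nat.sub_le _ _
  refine ⟨fun e => (multiChoose (A - b.val) e.val : k) •
    symVec k A (fun j => A j - (b j + e j)) (hle e), ?_, ?_⟩
  · apply symIncl_injective
    rw [map_smul, highestVec, symIncl_symVec, symIncl_symVec]
    simp only [Exps.top, Exps.val_mk, multiChoose_self, Nat.cast_one, one_smul]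
    congr 1
    funext j
    have := b.val_le j
    simp only [Exps.mk, Exps.val, Pi.sub_apply, Pi.zero_apply] at this ⊢
    omega
  · intro x
    apply symIncl_injective
    rw [symIncl_weightRep, monVec, symIncl_symVec, substHom_symMonomial, map_sum]
    simp only [uniMat, coe_mkGL, map_smul, symIncl_symVec]
    simp only [Matrix.det_fin_two_of, Matrix.of_apply, Matrix.cons_val', Matrix.cons_val_zero,
      Matrix.cons_val_one, Matrix.cons_val_fin_one, mul_one, mul_zero, sub_zero, map_one, map_zero,
      one_pow, one_smul, one_mul, zero_mul, add_zero, add_pow_fin, Finset.mul_sum, Fintype.prod_sum]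
    refine Finset.sum_congr rfl fun e _ => ?_
    rw [smul_smul, ← prod_frobEmb_pow, multiChoose, Nat.cast_prod, ← Finset.prod_mul_distrib,
      MvPolynomial.smul_eq_C_mul, map_prod, symMonomial, ← Finset.prod_mul_distrib]
    refine Finset.prod_congr rfl fun j _ => ?_
    have h1 := b.val_le j
    have h2 := Exps.val_le e j
    simp only [Exps.val, Pi.sub_apply] at h1 h2
    have e1 : A j - (b j + e j) = A j - b j - e j := by omega
    have e2 : A j - (A j - b j - e j) = b j + e j := by omega
    have e3 : A j - (A j - b j) = b j := by omega
    simp only [Pi.sub_apply, Exps.val, e1, e2, e3, map_mul, map_pow, map_natCast, mul_pow, pow_add]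
    ring

end Action

/-! ### Irreducibility of the weights and the recognition of a weight -/

section Extraction
variable {κ k V : Type*} [Field κ] [Fintype κ] [Field k] (ι : κ →+* k) [AddCommGroup V] [Module k V]
  {p f : ℕ}

theorem digVal_lt_card_sub_one [Fact p.Prime] (hq : Fintype.card κ = p ^ f)
    {i : Fin f → ℕ} (hi : ∀ j, i j + 1 < p) : digVal p i < Fintype.card κ - 1 := by
  have hf : 0 < f := by
    rcases Nat.eq_zero_or_pos f with rfl | h
    · have := Fintype.one_lt_card (α := κ)
      simp at hq; omega
    · exact h
  have := digVal_add_one_lt_pow p hf i hi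
  omega

theorem sum_map_pow_mul_pow {d e : ℕ} (hd : d < Fintype.card κ - 1) (he : e < Fintype.card κ - 1) :
    ∑ t : κ, ι t ^ (Fintype.card κ - 1 - d) * ι t ^ e = if e = d then -1 else 0 := by
  simp only [← pow_add]
  split_ifs with h
  · subst h
    rw [Nat.sub_add_cancel hd.le, sum_map_pow_card_sub_one]
  · exact sum_map_pow_eq_zero ι (by omega) (by omega)

/-- The coefficients of a polynomial function on the residue field, as power sums. -/
theorem sum_pow_smul_expansion [Fact p.Prime] (hq : Fintype.card κ = p ^ f) {A : Fin f → ℕ}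
    (hA : ∀ j, A j + 1 < p) (u : Exps A → V) (b : Exps A) :
    ∑ t : κ, ι t ^ (Fintype.card κ - 1 - digVal p b.val) •
      ∑ c : Exps A, ι t ^ digVal p c.val • u c = - u b := by
  have hlt : ∀ c : Exps A, ∀ j, c.val j + 1 < p := fun c j =>
    (Nat.succ_le_succ (c.val_le j)).trans_lt (hA j)
  simp only [Finset.smul_sum, smul_smul]
  rw [Finset.sum_comm]
  simp only [← Finset.sum_smul]
  rw [Finset.sum_eq_single b]
  · rw [sum_map_pow_mul_pow ι (digVal_lt_card_sub_one hq (hlt b))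
      (digVal_lt_card_sub_one hq (hlt b)), if_pos rfl, neg_one_smul]
  · intro c _ hc
    rw [sum_map_pow_mul_pow ι (digVal_lt_card_sub_one hq (hlt b))
      (digVal_lt_card_sub_one hq (hlt c)), if_neg, zero_smul]
    intro h
    exact hc (Exps.val_injective (digVal_injOn p _ _ (fun l => (Nat.lt_succ_self _).trans (hlt c l))
      (fun l => (Nat.lt_succ_self _).trans (hlt b l)) h))
  · simp

end Extraction

section Irreducible
variable {O k : Type*} [CommRing O] [IsLocalRing O] [Field k] (p : ℕ) [Fact p.Prime] [CharP k p]
  {f : ℕ} (ι : ResidueField O →+* k) [Fintype (ResidueField O)]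

/-- A nonzero subspace of the weight that is stable under `GL₂(𝓞)` is everything. -/
theorem eq_top_of_stable (hq : Fintype.card (ResidueField O) = p ^ f) {A : Fin f → ℕ}
    (hA : ∀ j, A j + 1 < p) (w : ℕ) (M : Submodule k (SymSpace k A))
    (hM : ∀ (a : GL (Fin 2) O), ∀ v ∈ M, weightRep p (ι.comp (residue O)) A w a v ∈ M)
    (hne : M ≠ ⊥) : M = ⊤ := by
  have hA' : ∀ j, A j < p := fun j => (Nat.lt_succ_self _).trans (hA j)
  obtain ⟨v, hv, hv0⟩ := Submodule.exists_mem_ne_zero_of_ne_bot hne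
  -- A monomial of `v` with the largest possible exponents of the variables `y_j`.
  obtain ⟨b₀, hb₀, hmax⟩ : ∃ b₀ : Exps A, (monBasis k A).repr v b₀ ≠ 0 ∧
      ∀ b : Exps A, (monBasis k A).repr v b ≠ 0 → digVal p (A - b.val) ≤ digVal p (A - b₀.val) := by
    classical
    have h1 : (Finset.univ.filter fun b => (monBasis k A).repr v b ≠ 0).Nonempty := by
      by_contra h
      rw [Finset.not_nonempty_iff_eq_empty, Finset.filter_eq_empty_iff] at h
      apply hv0
      apply (monBasis k A).repr.injective
      ext b
      simpa using h (Finset.mem_univ b)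
    obtain ⟨b, hb, h2⟩ := Finset.exists_max_image _ (fun b : Exps A => digVal p (A - b.val)) h1
    exact ⟨b, (Finset.mem_filter.mp hb).2, fun c hc => h2 c (by simpa using hc)⟩
  have hsub : ∀ b : Exps A, ∀ j, (A - b.val) j + 1 < p := fun b j =>
    (Nat.succ_le_succ (Nat.sub_le _ _)).trans_lt (hA j)
  have hlt : ∀ (b : Exps A) (e : Exps (A - b.val)), ∀ j, e.val j + 1 < p := fun b e j =>
    (Nat.succ_le_succ (e.val_le j)).trans_lt (hsub b j)
  choose lift hlift using residue_surjective (R := O)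
  have hx : highestVec A ∈ M := by
    have h1 : ∑ t : ResidueField O, ι t ^ (Fintype.card (ResidueField O) - 1 - digVal p (A - b₀.val)) •
        weightRep p (ι.comp (residue O)) A w (uniMat (lift t)) v ∈ M :=
      Submodule.sum_mem _ fun t _ => M.smul_mem _ (hM _ _ hv)
    -- The coefficients below do not depend on `t`, so the sum over `t` can be evaluated.
    have h2 : ∀ b : Exps A, ∃ u : Exps (A - b.val) → SymSpace k A,
        u (Exps.top _) = highestVec A ∧ ∀ x : O,
          weightRep p (ι.comp (residue O)) A w (uniMat x) (monVec k b) =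
            ∑ e : Exps (A - b.val), ι (residue O x) ^ digVal p e.val • u e :=
      fun b => weightRep_uniMat_monVec p (ι.comp (residue O)) A w b
    choose u hu hu' using h2
    rw [← (monBasis k A).sum_repr v] at h1
    simp only [map_sum, map_smul, monBasis_apply, hu', hlift, Finset.smul_sum] at h1
    rw [Finset.sum_comm] at h1
    have h3 : ∀ b ∈ Finset.univ, b ≠ b₀ → ∑ t : ResidueField O, ∑ e : Exps (A - b.val),
        ι t ^ (Fintype.card (ResidueField O) - 1 - digVal p (A - b₀.val)) •
          (monBasis k A).repr v b • ι t ^ digVal p e.val • u b e = 0 := by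
      intro b _ hb
      rcases eq_or_ne ((monBasis k A).repr v b) 0 with h0 | h0
      · simp [h0]
      rw [Finset.sum_comm]
      refine Finset.sum_eq_zero fun e _ => ?_
      have h4 : ∀ t : ResidueField O,
          ι t ^ (Fintype.card (ResidueField O) - 1 - digVal p (A - b₀.val)) •
            (monBasis k A).repr v b • ι t ^ digVal p e.val • u b e =
          (ι t ^ (Fintype.card (ResidueField O) - 1 - digVal p (A - b₀.val)) *
            ι t ^ digVal p e.val) • (monBasis k A).repr v b • u b e := fun t => by
        rw [smul_comm ((monBasis k A).repr v b), smul_smul]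
      simp only [h4, ← Finset.sum_smul]
      rw [sum_map_pow_mul_pow ι (digVal_lt_card_sub_one hq (hsub b₀))
        (digVal_lt_card_sub_one hq (hlt b e)), if_neg, zero_smul]
      intro h5
      have h6 := digVal_mono p e.val_le
      have h7 := hmax b h0
      apply hb
      apply Exps.val_injective
      have h8 := digVal_injOn p _ _ (fun l => (Nat.lt_succ_self _).trans (hsub b l))
        (fun l => (Nat.lt_succ_self _).trans (hsub b₀ l)) (by omega : digVal p (A - b.val) = digVal p (A - b₀.val))
      funext j
      have h9 : A j - b.val j = A j - b₀.val j := congrFun h8 j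
      have h10 := b.val_le j
      have h11 := b₀.val_le j
      change b.val j ≤ A j at h10
      change b₀.val j ≤ A j at h11
      omega
    rw [Finset.sum_eq_single b₀ h3 (by simp)] at h1
    have h4 : ∀ t : ResidueField O, ∑ e : Exps (A - b₀.val),
        ι t ^ (Fintype.card (ResidueField O) - 1 - digVal p (A - b₀.val)) •
          (monBasis k A).repr v b₀ • ι t ^ digVal p e.val • u b₀ e =
        (monBasis k A).repr v b₀ •
          ι t ^ (Fintype.card (ResidueField O) - 1 - digVal p (Exps.top (A - b₀.val)).val) •
          ∑ e : Exps (A - b₀.val), ι t ^ digVal p e.val • u b₀ e := fun t => by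
      rw [Finset.smul_sum, Finset.smul_sum]
      exact Finset.sum_congr rfl fun e _ => smul_comm _ _ _
    simp only [h4, ← Finset.smul_sum] at h1
    rw [sum_pow_smul_expansion ι hq (hsub b₀), hu, smul_neg, Submodule.neg_mem_iff,
      Submodule.smul_mem_iff _ hb₀] at h1
    exact h1
  have hmon : ∀ b : Exps A, monVec k b ∈ M := by
    intro b
    have h1 : ∑ t : ResidueField O, ι t ^ (Fintype.card (ResidueField O) - 1 - digVal p b.val) •
        weightRep p (ι.comp (residue O)) A w (bigMat (lift t)) (highestVec A) ∈ M :=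
      Submodule.sum_mem _ fun t _ => M.smul_mem _ (hM _ _ hx)
    simp only [weightRep_bigMat, RingHom.comp_apply, hlift] at h1
    rw [sum_pow_smul_expansion ι hq hA, Submodule.neg_mem_iff,
      Submodule.smul_mem_iff _ (multiChoose_ne_zero p hA' b)] at h1
    exact h1
  rw [eq_top_iff, ← (monBasis k A).span_eq, Submodule.span_le]
  rintro _ ⟨b, rfl⟩
  rw [monBasis_apply]
  exact hmon b

variable {V : Type*} [AddCommGroup V] [Module k V]

theorem bigMat_mul_lowMat {R : Type*} [CommRing R] (x y : R) :
    bigMat y * lowMat (y - x) = bigMat x := by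
  ext i j
  fin_cases i <;> fin_cases j <;> simp [bigMat, lowMat, coe_mkGL, Matrix.mul_apply, Fin.sum_univ_two]

theorem isUnit_of_residue_ne_zero {x : O} (h : residue O x ≠ 0) : IsUnit x := by
  by_contra h1
  exact h ((residue_eq_zero_iff x).mpr h1)

theorem residue_det (g : GL (Fin 2) O) : residue O (g : Matrix (Fin 2) (Fin 2) O).det =
    residue O (g 0 0) * residue O (g 1 1) - residue O (g 0 1) * residue O (g 1 0) := by
  rw [Matrix.det_fin_two]; simp

theorem residue_det_ne_zero (g : GL (Fin 2) O) :
    residue O (g : Matrix (Fin 2) (Fin 2) O).det ≠ 0 := by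
  have h := (Matrix.GeneralLinearGroup.det g).isUnit
  exact (h.map (residue O)).ne_zero

/-- **Recognition of a weight.** A vector `v ≠ 0` of a representation of `GL₂(𝓞)` that is invariant
under `I(1)`, is an eigenvector of the torus with the eigencharacter of the highest weight vector of
`⨂_j (Sym^{A_j})^{Frob^j} ⊗ det^w`, and is such that `n(λ) s v` is a polynomial in `λ` with the same
exponents as for that highest weight vector, generates a copy of this weight. -/
theorem exists_embedding_of_expansion (hq : Fintype.card (ResidueField O) = p ^ f) {A : Fin f → ℕ}
    (hA : ∀ j, A j + 1 < p) (w : ℕ) (ρ : Representation k (GL (Fin 2) O) V) (v : V) (hv : v ≠ 0)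
    (hinv : ∀ a : GL (Fin 2) O, residue O (a 0 0) = 1 → residue O (a 1 0) = 0 →
      residue O (a 1 1) = 1 → ρ a v = v)
    (htor : ∀ a d : Oˣ, ρ (diaMat a d) v =
      (ι (residue O a) ^ (digVal p A + w) * ι (residue O d) ^ w) • v)
    (lift : ResidueField O → O) (hlift : ∀ t, residue O (lift t) = t)
    (u : Exps A → V)
    (hu : ∀ t, ρ (bigMat (lift t)) v = ∑ b : Exps A, ι t ^ digVal p b.val • u b) :
    ∃ θ : SymSpace k A →ₗ[k] V, Function.Injective θ ∧ θ (highestVec A) = v ∧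
      ∀ a x, θ (weightRep p (ι.comp (residue O)) A w a x) = ρ a (θ x) := by
  have hA' : ∀ j, A j < p := fun j => (Nat.lt_succ_self _).trans (hA j)
  have hup : ∀ g : GL (Fin 2) O, residue O (g 1 0) = 0 → ρ g v =
      (ι (residue O (g : Matrix (Fin 2) (Fin 2) O).det) ^ w * ι (residue O (g 0 0)) ^ digVal p A) • v := by
    intro g hg
    have hd := residue_det_ne_zero g
    rw [residue_det, hg, mul_zero, sub_zero] at hd
    obtain ⟨a, ha⟩ := isUnit_of_residue_ne_zero (left_ne_zero_of_mul hd)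
    obtain ⟨d, hd⟩ := isUnit_of_residue_ne_zero (right_ne_zero_of_mul hd)
    have e : g = diaMat a d * ((diaMat a d)⁻¹ * g) := by simp
    have e2 : (diaMat a d)⁻¹ = diaMat a⁻¹ d⁻¹ := by
      rw [inv_eq_iff_mul_eq_one]
      ext i j
      fin_cases i <;> fin_cases j <;> simp [diaMat, coe_mkGL, Matrix.mul_apply, Fin.sum_univ_two]
    rw [e, map_mul, Module.End.mul_apply, hinv, htor, ← e, residue_det, hg, ← ha, ← hd]
    · congr 1
      simp only [mul_zero, sub_zero, map_mul, mul_pow, pow_add]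
      ring
    · rw [e2]
      simp [diaMat, coe_mkGL, Matrix.mul_apply, Fin.sum_univ_two, ← ha]
    · rw [e2]
      simp [diaMat, coe_mkGL, Matrix.mul_apply, Fin.sum_univ_two, hg]
    · rw [e2]
      simp [diaMat, coe_mkGL, Matrix.mul_apply, Fin.sum_univ_two, ← hd]
  have hbig : ∀ x : O, ρ (bigMat x) v = ∑ b : Exps A, ι (residue O x) ^ digVal p b.val • u b := by
    intro x
    rw [← hu, ← bigMat_mul_lowMat x (lift (residue O x)), map_mul, Module.End.mul_apply, hinv]
    · simp [lowMat, coe_mkGL]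
    · simp [lowMat, coe_mkGL, hlift]
    · simp [lowMat, coe_mkGL]
  have hq1 : 0 < Fintype.card (ResidueField O) - 1 := by
    have := Fintype.one_lt_card (α := ResidueField O); omega
  have hlt : ∀ b : Exps A, digVal p b.val < Fintype.card (ResidueField O) - 1 := fun b =>
    digVal_lt_card_sub_one hq fun j => (Nat.succ_le_succ (b.val_le j)).trans_lt (hA j)
  have hle : ∀ b : Exps A, digVal p b.val ≤ digVal p A := fun b => digVal_mono p b.val_le
  let zero : Exps A := Exps.mk 0 fun _ => Nat.zero_le _
  have hzero : ∀ b : Exps A, digVal p b.val = 0 → b = zero := fun b hb =>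
    Exps.val_injective (eq_of_digVal_eq p (i := 0) (j := b.val) (fun _ => Nat.zero_le _)
      (by rw [hb]; simp [digVal])).symm
  have hzv : digVal p zero.val = 0 := by simp [zero, digVal, Exps.val_mk]
  have htop : u (Exps.top A) = v := by
    -- Compare the two expressions for `(1, 0; x, 1) v`, summed over the nonzero residues of `x`.
    have h1 : ∀ t : ResidueField O, t ≠ 0 → ∑ b : Exps A, ι t ^ digVal p b.val •
        ρ (bigMat 0)⁻¹ (u b) = ∑ b : Exps A, ι (-t) ^ (digVal p A - digVal p b.val) • u b := by
      intro t ht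
      obtain ⟨x, hx⟩ := isUnit_of_residue_ne_zero (x := lift t) (by rwa [hlift])
      have hxt : residue O x = t := by rw [hx, hlift]
      have hxi : residue O ((x⁻¹ : Oˣ) : O) = t⁻¹ := by
        refine eq_inv_of_mul_eq_one_left ?_
        rw [← hxt, ← map_mul]; simp
      have h2 : ρ (bigMat 0)⁻¹ (ρ (bigMat (x : O)) v) = ρ (lowMat (-(x : O))) v := by
        rw [← bigMat_mul_lowMat (x : O) 0, map_mul, Module.End.mul_apply,
          Representation.inv_self_apply, zero_sub]
      have h3 : lowMat (-(x : O)) = bigMat (-((x⁻¹ : Oˣ) : O)) *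
          Matrix.GeneralLinearGroup.mk'' !![-(x : O), 1; 0, -((x⁻¹ : Oˣ) : O)] (by simp) := by
        ext i j
        fin_cases i <;> fin_cases j <;>
          simp [bigMat, lowMat, coe_mkGL, Matrix.mul_apply, Fin.sum_univ_two]
      rw [h3, map_mul ρ, Module.End.mul_apply, hup (Matrix.GeneralLinearGroup.mk'' _ _)
        (by simp [coe_mkGL]), hbig, map_smul, hbig] at h2
      simp only [map_sum, map_smul, hxt, coe_mkGL, Finset.smul_sum, map_neg, hxi] at h2
      rw [h2]
      refine Finset.sum_congr rfl fun b _ => ?_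
      have ht' : ι (-t) ≠ 0 := by simpa using ht
      have e1 : -ι t⁻¹ = (ι (-t))⁻¹ := by
        rw [map_neg, map_inv₀, inv_neg]
      rw [smul_smul, e1, inv_pow]
      congr 1
      rw [pow_sub₀ _ ht' (hle b)]
      simp [Matrix.det_fin_two_of, hxt, hxi]
    have h2 : ∑ t : ResidueField O, ι t ^ (Fintype.card (ResidueField O) - 1) •
        ∑ b : Exps A, ι t ^ digVal p b.val • ρ (bigMat 0)⁻¹ (u b) =
        ∑ t : ResidueField O, ι t ^ (Fintype.card (ResidueField O) - 1) •
          ∑ b : Exps A, ι (-t) ^ (digVal p A - digVal p b.val) • u b := by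
      refine Finset.sum_congr rfl fun t _ => ?_
      rcases eq_or_ne t 0 with rfl | ht
      · rw [map_zero, zero_pow hq1.ne', zero_smul, zero_smul]
      · rw [h1 t ht]
    have h3 : ∀ t : ResidueField O, ι t ^ (Fintype.card (ResidueField O) - 1) =
        ι (-t) ^ (Fintype.card (ResidueField O) - 1) := by
      intro t
      rw [← map_pow, ← map_pow]
      congr 1
      rcases eq_or_ne t 0 with rfl | ht
      · rw [neg_zero]
      · rw [FiniteField.pow_card_sub_one_eq_one t ht, FiniteField.pow_card_sub_one_eq_one _ (neg_ne_zero.mpr ht)]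
    have h4 : ∑ t : ResidueField O, ι t ^ (Fintype.card (ResidueField O) - 1) •
          ∑ b : Exps A, ι (-t) ^ (digVal p A - digVal p b.val) • u b =
        ∑ t : ResidueField O, ι t ^ (Fintype.card (ResidueField O) - 1) •
          ∑ b : Exps A, ι t ^ (digVal p A - digVal p b.val) • u b := by
      refine (Finset.sum_congr rfl fun t _ => by rw [h3 t]).trans ?_
      exact Equiv.sum_comp (Equiv.neg (ResidueField O)) fun t =>
        ι t ^ (Fintype.card (ResidueField O) - 1) •
          ∑ b : Exps A, ι t ^ (digVal p A - digVal p b.val) • u b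
    have key : ∀ (d : Exps A → ℕ) (b₀ : Exps A) (x : Exps A → V),
        (∀ b, d b < Fintype.card (ResidueField O) - 1) → d b₀ = 0 → (∀ b, d b = 0 → b = b₀) →
        ∑ t : ResidueField O, ι t ^ (Fintype.card (ResidueField O) - 1) •
          ∑ b : Exps A, ι t ^ d b • x b = - x b₀ := by
      intro d b₀ x hd h0 h00
      simp only [Finset.smul_sum, smul_smul, ← pow_add]
      rw [Finset.sum_comm]
      simp only [← Finset.sum_smul]
      rw [Finset.sum_eq_single b₀]
      · rw [h0, add_zero, sum_map_pow_card_sub_one, neg_one_smul]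
      · intro b _ hb
        rw [sum_map_pow_eq_zero, zero_smul]
        · have := hd b; omega
        · have : d b ≠ 0 := fun h => hb (h00 b h)
          omega
      · simp
    rw [h4, key _ zero _ hlt hzv hzero, key (fun b => digVal p A - digVal p b.val) (Exps.top A) u
      (fun b => (Nat.sub_le _ _).trans_lt (hlt (Exps.top A))) (Nat.sub_self _) (fun b hb => ?_),
      neg_inj] at h2
    · rw [← h2]
      have h5 : u zero = ρ (bigMat 0) v := by
        rw [hbig, Finset.sum_eq_single zero]
        · rw [hzv, pow_zero, one_smul]
        · intro b _ hb
          rw [map_zero, map_zero, zero_pow (fun h => hb (hzero b h)), zero_smul]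
        · simp
      rw [h5, Representation.inv_self_apply]
    · refine Exps.val_injective (eq_of_digVal_eq p b.val_le ?_)
      have := hle b
      simp only [Exps.top, Exps.val_mk] at hb ⊢
      omega
  obtain ⟨θ, hθ⟩ : ∃ θ : SymSpace k A →ₗ[k] V, ∀ b : Exps A, θ (monVec k b) =
      (multiChoose A b.val : k)⁻¹ • u b :=
    ⟨(monBasis k A).constr k fun b => (multiChoose A b.val : k)⁻¹ • u b, fun b => by
      rw [← monBasis_apply, Module.Basis.constr_basis]⟩
  have hθv : θ (highestVec A) = v := by
    rw [← monVec_top, hθ, htop, Exps.top, Exps.val_mk, multiChoose_self, Nat.cast_one, inv_one,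
      one_smul]
  have hθbig : ∀ x : O, θ (weightRep p (ι.comp (residue O)) A w (bigMat x) (highestVec A)) =
      ρ (bigMat x) v := by
    intro x
    rw [weightRep_bigMat, hbig, map_sum]
    refine Finset.sum_congr rfl fun b _ => ?_
    rw [map_smul, map_smul, hθ, smul_inv_smul₀ (multiChoose_ne_zero p hA' b)]
    rfl
  have hθg : ∀ g : GL (Fin 2) O, θ (weightRep p (ι.comp (residue O)) A w g (highestVec A)) =
      ρ g v := by
    intro g
    have hupp : ∀ h : GL (Fin 2) O, residue O (h 1 0) = 0 →
        weightRep p (ι.comp (residue O)) A w h (highestVec A) =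
        (ι (residue O (h : Matrix (Fin 2) (Fin 2) O).det) ^ w * ι (residue O (h 0 0)) ^ digVal p A) •
          highestVec A := fun h hh =>
      weightRep_upper_highestVec p _ A w h (by rw [RingHom.comp_apply, hh, map_zero])
    by_cases hg : residue O (g 1 0) = 0
    · rw [hupp g hg, hup g hg, map_smul, hθv]
    · obtain ⟨c, hc⟩ := isUnit_of_residue_ne_zero hg
      obtain ⟨x, hx⟩ : ∃ x : O, x = g 0 0 * (c⁻¹ : Oˣ) := ⟨_, rfl⟩
      have e : g = bigMat x * ((bigMat x)⁻¹ * g) := by simp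
      have e2 : (bigMat x)⁻¹ = Matrix.GeneralLinearGroup.mk'' !![0, 1; -1, x] (by simp) := by
        rw [inv_eq_iff_mul_eq_one]
        ext i j
        fin_cases i <;> fin_cases j <;>
          simp [bigMat, coe_mkGL, Matrix.mul_apply, Fin.sum_univ_two]
      have e3 : residue O (((bigMat x)⁻¹ * g : GL (Fin 2) O) 1 0) = 0 := by
        rw [e2]
        simp [coe_mkGL, Matrix.mul_apply, Fin.sum_univ_two, hx, ← hc, mul_assoc]
      generalize (bigMat x)⁻¹ * g = M at e e3
      rw [e, map_mul, map_mul, Module.End.mul_apply, Module.End.mul_apply, hupp M e3, hup M e3,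
        map_smul, map_smul, map_smul, hθbig]
  have hequiv : ∀ a x, θ (weightRep p (ι.comp (residue O)) A w a x) = ρ a (θ x) := by
    have hspan : Submodule.span k (Set.range fun g : GL (Fin 2) O =>
        weightRep p (ι.comp (residue O)) A w g (highestVec A)) = ⊤ := by
      refine eq_top_of_stable p ι hq hA w _ ?_ ?_
      · intro a x hx
        induction hx using Submodule.span_induction with
        | mem x hx =>
          obtain ⟨g, rfl⟩ := hx
          exact Submodule.subset_span ⟨a * g, by simp⟩
        | zero => simp
        | add x y _ _ hx hy => rw [map_add]; exact Submodule.add_mem _ hx hy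
        | smul c x _ hx => rw [map_smul]; exact Submodule.smul_mem _ c hx
      · intro h
        have h1 : highestVec (k := k) A ∈ (⊥ : Submodule k (SymSpace k A)) := by
          rw [← h]
          exact Submodule.subset_span ⟨1, by simp⟩
        rw [Submodule.mem_bot] at h1
        rw [h1, map_zero] at hθv
        exact hv hθv.symm
    intro a x
    have hx : x ∈ Submodule.span k (Set.range fun g : GL (Fin 2) O =>
        weightRep p (ι.comp (residue O)) A w g (highestVec A)) := hspan ▸ Submodule.mem_top
    induction hx using Submodule.span_induction with
    | mem x hx =>
      obtain ⟨g, rfl⟩ := hx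
      simp only [← Module.End.mul_apply, ← map_mul, hθg]
    | zero => simp
    | add x y _ _ hx hy => simp only [map_add, hx, hy]
    | smul c x _ hx => simp only [map_smul, hx]
  refine ⟨θ, ?_, hθv, hequiv⟩
  rw [← LinearMap.ker_eq_bot]
  by_contra hker
  have := eq_top_of_stable p ι hq hA w (LinearMap.ker θ) (fun a x hx => by
    rw [LinearMap.mem_ker] at hx ⊢
    rw [hequiv, hx, map_zero]) hker
  have h1 : highestVec A ∈ LinearMap.ker θ := this ▸ Submodule.mem_top
  rw [LinearMap.mem_ker, hθv] at h1
  exact hv h1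

end Irreducible

/-! ### Compact induction: tensors and submodules generated over `KZ` -/

section Tens
variable {k G V : Type*} [Field k] [Group G] [AddCommGroup V] [Module k V]
  (H : Subgroup G) (τ : Representation k H V)

theorem tens_apply_of_mem (g : G) (v : V) (x : G) (h : x * g ∈ H) :
    (tens H τ g v).1 x = τ ⟨x * g, h⟩ v := dif_pos h

theorem tens_apply_of_notMem (g : G) (v : V) (x : G) (h : x * g ∉ H) :
    (tens H τ g v).1 x = 0 := dif_neg h

/-- The map `v ↦ g ⊗ v` as a linear map. -/
def tensₗ (g : G) : V →ₗ[k] cInd H τ where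
  toFun := tens H τ g
  map_add' v w := by
    apply Subtype.ext
    funext x
    change (tens H τ g (v + w)).1 x = (tens H τ g v).1 x + (tens H τ g w).1 x
    by_cases h : x * g ∈ H
    · simp only [tens_apply_of_mem H τ g _ x h, map_add]
    · simp only [tens_apply_of_notMem H τ g _ x h, add_zero]
  map_smul' c v := by
    apply Subtype.ext
    funext x
    change (tens H τ g (c • v)).1 x = c • (tens H τ g v).1 x
    by_cases h : x * g ∈ H
    · simp only [tens_apply_of_mem H τ g _ x h, map_smul]
    · simp only [tens_apply_of_notMem H τ g _ x h, smul_zero]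

theorem cIndRep_tens (h g : G) (v : V) : cIndRep H τ h (tens H τ g v) = tens H τ (h * g) v := by
  apply Subtype.ext
  funext x
  change (tens H τ g v).1 (x * h) = _
  have e : x * h * g = x * (h * g) := mul_assoc _ _ _
  by_cases hx : x * h * g ∈ H
  · rw [tens_apply_of_mem H τ g _ _ hx, tens_apply_of_mem H τ (h * g) _ x (e ▸ hx)]
    congr 3
  · rw [tens_apply_of_notMem H τ g _ _ hx, tens_apply_of_notMem H τ (h * g) _ x (e ▸ hx)]

theorem tens_mul (g : G) (h : H) (v : V) : tens H τ (g * h) v = tens H τ g (τ h v) := by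
  apply Subtype.ext
  funext x
  have e : x * (g * h) = x * g * h := (mul_assoc _ _ _).symm
  have e' : x * (g * h) ∈ H ↔ x * g ∈ H := by rw [e]; exact Subgroup.mul_mem_cancel_right _ h.2
  by_cases hx : x * g ∈ H
  · rw [tens_apply_of_mem H τ g _ _ hx, tens_apply_of_mem H τ _ _ x (e'.mpr hx),
      ← Module.End.mul_apply, ← map_mul]
    congr 2
    exact Subtype.ext e
  · rw [tens_apply_of_notMem H τ g _ _ hx, tens_apply_of_notMem H τ _ _ x (mt e'.mp hx)]

end Tens

section Irr
variable {G k V : Type*} [Group G] [Field k] [AddCommGroup V] [Module k V]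

theorem isIrreducible_of_forall (ρ : Representation k G V) [Nontrivial V]
    (h : ∀ M : Submodule k V, (∀ g, ∀ v ∈ M, ρ g v ∈ M) → M ≠ ⊥ → M = ⊤) : ρ.IsIrreducible where
  exists_pair_ne := by
    refine ⟨⊥, ⊤, fun e => ?_⟩
    have e' : (⊥ : Submodule k V) = ⊤ := congrArg Subrepresentation.toSubmodule e
    exact bot_ne_top e'
  eq_bot_or_eq_top S := by
    by_cases hS : S.toSubmodule = ⊥
    · exact Or.inl (Subrepresentation.toSubmodule_injective hS)
    · exact Or.inr (Subrepresentation.toSubmodule_injective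
        (h S.toSubmodule (fun g v hv => S.apply_mem_toSubmodule g hv) hS))

end Irr

section Hecke
variable {O F : Type*} [CommRing O] [IsDomain O] [IsDiscreteValuationRing O] [Field F]
  [Algebra O F] [IsFractionRing O F]
  {k : Type*} [Field k] (p : ℕ) [Fact p.Prime] [CharP k p] {f : ℕ}
  {π : O} (hπ : Irreducible π) (ι : ResidueField O →+* k) (r : Fin f → ℕ) (w : ℕ)

variable {p hπ ι r w} in
theorem sigma_apply {h : subgroupKZ O F} {a : GL (Fin 2) O} {n : ℤ}
    (e : (h : GL (Fin 2) F) = embK O F a * scalarUnif F hπ ^ n) :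
    sigma F p hπ ι r w h = sigmaK p ι r w a := by
  rw [sigma, MonoidHom.comp_apply, partK_of_eq hπ h a n e]

theorem cIndRep_scalar (n : ℤ) : cIndRep (subgroupKZ O F) (sigma F p hπ ι r w)
    (scalarUnif F hπ ^ n) = 1 := by
  refine LinearMap.ext fun φ => Subtype.ext (funext fun x => ?_)
  change φ.1 (x * scalarUnif F hπ ^ n) = φ.1 x
  rw [← (scalarUnif_comm hπ n x).eq, indSigma_scalar]

variable [Finite (ResidueField O)]

variable (F) in
/-- The quotient `ind σ / (T)` as a representation of `K`. -/
def kRep : Representation k (GL (Fin 2) O) (IndModT F p hπ ι r w) :=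
  (indModTRep F p hπ ι r w).comp (embK O F)

variable (F) in
theorem indModTRep_scalar (n : ℤ) : indModTRep F p hπ ι r w (scalarUnif F hπ ^ n) = 1 := by
  refine LinearMap.ext fun v => ?_
  obtain ⟨φ, rfl⟩ := Submodule.Quotient.mk_surjective _ v
  change Submodule.Quotient.mk (cIndRep (subgroupKZ O F) (sigma F p hπ ι r w)
    (scalarUnif F hπ ^ n) φ) = _
  rw [cIndRep_scalar]
  rfl

variable {p hπ ι r w}

theorem indModTRep_of_mem {h : subgroupKZ O F} {a : GL (Fin 2) O} {n : ℤ}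
    (e : (h : GL (Fin 2) F) = embK O F a * scalarUnif F hπ ^ n) :
    indModTRep F p hπ ι r w h = kRep F p hπ ι r w a := by
  rw [e, map_mul, indModTRep_scalar, mul_one]
  rfl

/-- A `K`-equivariant embedding of a weight identifies it with the `KZ`-submodule generated by the
image of its highest weight vector; this submodule is irreducible. -/
theorem genKZ_of_embedding [Fintype (ResidueField O)]
    (hq : Fintype.card (ResidueField O) = p ^ f) {A : Fin f → ℕ} (hA : ∀ j, A j + 1 < p) (w' : ℕ)
    (φ : indSigma F p hπ ι r w) (θ : SymSpace k A →ₗ[k] IndModT F p hπ ι r w)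
    (hθ : Function.Injective θ) (hφ : θ (highestVec A) = Submodule.Quotient.mk φ)
    (hequiv : ∀ a x, θ (sigmaK p ι A w' a x) = kRep F p hπ ι r w a (θ x)) :
    Nonempty ((sigma F p hπ ι A w').Equiv (genKZ F p hπ ι r w φ).toRepresentation) ∧
      (genKZ F p hπ ι r w φ).toRepresentation.IsIrreducible ∧
      Module.finrank k (genKZ F p hπ ι r w φ).toSubmodule = ∏ j, (A j + 1) := by
  have hsig : ∀ (h : subgroupKZ O F) x, θ (sigma F p hπ ι A w' h x) =
      indModTRep F p hπ ι r w h (θ x) := by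
    intro h x
    obtain ⟨a, n, e⟩ := exists_decomp hπ h
    rw [sigma_apply e, indModTRep_of_mem e, hequiv]
  have hx0 : highestVec (k := k) A ≠ 0 := by
    rw [← monVec_top, ← monBasis_apply]
    exact (monBasis k A).ne_zero _
  have htop : Submodule.span k (Set.range fun a : GL (Fin 2) O =>
      sigmaK p ι A w' a (highestVec A)) = ⊤ := by
    refine eq_top_of_stable p ι hq hA w' _ ?_ ?_
    · intro a x hx
      induction hx using Submodule.span_induction with
      | mem x hx =>
        obtain ⟨g, rfl⟩ := hx
        exact Submodule.subset_span ⟨a * g, by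
          change sigmaK p ι A w' (a * g) _ = _
          rw [map_mul]; rfl⟩
      | zero => simp
      | add x y _ _ hx hy => rw [map_add]; exact Submodule.add_mem _ hx hy
      | smul c x _ hx => rw [map_smul]; exact Submodule.smul_mem _ c hx
    · refine ne_of_mem_of_not_mem' (a := highestVec A) (Submodule.subset_span ⟨1, ?_⟩) (by simpa)
      simp
  have hrange : LinearMap.range θ = (genKZ F p hπ ι r w φ).toSubmodule := by
    apply le_antisymm
    · rw [LinearMap.range_eq_map θ, ← htop, Submodule.map_span, Submodule.span_le]
      rintro _ ⟨_, ⟨a, rfl⟩, rfl⟩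
      refine Submodule.subset_span ⟨⟨embK O F a, embK_mem a⟩, ?_⟩
      simp only [hequiv, hφ]
      rfl
    · change Submodule.span k _ ≤ _
      rw [Submodule.span_le]
      rintro _ ⟨h, rfl⟩
      refine ⟨sigma F p hπ ι A w' h (highestVec A), ?_⟩
      rw [hsig, hφ]
  let e : SymSpace k A ≃ₗ[k] (genKZ F p hπ ι r w φ).toSubmodule :=
    (LinearEquiv.ofInjective θ hθ).trans (LinearEquiv.ofEq _ _ hrange)
  have he : ∀ x, ((e x : (genKZ F p hπ ι r w φ).toSubmodule) : IndModT F p hπ ι r w) = θ x :=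
    fun x => rfl
  have he' : ∀ h x, e (sigma F p hπ ι A w' h x) =
      (genKZ F p hπ ι r w φ).toRepresentation h (e x) := by
    intro h x
    apply Subtype.ext
    rw [he, hsig]
    rfl
  have hnt : Nontrivial (genKZ F p hπ ι r w φ).toSubmodule :=
    ⟨e (highestVec A), 0, fun h => hx0 (by simpa using h)⟩
  refine ⟨⟨Representation.Equiv.mk e fun h => LinearMap.ext fun x => he' h x⟩, ?_, ?_⟩
  · apply isIrreducible_of_forall
    intro M hM hM0
    have h1 : M.comap e.toLinearMap = ⊤ := by
      refine eq_top_of_stable p ι hq hA w' _ (fun a x hx => ?_) (fun h => hM0 ?_)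
      · have h2 := hM ⟨embK O F a, embK_mem a⟩ _ hx
        rw [LinearEquiv.coe_coe, ← he', sigma_apply (n := 0) (a := a) (by simp)] at h2
        exact h2
      · rw [Submodule.eq_bot_iff] at h ⊢
        intro y hy
        have := h (e.symm y) (by simpa using hy)
        simpa using this
    rw [eq_top_iff]
    intro y _
    have : e.symm y ∈ M.comap e.toLinearMap := h1 ▸ Submodule.mem_top
    simpa using this
  · rw [← e.finrank_eq, finrank_symSpace]

variable (p hπ ι r w) in
/-- The image of `g ⊗ v` in `ind σ / (T)`, as a linear function of `v`. -/
def cls (g : GL (Fin 2) F) : SymSpace k r →ₗ[k] IndModT F p hπ ι r w :=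
  (LinearMap.range (heckeT F p hπ ι r w)).mkQ ∘ₗ tensₗ (subgroupKZ O F) (sigma F p hπ ι r w) g

theorem mk_tensor (g : GL (Fin 2) F) (v : SymSpace k r) :
    (Submodule.Quotient.mk (tensor p hπ ι r w g v) : IndModT F p hπ ι r w) = cls p hπ ι r w g v := rfl

theorem kRep_cls (a : GL (Fin 2) O) (g : GL (Fin 2) F) (v : SymSpace k r) :
    kRep F p hπ ι r w a (cls p hπ ι r w g v) = cls p hπ ι r w (embK O F a * g) v := by
  change Submodule.Quotient.mk (cIndRep (subgroupKZ O F) (sigma F p hπ ι r w) (embK O F a)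
    (tens _ _ g v)) = _
  rw [cIndRep_tens]
  rfl

theorem cls_mul_embK (g : GL (Fin 2) F) (a : GL (Fin 2) O) (v : SymSpace k r) :
    cls p hπ ι r w (g * embK O F a) v = cls p hπ ι r w g (sigmaK p ι r w a v) := by
  change Submodule.Quotient.mk (tens _ _ (g * ((⟨embK O F a, embK_mem a⟩ : subgroupKZ O F) :
    GL (Fin 2) F)) v) = _
  rw [tens_mul, sigma_apply (n := 0) (a := a) (by simp)]
  rfl

theorem tensor_mul_embK (g : GL (Fin 2) F) (a : GL (Fin 2) O) (v : SymSpace k r) :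
    tensor p hπ ι r w (g * embK O F a) v = tensor p hπ ι r w g (sigmaK p ι r w a v) := by
  change tens _ _ (g * ((⟨embK O F a, embK_mem a⟩ : subgroupKZ O F) : GL (Fin 2) F)) v = _
  rw [tens_mul, sigma_apply (n := 0) (a := a) (by simp)]
  rfl

theorem tensor_scalar_mul (n : ℤ) (g : GL (Fin 2) F) (v : SymSpace k r) :
    tensor p hπ ι r w (scalarUnif F hπ ^ n * g) v = tensor p hπ ι r w g v := by
  rw [tensor, ← cIndRep_tens, cIndRep_scalar]
  rfl

end Hecke

/-! ### The tree of `GL₂(F)`: distance from the base vertex -/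

section Tree
variable {O F : Type*} [CommRing O] [IsDomain O] [IsDiscreteValuationRing O] [Field F]
  [Algebra O F] [IsFractionRing O F] {π : O} (hπ : Irreducible π)

/-- The matrix `(0, 1; 1, 0)`. -/
def swapMat {R : Type*} [CommRing R] : GL (Fin 2) R :=
  Matrix.GeneralLinearGroup.mk'' !![0, 1; 1, 0] (by simp)

theorem swapMat_mul_self {R : Type*} [CommRing R] : (swapMat : GL (Fin 2) R) * swapMat = 1 := by
  ext i j
  fin_cases i <;> fin_cases j <;> simp [swapMat, coe_mkGL, Matrix.mul_apply, Fin.sum_univ_two]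

theorem coe_cosetMat (n : ℕ) (μ : O) : (cosetMat F hπ n μ : Matrix (Fin 2) (Fin 2) F) =
    !![algebraMap O F π ^ n, algebraMap O F μ; 0, 1] := rfl

theorem coe_embK (a : GL (Fin 2) O) : (embK O F a : Matrix (Fin 2) (Fin 2) F) =
    (a : Matrix (Fin 2) (Fin 2) O).map (algebraMap O F) := rfl

theorem coe_embK_swapMat : (embK O F swapMat : Matrix (Fin 2) (Fin 2) F) = !![0, 1; 1, 0] := by
  ext i j
  fin_cases i <;> fin_cases j <;> simp [coe_embK, swapMat, coe_mkGL]

theorem coe_scalarUnif : (scalarUnif F hπ : Matrix (Fin 2) (Fin 2) F) =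
    algebraMap O F π • (1 : Matrix (Fin 2) (Fin 2) F) := by
  ext i j
  fin_cases i <;> fin_cases j <;> simp [scalarUnif, unif]

theorem cosetMat_mul_uniMat (n : ℕ) (μ x : O) :
    cosetMat F hπ n μ * embK O F (uniMat x) = cosetMat F hπ n (μ + π ^ n * x) := by
  ext i j
  fin_cases i <;> fin_cases j <;>
    simp [coe_cosetMat, coe_embK, uniMat, coe_mkGL, Matrix.mul_apply, Fin.sum_univ_two, add_comm]

theorem cosetMat_mul_cosetMat_one (n : ℕ) (μ : O) :
    cosetMat F hπ n μ * cosetMat F hπ 1 0 = cosetMat F hπ (n + 1) μ := by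
  ext i j
  fin_cases i <;> fin_cases j <;>
    simp [coe_cosetMat, Matrix.mul_apply, Fin.sum_univ_two, pow_succ]

theorem cosetMat_succ_mul_swapMat (n : ℕ) (μ : O) :
    cosetMat F hπ (n + 1) μ * (embK O F swapMat * cosetMat F hπ 1 0) =
      scalarUnif F hπ ^ (1 : ℤ) * (cosetMat F hπ n μ * embK O F swapMat) := by
  rw [zpow_one]
  ext i j
  rw [Units.val_mul (scalarUnif F hπ), coe_scalarUnif, Matrix.smul_mul, one_mul]
  fin_cases i <;> fin_cases j <;>
    simp [coe_cosetMat, coe_embK_swapMat, Matrix.mul_apply, Fin.sum_univ_two, pow_succ, mul_comm]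
  rw [Algebra.smul_def, mul_comm]

theorem cosetMat_zero (μ : O) : cosetMat F hπ 0 μ = embK O F (uniMat μ) := by
  ext i j
  fin_cases i <;> fin_cases j <;> simp [coe_cosetMat, coe_embK, uniMat, coe_mkGL]

variable {hπ} (π) in
/-- The vertex `g KZ` of the tree of `GL₂(F)` is at distance at most `n` from the base vertex `KZ`:
a multiple `M` of `g` is integral, and so is `π^n M⁻¹`. -/
def Near (n : ℕ) (g : GL (Fin 2) F) : Prop :=
  ∃ (z : Fˣ) (M M' : Matrix (Fin 2) (Fin 2) O),
    M.map (algebraMap O F) = (z : F) • (g : Matrix (Fin 2) (Fin 2) F) ∧ M * M' = π ^ n • 1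

theorem Near.embK_mul {n : ℕ} {g : GL (Fin 2) F} (h : Near π n g) (a : GL (Fin 2) O) :
    Near π n (embK O F a * g) := by
  obtain ⟨z, M, M', h1, h2⟩ := h
  refine ⟨z, (a : Matrix (Fin 2) (Fin 2) O) * M,
    M' * ((a⁻¹ : GL (Fin 2) O) : Matrix (Fin 2) (Fin 2) O), ?_, ?_⟩
  · rw [Matrix.map_mul, h1, Units.val_mul, coe_embK, Matrix.mul_smul]
  · have h3 : (a : Matrix (Fin 2) (Fin 2) O) * ((a⁻¹ : GL (Fin 2) O) : Matrix (Fin 2) (Fin 2) O) = 1 := by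
      rw [← Units.val_mul, mul_inv_cancel, Units.val_one]
    calc _ = (a : Matrix (Fin 2) (Fin 2) O) * (M * M') *
          ((a⁻¹ : GL (Fin 2) O) : Matrix (Fin 2) (Fin 2) O) := by simp only [mul_assoc]
      _ = _ := by rw [h2, Matrix.mul_smul, mul_one, Matrix.smul_mul, h3]

theorem Near.mul_embK {n : ℕ} {g : GL (Fin 2) F} (h : Near π n g) (a : GL (Fin 2) O) :
    Near π n (g * embK O F a) := by
  obtain ⟨z, M, M', h1, h2⟩ := h
  refine ⟨z, M * (a : Matrix (Fin 2) (Fin 2) O),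
    ((a⁻¹ : GL (Fin 2) O) : Matrix (Fin 2) (Fin 2) O) * M', ?_, ?_⟩
  · rw [Matrix.map_mul, h1, Units.val_mul, coe_embK, Matrix.smul_mul]
  · have h3 : (a : Matrix (Fin 2) (Fin 2) O) * ((a⁻¹ : GL (Fin 2) O) : Matrix (Fin 2) (Fin 2) O) = 1 := by
      rw [← Units.val_mul, mul_inv_cancel, Units.val_one]
    calc _ = M * ((a : Matrix (Fin 2) (Fin 2) O) *
          ((a⁻¹ : GL (Fin 2) O) : Matrix (Fin 2) (Fin 2) O)) * M' := by simp only [mul_assoc]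
      _ = _ := by rw [h3, mul_one, h2]

theorem Near.scalar_mul {n : ℕ} {g : GL (Fin 2) F} (h : Near π n g) (j : ℤ) :
    Near π n (scalarUnif F hπ ^ j * g) := by
  obtain ⟨z, M, M', h1, h2⟩ := h
  have e : ((scalarUnif F hπ ^ j * g : GL (Fin 2) F) : Matrix (Fin 2) (Fin 2) F) =
      ((unif F hπ ^ j : Fˣ) : F) • (g : Matrix (Fin 2) (Fin 2) F) := by
    rw [scalarUnif, ← map_zpow, Units.val_mul]
    have : ((Matrix.GeneralLinearGroup.scalar (Fin 2) (unif F hπ ^ j) : GL (Fin 2) F) :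
        Matrix (Fin 2) (Fin 2) F) = ((unif F hπ ^ j : Fˣ) : F) • 1 := by
      rw [Matrix.smul_one_eq_diagonal]
      rfl
    rw [this, Matrix.smul_mul, one_mul]
  refine ⟨z * (unif F hπ ^ j)⁻¹, M, M', ?_, h2⟩
  rw [h1, e, smul_smul, Units.val_mul, mul_assoc, ← Units.val_mul, inv_mul_cancel, Units.val_one,
    mul_one]

theorem Near.mul_mem (hπ : Irreducible π) {n : ℕ} {g h : GL (Fin 2) F} (hg : Near π n g) (hh : h ∈ subgroupKZ O F) :
    Near π n (g * h) := by
  obtain ⟨a, j, e⟩ := exists_decomp hπ ⟨h, hh⟩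
  change h = _ at e
  rw [e, ← mul_assoc, ← (scalarUnif_comm hπ j _).eq]
  exact (hg.mul_embK a).scalar_mul hπ j

theorem near_cosetMat (n : ℕ) (μ : O) : Near π n (cosetMat F hπ n μ) := by
  refine ⟨1, !![π ^ n, μ; 0, 1], !![1, -μ; 0, π ^ n], ?_, ?_⟩
  · ext i j
    fin_cases i <;> fin_cases j <;> simp [coe_cosetMat]
  · ext i j
    fin_cases i <;> fin_cases j <;> simp [Matrix.mul_apply, Fin.sum_univ_two]; ring

theorem near_zero_of_mem (hπ : Irreducible π) {g : GL (Fin 2) F} (h : g ∈ subgroupKZ O F) : Near π 0 g := by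
  have := (near_cosetMat (F := F) hπ 0 0).mul_mem hπ h
  rwa [cosetMat_zero, show uniMat (0 : O) = 1 by
    ext i j; fin_cases i <;> fin_cases j <;> simp [uniMat, coe_mkGL], map_one, one_mul] at this

theorem le_of_near_cosetMat {n m : ℕ} {μ : O} (h : Near π n (cosetMat F hπ m μ)) : m ≤ n := by
  obtain ⟨z, M, M', h1, h2⟩ := h
  have hinj := IsFractionRing.injective O F
  have e := fun i j => congrFun (congrFun h1 i) j
  have e00 := e 0 0
  have e10 := e 1 0
  have e11 := e 1 1
  simp only [Matrix.map_apply, coe_cosetMat, Matrix.smul_apply, Matrix.of_apply, Matrix.cons_val',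
    Matrix.cons_val_zero, Matrix.cons_val_one, Matrix.cons_val_fin_one, smul_eq_mul, mul_zero,
    mul_one] at e00 e10 e11
  have m10 : M 1 0 = 0 := hinj (by rw [e10, map_zero])
  have m11 : M 1 1 ≠ 0 := fun h0 => z.ne_zero (by rw [← e11, h0, map_zero])
  have m00 : M 0 0 = π ^ m * M 1 1 := hinj (by rw [e00, map_mul, e11, map_pow, mul_comm])
  have f10 := congrFun (congrFun h2 1) 0
  have f00 := congrFun (congrFun h2 0) 0
  simp [Matrix.mul_apply, Fin.sum_univ_two, m10, m11] at f10 f00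
  rw [f10, mul_zero, add_zero, m00] at f00
  have : π ^ m ∣ π ^ n := ⟨M 1 1 * M' 0 0, by rw [← f00, mul_assoc]⟩
  exact (pow_dvd_pow_iff hπ.ne_zero hπ.not_isUnit).mp this

theorem exists_unit_entry (hπ : Irreducible π) {M : Matrix (Fin 2) (Fin 2) O} (hM : M ≠ 0) :
    ∃ (e : ℕ) (N : Matrix (Fin 2) (Fin 2) O), M = π ^ e • N ∧ ∃ i j, IsUnit (N i j) := by
  classical
  have hdvd : ∀ e : ℕ, (∀ i j, π ^ e ∣ M i j) → ∃ N : Matrix (Fin 2) (Fin 2) O, M = π ^ e • N := by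
    intro e he
    choose N hN using he
    exact ⟨N, by ext i j; rw [hN]; rfl⟩
  obtain ⟨i₀, j₀, h0⟩ : ∃ i j, M i j ≠ 0 := by
    by_contra! h
    exact hM (by ext i j; simp [h])
  obtain ⟨m, u, hm⟩ := IsDiscreteValuationRing.eq_unit_mul_pow_irreducible h0 hπ
  have hbd : ∀ e : ℕ, (∀ i j, π ^ e ∣ M i j) → e ≤ m := by
    intro e he
    have := he i₀ j₀
    rw [hm, Units.dvd_mul_left] at this
    exact (pow_dvd_pow_iff hπ.ne_zero hπ.not_isUnit).mp this
  let e := Nat.findGreatest (fun e => ∀ i j, π ^ e ∣ M i j) m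
  have he : ∀ i j, π ^ e ∣ M i j :=
    Nat.findGreatest_spec (P := fun e => ∀ i j, π ^ e ∣ M i j) (Nat.zero_le m) (by simp)
  obtain ⟨N, hN⟩ := hdvd e he
  refine ⟨e, N, hN, ?_⟩
  by_contra! hu
  have h1 : ∀ i j, π ^ (e + 1) ∣ M i j := by
    intro i j
    have : π ∣ N i j := by
      rw [← Ideal.mem_span_singleton, ← hπ.maximalIdeal_eq]
      exact (IsLocalRing.mem_maximalIdeal _).mpr (hu i j)
    rw [hN, Matrix.smul_apply, smul_eq_mul, pow_succ]
    exact mul_dvd_mul_left _ this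
  have := Nat.le_findGreatest (P := fun e => ∀ i j, π ^ e ∣ M i j) (hbd _ h1) h1
  omega

/-- Gaussian elimination for an integral matrix with an invertible entry. -/
theorem exists_smith {N : Matrix (Fin 2) (Fin 2) O} (hN : ∃ i j, IsUnit (N i j)) :
    ∃ (a b : GL (Fin 2) O) (d : O), N = (a : Matrix (Fin 2) (Fin 2) O) * !![d, 0; 0, 1] * b := by
  have key : ∀ N : Matrix (Fin 2) (Fin 2) O, IsUnit (N 1 1) →
      ∃ (a b : GL (Fin 2) O) (d : O), N = (a : Matrix (Fin 2) (Fin 2) O) * !![d, 0; 0, 1] * b := by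
    rintro N ⟨u, hu⟩
    refine ⟨uniMat (N 0 1 * (u⁻¹ : Oˣ)), Matrix.GeneralLinearGroup.mk'' !![1, 0; N 1 0, u] (by simp),
      N 0 0 - N 0 1 * (u⁻¹ : Oˣ) * N 1 0, ?_⟩
    have hu' : ((u⁻¹ : Oˣ) : O) * N 1 1 = 1 := by rw [← hu, Units.inv_mul]
    ext i j
    fin_cases i <;> fin_cases j <;>
      simp [uniMat, coe_mkGL, Matrix.mul_apply, Fin.sum_univ_two, hu, mul_assoc, hu']
  have hs : (swapMat : GL (Fin 2) O).val * (swapMat : GL (Fin 2) O).val = 1 := by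
    rw [← Units.val_mul, swapMat_mul_self, Units.val_one]
  have hl : ∀ (N : Matrix (Fin 2) (Fin 2) O) j, ((swapMat : GL (Fin 2) O).val * N) 1 j = N 0 j := by
    intro N j
    simp [swapMat, coe_mkGL, Matrix.mul_apply, Fin.sum_univ_two]
  have hr : ∀ (N : Matrix (Fin 2) (Fin 2) O) i, (N * (swapMat : GL (Fin 2) O).val) i 1 = N i 0 := by
    intro N j
    simp [swapMat, coe_mkGL, Matrix.mul_apply, Fin.sum_univ_two]
  have keyl : ∀ N : Matrix (Fin 2) (Fin 2) O, ∀ i, IsUnit (N i 1) →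
      ∃ (a b : GL (Fin 2) O) (d : O), N = (a : Matrix (Fin 2) (Fin 2) O) * !![d, 0; 0, 1] * b := by
    intro N i hi
    fin_cases i
    · obtain ⟨a, b, d, h⟩ := key ((swapMat : GL (Fin 2) O).val * N) (by rw [hl]; exact hi)
      refine ⟨swapMat * a, b, d, ?_⟩
      rw [Units.val_mul, mul_assoc, mul_assoc, ← mul_assoc (a : Matrix (Fin 2) (Fin 2) O), ← h,
        ← mul_assoc, hs, one_mul]
    · exact key N hi
  obtain ⟨i, j, hij⟩ := hN
  fin_cases j
  · obtain ⟨a, b, d, h⟩ := keyl (N * (swapMat : GL (Fin 2) O).val) i (by rw [hr]; exact hij)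
    refine ⟨a, b * swapMat, d, ?_⟩
    rw [Units.val_mul, ← mul_assoc, ← h, mul_assoc, hs, mul_one]
  · exact keyl N i hij

/-- The Cartan decomposition. -/
theorem Near.exists_cartan {n : ℕ} {g : GL (Fin 2) F} (h : Near π n g) :
    ∃ m ≤ n, ∃ a : GL (Fin 2) O, ∃ c ∈ subgroupKZ O F, g = embK O F a * cosetMat F hπ m 0 * c := by
  obtain ⟨z, M, M', h1, h2⟩ := h
  have hinj := IsFractionRing.injective O F
  have hM : M ≠ 0 := by
    rintro rfl
    rw [zero_mul] at h2
    have := congrFun (congrFun h2 0) 0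
    simp at this
    exact pow_ne_zero n hπ.ne_zero this.symm
  obtain ⟨e, N, rfl, hN⟩ := exists_unit_entry hπ hM
  obtain ⟨a, b, d, rfl⟩ := exists_smith hN
  -- The elementary divisor `d` divides `π ^ n`.
  have hd : d ∣ π ^ n := by
    have h3 : (!![d, 0; 0, 1] : Matrix (Fin 2) (Fin 2) O) *
        ((b : Matrix (Fin 2) (Fin 2) O) * (π ^ e • M') * (a : Matrix (Fin 2) (Fin 2) O)) =
        π ^ n • 1 := by
      have h4 : ((a⁻¹ : GL (Fin 2) O) : Matrix (Fin 2) (Fin 2) O) * (a : Matrix (Fin 2) (Fin 2) O) = 1 := by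
        rw [← Units.val_mul, inv_mul_cancel, Units.val_one]
      calc _ = ((a⁻¹ : GL (Fin 2) O) : Matrix (Fin 2) (Fin 2) O) *
            (π ^ e • ((a : Matrix (Fin 2) (Fin 2) O) * !![d, 0; 0, 1] * b) * M') * a := by
              rw [Matrix.smul_mul, Matrix.mul_smul, Matrix.smul_mul, Matrix.mul_smul,
                Matrix.mul_smul, Matrix.smul_mul]
              congr 1
              simp only [← mul_assoc, h4, one_mul]
        _ = _ := by rw [h2, Matrix.mul_smul, mul_one, Matrix.smul_mul, h4]
    have h5 := congrFun (congrFun h3 0) 0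
    rw [Matrix.mul_apply, Fin.sum_univ_two] at h5
    simp at h5
    exact ⟨_, h5.symm⟩
  obtain ⟨m, hm, hdm⟩ := (dvd_prime_pow hπ.prime n).mp hd
  obtain ⟨u, hu⟩ := hdm.symm
  obtain ⟨z', hz'⟩ : ∃ z' : Fˣ, z' = z⁻¹ * unif F hπ ^ e := ⟨_, rfl⟩
  refine ⟨m, hm, a * diaMat u 1, embK O F b * Matrix.GeneralLinearGroup.scalar (Fin 2) z',
    (subgroupKZ O F).mul_mem (embK_mem b) (Subgroup.mem_sup_right ?_), ?_⟩
  · rw [Matrix.GeneralLinearGroup.center_eq_range_scalar]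
    exact ⟨_, rfl⟩
  · have h6 : (g : Matrix (Fin 2) (Fin 2) F) = (z' : F) •
        ((a : Matrix (Fin 2) (Fin 2) O) * !![d, 0; 0, 1] * b).map (algebraMap O F) := by
      have h7 : ((π ^ e • ((a : Matrix (Fin 2) (Fin 2) O) * !![d, 0; 0, 1] * b)).map
          (algebraMap O F)) = (unif F hπ : F) ^ e •
            ((a : Matrix (Fin 2) (Fin 2) O) * !![d, 0; 0, 1] * b).map (algebraMap O F) := by
        ext i j
        rw [Matrix.map_apply, Matrix.smul_apply, Matrix.smul_apply, Matrix.map_apply, smul_eq_mul,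
          map_mul, map_pow]
        rfl
      rw [h7] at h1
      rw [hz', Units.val_mul, mul_smul, Units.val_pow_eq_pow_val, h1, smul_smul, ← Units.val_mul,
        inv_mul_cancel, Units.val_one, one_smul]
    apply Units.ext
    rw [h6, Units.val_mul, Units.val_mul, Units.val_mul, map_mul (embK O F), Units.val_mul, coe_embK, coe_embK,
      coe_embK, Matrix.map_mul, Matrix.map_mul]
    have h8 : ((Matrix.GeneralLinearGroup.scalar (Fin 2) z' : GL (Fin 2) F) :
        Matrix (Fin 2) (Fin 2) F) = (z' : F) • 1 := by
      ext i j
      fin_cases i <;> fin_cases j <;> simp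
    have h9 : (!![d, 0; 0, 1] : Matrix (Fin 2) (Fin 2) O).map (algebraMap O F) =
        (diaMat u 1 : GL (Fin 2) O).val.map (algebraMap O F) *
          (cosetMat F hπ m 0 : Matrix (Fin 2) (Fin 2) F) := by
      ext i j
      fin_cases i <;> fin_cases j <;>
        simp [diaMat, coe_mkGL, coe_cosetMat, Matrix.mul_apply, Fin.sum_univ_two, ← hu, mul_comm]
    rw [h9, h8, Matrix.mul_smul, Matrix.mul_smul, mul_one]
    simp only [mul_assoc]

theorem exists_near (hπ : Irreducible π) (g : GL (Fin 2) F) : ∃ n, Near π n g := by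
  obtain ⟨b, hb⟩ := IsLocalization.exist_integer_multiples_of_finite (nonZeroDivisors O)
    (fun ij : Fin 2 × Fin 2 => (g : Matrix (Fin 2) (Fin 2) F) ij.1 ij.2)
  choose N hN using hb
  have hb0 : algebraMap O F b ≠ 0 := by
    rw [Ne, FaithfulSMul.algebraMap_eq_zero_iff]
    exact nonZeroDivisors.ne_zero b.2
  let M : Matrix (Fin 2) (Fin 2) O := fun i j => N (i, j)
  have hM : M.map (algebraMap O F) = algebraMap O F b • (g : Matrix (Fin 2) (Fin 2) F) := by
    ext i j
    have := hN (i, j)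
    simp only [Algebra.smul_def] at this
    exact this
  have hdet : M.det ≠ 0 := by
    intro h0
    have h1 : (M.map (algebraMap O F)).det = 0 := by
      rw [← RingHom.mapMatrix_apply, ← RingHom.map_det, h0, map_zero]
    rw [hM, Matrix.det_smul] at h1
    have h2 : (g : Matrix (Fin 2) (Fin 2) F).det ≠ 0 :=
      (Matrix.GeneralLinearGroup.det g).ne_zero
    exact mul_ne_zero (pow_ne_zero _ hb0) h2 h1
  obtain ⟨n, u, hu⟩ := IsDiscreteValuationRing.eq_unit_mul_pow_irreducible hdet hπ
  refine ⟨n, Units.mk0 _ hb0, M, (u⁻¹ : Oˣ).val • M.adjugate, hM, ?_⟩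
  rw [Matrix.mul_smul, Matrix.mul_adjugate, hu, smul_smul, ← mul_assoc, Units.inv_mul, one_mul]

theorem dvd_of_inv_cosetMat_mul_mem {n : ℕ} {μ ν : O}
    (h : (cosetMat F hπ n μ)⁻¹ * cosetMat F hπ n ν ∈ subgroupKZ O F) : π ^ n ∣ ν - μ := by
  obtain ⟨z, M, M', h1, h2⟩ := near_zero_of_mem hπ h
  have hinj := IsFractionRing.injective O F
  have h3 : (cosetMat F hπ n μ : Matrix (Fin 2) (Fin 2) F) * M.map (algebraMap O F) =
      (z : F) • (cosetMat F hπ n ν : Matrix (Fin 2) (Fin 2) F) := by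
    rw [h1, Matrix.mul_smul, ← Units.val_mul, mul_inv_cancel_left]
  have e := fun i j => congrFun (congrFun h3 i) j
  have e01 := e 0 1
  have e11 := e 1 1
  have e10 := e 1 0
  simp [coe_cosetMat, Matrix.mul_apply, Fin.sum_univ_two] at e01 e11 e10
  have f11 := congrFun (congrFun h2 1) 1
  simp [Matrix.mul_apply, Fin.sum_univ_two, e10] at f11
  have hu : IsUnit (M 1 1) := IsUnit.of_mul_eq_one _ f11
  have h4 : π ^ n * M 0 1 = M 1 1 * (ν - μ) := hinj (by
    rw [← e11] at e01
    simp only [map_mul, map_sub, map_pow]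
    linear_combination e01)
  exact (hu.dvd_mul_left).mp ⟨_, h4.symm⟩

theorem cosetMat_one_inv_mul_swapMat_notMem (μ : O) :
    (cosetMat F hπ 1 μ)⁻¹ * (embK O F swapMat * cosetMat F hπ 1 0) ∉ subgroupKZ O F := by
  intro h
  obtain ⟨z, M, M', h1, h2⟩ := near_zero_of_mem hπ h
  have hinj := IsFractionRing.injective O F
  have h3 : (cosetMat F hπ 1 μ : Matrix (Fin 2) (Fin 2) F) * M.map (algebraMap O F) =
      (z : F) • ((embK O F swapMat * cosetMat F hπ 1 0 : GL (Fin 2) F) :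
        Matrix (Fin 2) (Fin 2) F) := by
    rw [h1, Matrix.mul_smul, ← Units.val_mul, mul_inv_cancel_left]
  have e := fun i j => congrFun (congrFun h3 i) j
  have e01 := e 0 1
  have e11 := e 1 1
  have e10 := e 1 0
  simp [coe_cosetMat, coe_embK, swapMat, coe_mkGL, Matrix.mul_apply, Fin.sum_univ_two] at e01 e11 e10
  have f11 := congrFun (congrFun h2 1) 1
  simp [Matrix.mul_apply, Fin.sum_univ_two, e11] at f11
  -- The entry of `M` below the diagonal is divisible by `π`, so `M` cannot be invertible.
  have h4 : M 1 0 = π * (π * M 0 1) := hinj (by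
    rw [e11, map_zero, mul_zero, add_zero] at e01
    rw [map_mul, map_mul, e01, e10]; ring)
  rw [h4] at f11
  exact hπ.not_isUnit (IsUnit.of_mul_eq_one (π * M 0 1 * M' 0 1) (by rw [← f11]; ring))

end Tree

/-! ### The Hecke operator on the tree -/

section TopCoef
variable {k : Type*} [Field k] (p : ℕ) [Fact p.Prime] [CharP k p] {f : ℕ}
  {R : Type*} [CommRing R] (χ : R →+* k)

/-- The coefficient of `⨂_j x_j^{A_j}`. -/
def topCoef {A : Fin f → ℕ} : SymSpace k A →ₗ[k] k :=
  LinearMap.proj (Exps.top A) ∘ₗ symCoord k A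

/-- The exponents `A_j - b_j`. -/
def Exps.rev {A : Fin f → ℕ} (b : Exps A) : Exps A := Exps.mk (A - b.val) fun _ => Nat.sub_le _ _

theorem Exps.rev_val {A : Fin f → ℕ} (b : Exps A) : b.rev.val = A - b.val := rfl

theorem Exps.rev_rev {A : Fin f → ℕ} (b : Exps A) : b.rev.rev = b := by
  apply Exps.val_injective
  funext j
  exact Nat.sub_sub_self (b.val_le j)

theorem topCoef_monVec {A : Fin f → ℕ} (b : Exps A) :
    topCoef (monVec k b) = if b = Exps.top A then 1 else 0 := by
  rw [topCoef, LinearMap.comp_apply, symCoord_monVec, LinearMap.proj_apply, Pi.single_apply]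
  exact if_congr eq_comm rfl rfl

theorem topCoef_highestVec (A : Fin f → ℕ) : topCoef (highestVec (k := k) A) = 1 := by
  rw [← monVec_top, topCoef_monVec, if_pos rfl]

/-- Evaluation at `x_j = 1`, `y_j = 0`. -/
def evalX (k : Type*) [Field k] (f : ℕ) : MvPolynomial (Fin f × Fin 2) k →ₐ[k] k :=
  MvPolynomial.aeval fun v => if v.2 = 0 then 1 else 0

theorem evalX_symMonomial (A a : Fin f → ℕ) :
    evalX k f (symMonomial k A a) = if a = 0 then 1 else 0 := by
  simp only [evalX, symMonomial, map_prod, map_mul, map_pow, MvPolynomial.aeval_X]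
  by_cases h : a = 0
  · rw [if_pos h]
    simp [h]
  · rw [if_neg h]
    obtain ⟨j, hj⟩ : ∃ j, a j ≠ 0 := by
      by_contra! h'
      exact h (funext h')
    exact Finset.prod_eq_zero (Finset.mem_univ j) (by simp [hj])

theorem topCoef_eq_evalX {A : Fin f → ℕ} (v : SymSpace k A) :
    topCoef v = evalX k f (symIncl k A v) := by
  suffices h : topCoef = (evalX k f).toLinearMap ∘ₗ symIncl k A from LinearMap.congr_fun h v
  refine (monBasis k A).ext fun b => ?_
  rw [monBasis_apply, topCoef_monVec, LinearMap.comp_apply, monVec, symIncl_symVec]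
  change _ = evalX k f _
  rw [evalX_symMonomial]
  refine if_congr ⟨fun h => ?_, fun h => Exps.val_injective (funext fun j => ?_)⟩ rfl rfl
  · rw [h, Exps.top, Exps.val_mk, tsub_self]
  · have h1 : A j - b.val j = 0 := congrFun h j
    exact le_antisymm (b.val_le j) (Nat.sub_eq_zero_iff_le.mp h1)

theorem topCoef_uniMat_monVec {A : Fin f → ℕ} (w : ℕ) (x : R) (b : Exps A) :
    topCoef (weightRep p χ A w (uniMat x) (monVec k b)) = χ x ^ digVal p b.rev.val := by
  rw [topCoef_eq_evalX, symIncl_weightRep, monVec, symIncl_symVec, substHom_symMonomial, map_smul,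
    map_prod, Exps.rev_val, ← prod_frobEmb_pow]
  simp [uniMat, coe_mkGL, evalX]

theorem topCoef_uniMat {A : Fin f → ℕ} (w : ℕ) (x : R) (v : SymSpace k A) :
    topCoef (weightRep p χ A w (uniMat x) v) =
      ∑ b : Exps A, χ x ^ digVal p b.val • (monBasis k A).repr v b.rev := by
  conv_lhs => rw [← (monBasis k A).sum_repr v]
  simp only [map_sum, map_smul, monBasis_apply, topCoef_uniMat_monVec]
  refine Fintype.sum_equiv (Function.Involutive.toPerm _ (Exps.rev_rev (A := A))) _ _ fun b => ?_
  change _ = χ x ^ digVal p b.rev.val • (monBasis k A).repr v b.rev.rev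
  rw [Exps.rev_rev, smul_eq_mul, smul_eq_mul, mul_comm]

theorem weightRep_swapMat {A : Fin f → ℕ} (w : ℕ) (b : Exps A) :
    weightRep p χ A w swapMat (monVec k b) = (-1 : k) ^ w • monVec k b.rev := by
  apply symIncl_injective
  rw [symIncl_weightRep, monVec, symIncl_symVec, substHom_symMonomial, map_smul, monVec,
    symIncl_symVec]
  congr 1
  · simp [swapMat, coe_mkGL, Matrix.det_fin_two_of]
  · rw [symMonomial]
    refine Finset.prod_congr rfl fun j _ => ?_
    have h := b.val_le j
    simp [swapMat, coe_mkGL, Exps.rev_val, mul_comm, Nat.sub_sub_self h]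

theorem symVec_self_eq (A : Fin f → ℕ) (h) : symVec k A A h = monVec k (Exps.top A).rev := by
  apply symIncl_injective
  rw [monVec, symIncl_symVec, symIncl_symVec, Exps.rev_val, Exps.top, Exps.val_mk, tsub_self, tsub_zero]

theorem evalYLin_monVec_rev {A : Fin f → ℕ} (b : Exps A) :
    evalYLin k A (monVec k b.rev) = topCoef (monVec k b) := by
  change evalY k f (symMonomial k A (A - b.rev.val)) = _
  have e : A - b.rev.val = b.val := by
    rw [← Exps.rev_val, Exps.rev_rev]
  rw [e, topCoef_monVec]
  simp only [evalY, symMonomial, map_prod, map_mul, map_pow, MvPolynomial.aeval_X]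
  by_cases h : b = Exps.top A
  · rw [if_pos h]
    simp [h, Exps.top, Exps.val_mk]
  · rw [if_neg h]
    obtain ⟨j, hj⟩ : ∃ j, b.val j ≠ A j := by
      by_contra! h'
      exact h (Exps.val_injective (funext h'))
    exact Finset.prod_eq_zero (Finset.mem_univ j) (by
      rw [if_neg (by simp), zero_pow (Nat.sub_ne_zero_of_lt (lt_of_le_of_ne (b.val_le j) hj)),
        zero_mul])

theorem swapMat_projY_swapMat {A : Fin f → ℕ} (w : ℕ) (v : SymSpace k A) :
    weightRep p χ A w swapMat (projY k A (weightRep p χ A w swapMat v)) =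
      topCoef v • highestVec A := by
  suffices h : weightRep p χ A w swapMat ∘ₗ projY k A ∘ₗ weightRep p χ A w swapMat =
      topCoef.smulRight (highestVec A) from LinearMap.congr_fun h v
  refine (monBasis k A).ext fun b => ?_
  rw [monBasis_apply, LinearMap.comp_apply, LinearMap.comp_apply, weightRep_swapMat, map_smul,
    projY, LinearMap.smulRight_apply, evalYLin_monVec_rev, symVec_self_eq, map_smul, map_smul,
    weightRep_swapMat, Exps.rev_rev, monVec_top, LinearMap.smulRight_apply, smul_smul, smul_smul,
    mul_right_comm, ← pow_add, Even.neg_one_pow ⟨w, rfl⟩, one_mul]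

end TopCoef

section Hecke
variable {O F : Type*} [CommRing O] [IsDomain O] [IsDiscreteValuationRing O] [Field F]
  [Algebra O F] [IsFractionRing O F]
  {k : Type*} [Field k] {p : ℕ} [Fact p.Prime] [CharP k p] {f : ℕ}
  {π : O} {hπ : Irreducible π} {ι : ResidueField O →+* k} {r : Fin f → ℕ} {w : ℕ}

/-- If `n(x) v` has no component along `⨂_j x_j^{A_j}` for any `x`, then `v = 0`. -/
theorem eq_zero_of_topCoef_uniMat [Fintype (ResidueField O)]
    (hq : Fintype.card (ResidueField O) = p ^ f) (hr : ∀ j, r j + 1 < p) (v : SymSpace k r)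
    (h : ∀ x : O, topCoef (sigmaK p ι r w (uniMat x) v) = 0) : v = 0 := by
  apply (monBasis k r).repr.injective
  ext b
  rw [map_zero, Finsupp.zero_apply]
  choose lift hlift using residue_surjective (R := O)
  have h1 := sum_pow_smul_expansion ι hq hr (fun c => (monBasis k r).repr v c.rev) b.rev
  rw [Exps.rev_rev, eq_comm, neg_eq_iff_eq_neg] at h1
  rw [h1, neg_eq_zero]
  refine Finset.sum_eq_zero fun t _ => ?_
  have h2 := h (lift t)
  rw [sigmaK, topCoef_uniMat] at h2
  simp only [RingHom.comp_apply, hlift] at h2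
  rw [h2, smul_zero]

/-- The support of `φ` lies at distance less than `N` from the base vertex. -/
def InBall (φ : indSigma F p hπ ι r w) (N : ℕ) : Prop :=
  ∀ g : GL (Fin 2) F, φ.1 g⁻¹ ≠ 0 → ∃ m < N, Near π m g

theorem InBall.eq_zero {φ : indSigma F p hπ ι r w} (h : InBall φ 0) : φ = 0 := by
  apply Subtype.ext
  funext x
  by_contra h0
  obtain ⟨m, hm, -⟩ := h x⁻¹ (by rwa [inv_inv])
  omega

theorem exists_inBall (φ : indSigma F p hπ ι r w) : ∃ N, InBall φ N := by
  obtain ⟨S, hS, hS'⟩ := φ.2.2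
  choose d hd using fun x : GL (Fin 2) F => exists_near (F := F) hπ x⁻¹
  obtain ⟨N, hN⟩ := Set.Finite.bddAbove (Set.Finite.image d hS)
  refine ⟨N + 1, fun g hg => ?_⟩
  obtain ⟨s, hs, h, e⟩ := hS' _ hg
  refine ⟨d s, Nat.lt_succ_of_le (hN ⟨s, hs, rfl⟩), ?_⟩
  rw [inv_eq_iff_eq_inv, mul_inv_rev] at e
  rw [e]
  exact (hd s).mul_mem hπ (inv_mem h.2)

theorem inBall_tensor {n : ℕ} {g : GL (Fin 2) F} (h : Near π n g) (v : SymSpace k r) :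
    InBall (tensor p hπ ι r w g v) (n + 1) := by
  intro x hx
  have h1 : x⁻¹ * g ∈ subgroupKZ O F := by
    by_contra h1
    exact hx (tens_apply_of_notMem _ _ _ _ _ h1)
  refine ⟨n, Nat.lt_succ_self n, ?_⟩
  have e : x = g * (x⁻¹ * g)⁻¹ := by group
  rw [e]
  exact h.mul_mem hπ (inv_mem h1)

theorem InBall.add {φ ψ : indSigma F p hπ ι r w} {n : ℕ} (hφ : InBall φ n) (hψ : InBall ψ n) :
    InBall (φ + ψ) n := by
  intro g hg
  by_cases h : φ.1 g⁻¹ = 0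
  · refine hψ g fun h' => hg ?_
    change φ.1 g⁻¹ + ψ.1 g⁻¹ = 0
    rw [h, h', add_zero]
  · exact hφ g h

theorem InBall.sum {α : Type*} (s : Finset α) {φ : α → indSigma F p hπ ι r w} {n : ℕ}
    (h : ∀ a ∈ s, InBall (φ a) n) : InBall (∑ a ∈ s, φ a) n := by
  classical
  induction s using Finset.induction_on with
  | empty => exact fun g hg => absurd rfl hg
  | insert a s ha ih =>
    rw [Finset.sum_insert ha]
    exact (h a (Finset.mem_insert_self a s)).add
      (ih fun b hb => h b (Finset.mem_insert_of_mem hb))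

theorem apply_inv_mul_embK (φ : indSigma F p hπ ι r w) (g : GL (Fin 2) F) (a : GL (Fin 2) O) :
    φ.1 (g * embK O F a)⁻¹ = sigmaK p ι r w a⁻¹ (φ.1 g⁻¹) := by
  rw [mul_inv_rev, ← map_inv, indSigma_embK]

theorem uniMat_inv {R : Type*} [CommRing R] (x : R) : (uniMat x)⁻¹ = uniMat (-x) := by
  rw [inv_eq_iff_mul_eq_one]
  ext i j
  fin_cases i <;> fin_cases j <;> simp [uniMat, coe_mkGL, Matrix.mul_apply, Fin.sum_univ_two]

theorem uniMat_mul {R : Type*} [CommRing R] (x y : R) : uniMat x * uniMat y = uniMat (x + y) := by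
  ext i j
  fin_cases i <;> fin_cases j <;>
    simp [uniMat, coe_mkGL, Matrix.mul_apply, Fin.sum_univ_two, add_comm]

/-- Representatives of `K / K₀`: the matrices `n(x)`, and the swap. -/
theorem exists_eq_mul_of_K (b : GL (Fin 2) O) :
    (∃ h ∈ subgroupK₀ O, b = swapMat * h) ∨ ∃ x : O, ∃ h ∈ subgroupK₀ O, b = uniMat x * h := by
  by_cases hb : residue O (b 1 1) = 0
  · refine Or.inl ⟨swapMat * b, ?_, by rw [← mul_assoc, swapMat_mul_self, one_mul]⟩
    rw [mem_subgroupK₀]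
    simp [swapMat, coe_mkGL, Matrix.mul_apply, Fin.sum_univ_two, hb]
  · obtain ⟨u, hu⟩ := (residue_ne_zero_iff_isUnit _).mp hb
    have hu' : ((u⁻¹ : Oˣ) : O) * b 1 1 = 1 := by rw [← hu, Units.inv_mul]
    refine Or.inr ⟨b 0 1 * (u⁻¹ : Oˣ), (uniMat (b 0 1 * (u⁻¹ : Oˣ)))⁻¹ * b, ?_, by simp⟩
    rw [mem_subgroupK₀, uniMat_inv]
    simp [uniMat, coe_mkGL, Matrix.mul_apply, Fin.sum_univ_two, mul_assoc, hu']

/-- The representative `x` of the coset in `exists_eq_mul_of_K` only matters modulo `π`. -/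
theorem exists_eq_mul_lift (lift : ResidueField O → O) (hlift : ∀ t, residue O (lift t) = t)
    (b : GL (Fin 2) O) : (∃ h ∈ subgroupK₀ O, b = swapMat * h) ∨
      ∃ t : ResidueField O, ∃ h ∈ subgroupK₀ O, b = uniMat (lift t) * h := by
  rcases exists_eq_mul_of_K b with h | ⟨x, h, hh, rfl⟩
  · exact Or.inl h
  · refine Or.inr ⟨residue O x, uniMat (x - lift (residue O x)) * h, mul_mem ?_ hh, ?_⟩
    · rw [mem_subgroupK₀]
      simp [uniMat, coe_mkGL, hlift]
    · rw [← mul_assoc, uniMat_mul, add_sub_cancel]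

theorem cosetMat_mul_K₀ (g : GL (Fin 2) F) (h : GL (Fin 2) O) (hh : h ∈ subgroupK₀ O) :
    ∃ h', g * embK O F h * cosetMat F hπ 1 0 = g * cosetMat F hπ 1 0 * embK O F h' := by
  obtain ⟨h', e, -⟩ := conj_cosetMat (F := F) hπ h hh
  exact ⟨h', by rw [mul_assoc, e, mul_assoc]⟩

variable [Finite (ResidueField O)]

/-- On the sphere just outside the support of `ψ`, the function `T ψ` is given by a single term. -/
theorem heckeT_apply_of_inBall {ψ : indSigma F p hπ ι r w} {N : ℕ} (hψ : InBall ψ (N + 1)) (μ : O) :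
    (heckeT F p hπ ι r w ψ).1 (cosetMat F hπ (N + 1) μ)⁻¹ =
      topCoef (ψ.1 (cosetMat F hπ N μ)⁻¹) • highestVec r := by
  change ∑ᶠ c, heckeTerm ψ _ c = _
  rw [finsum_eq_single _ ((swapMat : GL (Fin 2) O) : GL (Fin 2) O ⧸ subgroupK₀ O)]
  · rw [heckeTerm_mk]
    have e : (embK O F swapMat * cosetMat F hπ 1 0)⁻¹ * (cosetMat F hπ (N + 1) μ)⁻¹ =
        (scalarUnif F hπ ^ (1 : ℤ) * (cosetMat F hπ N μ * embK O F swapMat))⁻¹ := by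
      rw [← cosetMat_succ_mul_swapMat, ← mul_inv_rev]
    have e2 : ψ.1 (scalarUnif F hπ ^ (1 : ℤ) * (cosetMat F hπ N μ * embK O F swapMat))⁻¹ =
        sigmaK p ι r w swapMat (ψ.1 (cosetMat F hπ N μ)⁻¹) := by
      rw [mul_inv_rev, ← zpow_neg, ← (scalarUnif_comm hπ _ _).eq, indSigma_scalar,
        apply_inv_mul_embK, inv_eq_of_mul_eq_one_left swapMat_mul_self]
    rw [e, e2, sigmaK, swapMat_projY_swapMat]
  · intro c hc
    induction c using QuotientGroup.induction_on with
    | H b =>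
      rw [heckeTerm_mk]
      rcases exists_eq_mul_of_K b with ⟨h, hh, rfl⟩ | ⟨x, h, hh, rfl⟩
      · exact absurd (QuotientGroup.eq.mpr (by simpa using hh)) hc
      · suffices h0 : ψ.1 ((embK O F (uniMat x * h) * cosetMat F hπ 1 0)⁻¹ *
            (cosetMat F hπ (N + 1) μ)⁻¹) = 0 by rw [h0, map_zero, map_zero]
        by_contra h0
        rw [← mul_inv_rev] at h0
        obtain ⟨m, hm, hn⟩ := hψ _ h0
        obtain ⟨h', e⟩ := cosetMat_mul_K₀ (hπ := hπ) (cosetMat F hπ (N + 1) (μ + π ^ (N + 1) * x)) h hh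
        rw [map_mul, ← mul_assoc, ← mul_assoc, cosetMat_mul_uniMat, e, cosetMat_mul_cosetMat_one] at hn
        have := hn.mul_embK h'⁻¹
        rw [mul_assoc, ← map_mul, mul_inv_cancel, map_one, mul_one] at this
        have := le_of_near_cosetMat hπ this
        omega

/-- The Hecke operator strictly enlarges supports. -/
theorem InBall.of_heckeT [Fintype (ResidueField O)] (hq : Fintype.card (ResidueField O) = p ^ f)
    (hr : ∀ j, r j + 1 < p) {ψ : indSigma F p hπ ι r w} {n : ℕ}
    (h : InBall (heckeT F p hπ ι r w ψ) (n + 1)) : InBall ψ n := by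
  have step : ∀ N, n ≤ N → InBall ψ (N + 1) → InBall ψ N := by
    intro N hN hψ g hg
    obtain ⟨m, hm, hn⟩ := hψ g hg
    obtain ⟨m', hm', a, c, hc, e⟩ := hn.exists_cartan hπ
    rcases Nat.lt_or_ge m' N with hlt | hge
    · refine ⟨m', hlt, ?_⟩
      rw [e]
      exact ((near_cosetMat hπ m' 0).embK_mul a).mul_mem hπ hc
    obtain rfl : m' = N := by omega
    exfalso
    obtain ⟨ψ', hψ'⟩ : ∃ ψ', ψ' = cIndRep (subgroupKZ O F) (sigma F p hπ ι r w) (embK O F a⁻¹) ψ :=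
      ⟨_, rfl⟩
    have hev : ∀ x, ψ'.1 x = ψ.1 (x * embK O F a⁻¹) := fun x => by rw [hψ']; rfl
    have hball : InBall ψ' (m' + 1) := by
      intro x hx
      rw [hev, map_inv, ← mul_inv_rev] at hx
      obtain ⟨l, hl, hnl⟩ := hψ _ hx
      refine ⟨l, hl, ?_⟩
      have := hnl.embK_mul a⁻¹
      rwa [← mul_assoc, ← map_mul, inv_mul_cancel, map_one, one_mul] at this
    have hT : ∀ x, (heckeT F p hπ ι r w ψ').1 x = (heckeT F p hπ ι r w ψ).1 (x * embK O F a⁻¹) := by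
      intro x
      rw [hψ', heckeT_comm]
      rfl
    have hzero : ∀ x : O, topCoef (sigmaK p ι r w (uniMat x) (ψ'.1 (cosetMat F hπ m' 0)⁻¹)) = 0 := by
      intro x
      have h1 := heckeT_apply_of_inBall hball (0 + π ^ m' * (-x))
      rw [← cosetMat_mul_uniMat hπ m', apply_inv_mul_embK, uniMat_inv, neg_neg] at h1
      have h2 : (heckeT F p hπ ι r w ψ').1 (cosetMat F hπ (m' + 1) (0 + π ^ m' * (-x)))⁻¹ = 0 := by
        by_contra h0
        rw [hT, map_inv, ← mul_inv_rev] at h0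
        obtain ⟨l, hl, hnl⟩ := h _ h0
        have := hnl.embK_mul a⁻¹
        rw [← mul_assoc, ← map_mul, inv_mul_cancel, map_one, one_mul] at this
        have := le_of_near_cosetMat hπ this
        omega
      rw [h2] at h1
      have h3 := congrArg topCoef h1
      rwa [map_zero, map_smul, topCoef_highestVec, smul_eq_mul, mul_one, eq_comm] at h3
    have h4 := eq_zero_of_topCoef_uniMat hq hr _ hzero
    rw [hev, map_inv, ← mul_inv_rev] at h4
    apply hg
    rw [e, mul_inv_rev]
    have := ψ.2.1 ⟨c⁻¹, inv_mem hc⟩ (embK O F a * cosetMat F hπ m' 0)⁻¹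
    rw [h4, map_zero] at this
    exact this
  obtain ⟨N₀, hN₀⟩ := exists_inBall ψ
  have main : ∀ d, InBall ψ (n + d) → InBall ψ n := by
    intro d
    induction d with
    | zero => exact id
    | succ d ih => exact fun h' => ih (step (n + d) (Nat.le_add_right _ _) h')
  exact main N₀ fun g hg => by
    obtain ⟨m, hm, h'⟩ := hN₀ g hg
    exact ⟨m, by omega, h'⟩

/-- No nonzero function supported on the base vertex lies in the image of `T`. -/
theorem eq_zero_of_mem_range [Fintype (ResidueField O)]
    (hq : Fintype.card (ResidueField O) = p ^ f) (hr : ∀ j, r j + 1 < p)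
    {φ : indSigma F p hπ ι r w} (hφ : InBall φ 1)
    (h : φ ∈ LinearMap.range (heckeT F p hπ ι r w)) : φ = 0 := by
  obtain ⟨ψ, rfl⟩ := h
  rw [(InBall.of_heckeT hq hr hφ).eq_zero, map_zero]

/-- On the outermost sphere of its support, an element of the image of `T` takes values in the line
of the highest weight vector; along the neighbours of a vertex of the previous sphere these values
are polynomials with exponents at most `r`. -/
theorem exists_of_mem_range [Fintype (ResidueField O)]
    (hq : Fintype.card (ResidueField O) = p ^ f) (hr : ∀ j, r j + 1 < p)
    {φ : indSigma F p hπ ι r w} {n : ℕ} (hφ : InBall φ (n + 2))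
    (h : φ ∈ LinearMap.range (heckeT F p hπ ι r w)) (μ : O) :
    ∃ u : Exps r → k, ∀ x : O, φ.1 (cosetMat F hπ (n + 1) (μ + π ^ n * x))⁻¹ =
      (∑ b : Exps r, ι (residue O x) ^ digVal p b.val • u b) • highestVec r := by
  obtain ⟨ψ, rfl⟩ := h
  have hψ := InBall.of_heckeT hq hr hφ
  -- The value at `-x` is turned into a value at `x` by the signs.
  refine ⟨fun b => (-1) ^ digVal p b.val *
    (monBasis k r).repr (ψ.1 (cosetMat F hπ n μ)⁻¹) b.rev, fun x => ?_⟩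
  rw [heckeT_apply_of_inBall hψ, ← cosetMat_mul_uniMat, apply_inv_mul_embK, uniMat_inv, sigmaK,
    topCoef_uniMat]
  congr 1
  refine Finset.sum_congr rfl fun b _ => ?_
  rw [RingHom.comp_apply, map_neg, map_neg, neg_pow, smul_eq_mul, smul_eq_mul]
  ring

/-- The formula for `T (g ⊗ v)`. -/
theorem heckeT_tensor [Fintype (ResidueField O)] (lift : ResidueField O → O)
    (hlift : ∀ t, residue O (lift t) = t) (g : GL (Fin 2) F) (v : SymSpace k r) :
    heckeT F p hπ ι r w (tensor p hπ ι r w g v) =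
      ∑ t : ResidueField O, tensor p hπ ι r w (g * cosetMat F hπ 1 (lift t))
        (topCoef (sigmaK p ι r w (uniMat (-lift t)) v) • highestVec r) +
      tensor p hπ ι r w (g * (embK O F swapMat * cosetMat F hπ 1 0))
        (topCoef (sigmaK p ι r w swapMat v) • highestVec r) := by
  -- By equivariance it is enough to treat `g = 1`.
  suffices h1 : heckeT F p hπ ι r w (tensor p hπ ι r w 1 v) =
      ∑ t : ResidueField O, tensor p hπ ι r w (cosetMat F hπ 1 (lift t))
        (topCoef (sigmaK p ι r w (uniMat (-lift t)) v) • highestVec r) +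
      tensor p hπ ι r w (embK O F swapMat * cosetMat F hπ 1 0)
        (topCoef (sigmaK p ι r w swapMat v) • highestVec r) by
    have h2 := congrArg (cIndRep (subgroupKZ O F) (sigma F p hπ ι r w) g) h1
    rw [← heckeT_comm, map_add, map_sum] at h2
    simp only [tensor, cIndRep_tens, mul_one] at h2
    exact h2
  have hnear : InBall (tensor p hπ ι r w (1 : GL (Fin 2) F) v) 1 :=
    inBall_tensor (near_zero_of_mem hπ (one_mem _)) v
  have hone : ∀ a : GL (Fin 2) O, (tensor p hπ ι r w (1 : GL (Fin 2) F) v).1 (embK O F a) =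
      sigmaK p ι r w a v := by
    intro a
    have h1 : embK O F a * 1 ∈ subgroupKZ O F := by rw [mul_one]; exact embK_mem a
    rw [tensor, tens_apply_of_mem _ _ _ _ _ h1, sigma_apply (n := 0) (a := a) (by simp)]
  have hL : ∀ x : O, (heckeT F p hπ ι r w (tensor p hπ ι r w 1 v)).1 (cosetMat F hπ 1 x)⁻¹ =
      topCoef (sigmaK p ι r w (uniMat (-x)) v) • highestVec r := by
    intro x
    rw [heckeT_apply_of_inBall (N := 0) hnear, cosetMat_zero, ← map_inv, hone, uniMat_inv]
  have hL' : (heckeT F p hπ ι r w (tensor p hπ ι r w 1 v)).1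
      (embK O F swapMat * cosetMat F hπ 1 0)⁻¹ =
      topCoef (sigmaK p ι r w swapMat v) • highestVec r := by
    have e : (embK O F swapMat * cosetMat F hπ 1 0)⁻¹ =
        (cosetMat F hπ 1 0)⁻¹ * embK O F swapMat := by
      rw [mul_inv_rev, ← map_inv, inv_eq_of_mul_eq_one_left swapMat_mul_self]
    have h1 : (heckeT F p hπ ι r w (tensor p hπ ι r w 1 v)).1
        ((cosetMat F hπ 1 0)⁻¹ * embK O F swapMat) = (heckeT F p hπ ι r w
          (cIndRep (subgroupKZ O F) (sigma F p hπ ι r w) (embK O F swapMat)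
            (tensor p hπ ι r w 1 v))).1 (cosetMat F hπ 1 0)⁻¹ := by
      rw [heckeT_comm]
      rfl
    have h2 : cIndRep (subgroupKZ O F) (sigma F p hπ ι r w) (embK O F swapMat)
        (tensor p hπ ι r w 1 v) = tensor p hπ ι r w 1 (sigmaK p ι r w swapMat v) := by
      rw [← tensor_mul_embK, tensor, cIndRep_tens, one_mul, mul_one]
      rfl
    have hnear' : InBall (tensor p hπ ι r w (1 : GL (Fin 2) F) (sigmaK p ι r w swapMat v)) 1 :=
      inBall_tensor (near_zero_of_mem hπ (one_mem _)) _
    rw [e, h1, h2, heckeT_apply_of_inBall (N := 0) hnear', cosetMat_zero, ← h2]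
    have h3 : (cIndRep (subgroupKZ O F) (sigma F p hπ ι r w) (embK O F swapMat)
        (tensor p hπ ι r w (1 : GL (Fin 2) F) v)).1 (embK O F (uniMat 0))⁻¹ =
        (tensor p hπ ι r w (1 : GL (Fin 2) F) v).1 ((embK O F (uniMat 0))⁻¹ * embK O F swapMat) := rfl
    rw [h3, ← map_inv, ← map_mul, hone, uniMat_inv, neg_zero,
      show uniMat (0 : O) = 1 by
        ext i j; fin_cases i <;> fin_cases j <;> simp [uniMat, coe_mkGL], one_mul]
  -- Both sides are determined by their values at the neighbours of the base vertex.
  obtain ⟨D, hD⟩ : ∃ D, D = heckeT F p hπ ι r w (tensor p hπ ι r w 1 v) -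
    (∑ t : ResidueField O, tensor p hπ ι r w (cosetMat F hπ 1 (lift t))
        (topCoef (sigmaK p ι r w (uniMat (-lift t)) v) • highestVec r) +
      tensor p hπ ι r w (embK O F swapMat * cosetMat F hπ 1 0)
        (topCoef (sigmaK p ι r w swapMat v) • highestVec r)) := ⟨_, rfl⟩
  have hDx : ∀ x, D.1 x = (heckeT F p hπ ι r w (tensor p hπ ι r w 1 v)).1 x -
    (∑ t : ResidueField O, (tensor p hπ ι r w (cosetMat F hπ 1 (lift t))
        (topCoef (sigmaK p ι r w (uniMat (-lift t)) v) • highestVec r)).1 x +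
      (tensor p hπ ι r w (embK O F swapMat * cosetMat F hπ 1 0)
        (topCoef (sigmaK p ι r w swapMat v) • highestVec r)).1 x) := by
    intro x
    rw [hD, ← Finset.sum_apply]
    simp
  rw [← sub_eq_zero, ← hD]
  have hD1 : ∀ t, D.1 (cosetMat F hπ 1 (lift t))⁻¹ = 0 := by
    intro t
    have h1 : (cosetMat F hπ 1 (lift t))⁻¹ * cosetMat F hπ 1 (lift t) ∈ subgroupKZ O F := by
      rw [inv_mul_cancel]; exact one_mem _
    rw [hDx, hL, Finset.sum_eq_single t, tensor, tensor, tens_apply_of_mem _ _ _ _ _ h1,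
      tens_apply_of_notMem _ _ _ _ _ (cosetMat_one_inv_mul_swapMat_notMem hπ _), add_zero,
      sigma_apply (n := 0) (a := 1) (by simp), map_one, Module.End.one_apply, sub_self]
    · intro t' _ ht'
      refine tens_apply_of_notMem _ _ _ _ _ fun h2 => ht' ?_
      have h3 := dvd_of_inv_cosetMat_mul_mem hπ h2
      rw [pow_one, ← Ideal.mem_span_singleton, ← hπ.maximalIdeal_eq, ← residue_eq_zero_iff, map_sub,
        hlift, hlift, sub_eq_zero] at h3
      exact h3
    · simp
  have hD2 : D.1 (embK O F swapMat * cosetMat F hπ 1 0)⁻¹ = 0 := by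
    have h1 : (embK O F swapMat * cosetMat F hπ 1 0)⁻¹ * (embK O F swapMat * cosetMat F hπ 1 0) ∈
        subgroupKZ O F := by
      rw [inv_mul_cancel]; exact one_mem _
    rw [hDx, hL', Finset.sum_eq_zero, tensor, tens_apply_of_mem _ _ _ _ _ h1, zero_add,
      sigma_apply (n := 0) (a := 1) (by simp), map_one, Module.End.one_apply, sub_self]
    intro t _
    refine tens_apply_of_notMem _ _ _ _ _ fun h2 => ?_
    apply cosetMat_one_inv_mul_swapMat_notMem (F := F) hπ (lift t)
    have := inv_mem h2
    rwa [mul_inv_rev, inv_inv] at this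
  have hclose : ∀ (g' : GL (Fin 2) F), D.1 g'⁻¹ = 0 → ∀ x, x * g' ∈ subgroupKZ O F → D.1 x = 0 := by
    intro g' h0 x hx
    have := D.2.1 ⟨x * g', hx⟩ g'⁻¹
    rw [h0, map_zero] at this
    simpa using this
  apply Subtype.ext
  funext x
  change D.1 x = 0
  by_contra hx
  have hT0 : ∀ t, x * cosetMat F hπ 1 (lift t) ∉ subgroupKZ O F := fun t h =>
    hx (hclose _ (hD1 t) x h)
  have hS0 : x * (embK O F swapMat * cosetMat F hπ 1 0) ∉ subgroupKZ O F := fun h =>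
    hx (hclose _ hD2 x h)
  rw [hDx, Finset.sum_eq_zero, tensor, tensor, tens_apply_of_notMem _ _ _ _ _ hS0, add_zero,
    sub_zero] at hx
  · change ∑ᶠ c, heckeTerm _ x c ≠ 0 at hx
    obtain ⟨c, hc⟩ : ∃ c, heckeTerm (tensor p hπ ι r w 1 v) x c ≠ 0 := by
      by_contra! h0
      exact hx (finsum_eq_zero_of_forall_eq_zero h0)
    induction c using QuotientGroup.induction_on with
    | H b =>
      have h1 : (tensor p hπ ι r w (1 : GL (Fin 2) F) v).1 ((embK O F b * cosetMat F hπ 1 0)⁻¹ * x) ≠ 0 := by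
        intro h0
        rw [heckeTerm_mk, h0, map_zero, map_zero] at hc
        exact hc rfl
      have h2 : (embK O F b * cosetMat F hπ 1 0)⁻¹ * x * 1 ∈ subgroupKZ O F := by
        by_contra h2
        exact h1 (tens_apply_of_notMem _ _ _ _ _ h2)
      -- Use that `δ` and `δ⁻¹` generate the same `KZ`-double coset.
      obtain ⟨s, hs, es⟩ := cosetMat_weyl (F := F) (hπ := hπ)
      have h3 : x⁻¹ * (embK O F b * cosetMat F hπ 1 0) ∈ subgroupKZ O F := by
        have := inv_mem h2
        rwa [mul_one, mul_inv_rev, inv_inv] at this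
      obtain ⟨a, j, hj⟩ := exists_decomp hπ ⟨_, h2⟩
      change (embK O F b * cosetMat F hπ 1 0)⁻¹ * x * 1 = _ at hj
      have hx' : x = embK O F b * cosetMat F hπ 1 0 * (embK O F a * scalarUnif F hπ ^ j) := by
        rw [← hj]; group
      have hmem : ∀ h : GL (Fin 2) O, a⁻¹ * s = h → x * (embK O F h * cosetMat F hπ 1 0) ∈ subgroupKZ O F := by
        rintro h rfl
        have e : x * (embK O F (a⁻¹ * s) * cosetMat F hπ 1 0) =
            scalarUnif F hπ ^ (j + 1) * (embK O F (b * s)) := by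
          have c1 := scalarUnif_comm (F := F) hπ 1
          have cj := scalarUnif_comm (F := F) hπ j
          have hss : embK O F s * embK O F s = 1 := by rw [← map_mul, hs, map_one]
          rw [hx', map_mul, map_mul, map_inv, zpow_add]
          generalize (cosetMat F hπ 1 0) = δ at es ⊢
          generalize scalarUnif F hπ ^ (1 : ℤ) = z1 at es c1 ⊢
          generalize scalarUnif F hπ ^ j = zj at cj ⊢
          generalize embK O F a = A
          generalize embK O F b = B
          generalize embK O F s = S at *
          calc B * δ * (A * zj) * (A⁻¹ * S * δ) = B * δ * (zj * A) * (A⁻¹ * S * δ) := by rw [(cj A).eq]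
            _ = B * δ * (zj * (S * δ)) := by group
            _ = B * δ * (zj * (S * (z1 * (S * δ⁻¹ * S)))) := by rw [← es]
            _ = B * δ * (zj * (S * z1 * (S * δ⁻¹ * S))) := by simp only [mul_assoc]
            _ = B * δ * (zj * (z1 * S * (S * δ⁻¹ * S))) := by rw [← (c1 S).eq]
            _ = B * δ * (zj * (z1 * ((S * S) * δ⁻¹ * S))) := by simp only [mul_assoc]
            _ = B * δ * (zj * (z1 * (δ⁻¹ * S))) := by rw [hss, one_mul]
            _ = (B * δ * zj) * z1 * (δ⁻¹ * S) := by simp only [mul_assoc]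
            _ = zj * ((B * δ) * z1 * (δ⁻¹ * S)) := by rw [← (cj _).eq]; simp only [mul_assoc]
            _ = zj * (z1 * (B * δ) * (δ⁻¹ * S)) := by rw [← (c1 _).eq]
            _ = zj * z1 * (B * S) := by group
        rw [e]
        exact mul_mem (scalarUnif_zpow_mem hπ _) (embK_mem _)
      have h4 := hmem _ rfl
      rcases exists_eq_mul_lift lift hlift (a⁻¹ * s) with ⟨h, hh, eh⟩ | ⟨t, h, hh, eh⟩
      · obtain ⟨h', e, -⟩ := conj_cosetMat (F := F) hπ h hh
        apply hS0
        rw [eh, map_mul, mul_assoc (embK O F swapMat), e, ← mul_assoc, ← mul_assoc] at h4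
        rw [← mul_assoc]
        exact (Subgroup.mul_mem_cancel_right _ (embK_mem h')).mp h4
      · obtain ⟨h', e, -⟩ := conj_cosetMat (F := F) hπ h hh
        apply hT0 t
        have e2 : cosetMat F hπ 1 (lift t) = embK O F (uniMat (lift t)) * cosetMat F hπ 1 0 := by
          rw [← cosetMat_zero hπ, cosetMat_mul_cosetMat_one]
        rw [eh, map_mul, mul_assoc (embK O F (uniMat (lift t))), e, ← mul_assoc, ← mul_assoc] at h4
        rw [e2, ← mul_assoc]
        exact (Subgroup.mul_mem_cancel_right _ (embK_mem h')).mp h4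
  · intro t _
    exact tens_apply_of_notMem _ _ _ _ _ (hT0 t)

end Hecke

/-! ### Teichmüller representatives and digits -/

section Teich
variable {O : Type*} [CommRing O] [IsDomain O] [IsDiscreteValuationRing O]
  [Fintype (ResidueField O)] {p f : ℕ} {π : O}

/-- Every residue class contains a root of `x^q = x`, where `q` is the cardinality of the residue
field. This holds when `O` is complete, and makes `teichmuller` meaningful. -/
def HasTeichmuller (O : Type*) [CommRing O] [IsLocalRing O] : Prop :=
  ∀ μ : ResidueField O, ∃ x : O, x ^ Nat.card (ResidueField O) = x ∧ residue O x = μ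

theorem HasTeichmuller.residue (h : HasTeichmuller O) (μ : ResidueField O) :
    residue O (teichmuller μ) = μ := (Classical.epsilon_spec (h μ)).2

theorem HasTeichmuller.pow (h : HasTeichmuller O) (μ : ResidueField O) :
    (teichmuller μ : O) ^ Fintype.card (ResidueField O) = teichmuller μ := by
  rw [← Nat.card_eq_fintype_card]
  exact (Classical.epsilon_spec (h μ)).1

theorem dvd_iff_residue (hπ : Irreducible π) {x : O} : π ∣ x ↔ residue O x = 0 := by
  rw [residue_eq_zero_iff, hπ.maximalIdeal_eq, Ideal.mem_span_singleton]

theorem dvd_sub_iff_residue (hπ : Irreducible π) {x y : O} :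
    π ∣ x - y ↔ residue O x = residue O y := by
  rw [dvd_iff_residue hπ, map_sub, sub_eq_zero]

/-- Roots of `x^q = x` are determined by their residue classes. -/
theorem eq_of_pow_card_eq {x y : O} (hx : x ^ Fintype.card (ResidueField O) = x)
    (hy : y ^ Fintype.card (ResidueField O) = y) (h : residue O x = residue O y) : x = y := by
  obtain ⟨q, hq⟩ : ∃ q, q = Fintype.card (ResidueField O) := ⟨_, rfl⟩
  rw [← hq] at hx hy
  have h1 := Commute.geom_sum₂_mul (Commute.all x y) q
  rw [hx, hy] at h1
  have h2 : residue O (∑ i ∈ Finset.range q, x ^ i * y ^ (q - 1 - i)) = 0 := by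
    have h3 : (q : ResidueField O) = 0 := by rw [hq]; exact Nat.cast_card_eq_zero _
    rw [map_sum]
    have : ∀ i ∈ Finset.range q, residue O (x ^ i * y ^ (q - 1 - i)) = residue O x ^ (q - 1) := by
      intro i hi
      rw [map_mul, map_pow, map_pow, ← h, ← pow_add]
      congr 1
      have := Finset.mem_range.mp hi
      omega
    rw [Finset.sum_congr rfl this, Finset.sum_const, Finset.card_range, nsmul_eq_mul, h3, zero_mul]
  by_contra hne
  rw [← sub_eq_zero, ← sub_one_mul, mul_eq_zero, or_iff_left (sub_ne_zero.mpr hne), sub_eq_zero] at h1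
  rw [h1, map_one] at h2
  exact one_ne_zero h2

theorem teichmuller_mul (hT : HasTeichmuller O) (a b : ResidueField O) :
    (teichmuller (a * b) : O) = teichmuller a * teichmuller b :=
  eq_of_pow_card_eq (hT.pow _) (by rw [mul_pow, hT.pow, hT.pow])
    (by rw [map_mul, hT.residue, hT.residue, hT.residue])

theorem teichmuller_zero (hT : HasTeichmuller O) : (teichmuller (0 : ResidueField O) : O) = 0 :=
  eq_of_pow_card_eq (hT.pow _) (by rw [zero_pow Fintype.card_ne_zero])
    (by rw [map_zero, hT.residue])

theorem teichmuller_one (hT : HasTeichmuller O) : (teichmuller (1 : ResidueField O) : O) = 1 :=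
  eq_of_pow_card_eq (hT.pow _) (one_pow _) (by rw [map_one, hT.residue])

theorem teichmuller_pow (hT : HasTeichmuller O) (a : ResidueField O) (n : ℕ) :
    (teichmuller (a ^ n) : O) = teichmuller a ^ n := by
  induction n with
  | zero => rw [pow_zero, pow_zero, teichmuller_one hT]
  | succ n ih => rw [pow_succ, pow_succ, teichmuller_mul hT, ih]

section Carry
variable [Fact p.Prime]

theorem residue_natCast_prime (hq : Fintype.card (ResidueField O) = p ^ f) :
    (p : ResidueField O) = 0 := by
  have h0 : ((p ^ f : ℕ) : ResidueField O) = 0 := by rw [← hq]; exact Nat.cast_card_eq_zero _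
  rw [Nat.cast_pow] at h0
  exact eq_zero_of_pow_eq_zero h0

/-- Congruent elements have `p`-th powers that are congruent modulo `π^2`. -/
theorem sq_dvd_pow_sub_pow (hπ : Irreducible π) (hq : Fintype.card (ResidueField O) = p ^ f)
    {x y : O} (h : π ∣ x - y) : π ^ 2 ∣ x ^ p - y ^ p := by
  rw [← Commute.geom_sum₂_mul (Commute.all x y) p, sq]
  refine mul_dvd_mul ?_ h
  rw [dvd_sub_iff_residue hπ] at h
  rw [dvd_iff_residue hπ, map_sum]
  have : ∀ i ∈ Finset.range p, residue O (x ^ i * y ^ (p - 1 - i)) = residue O x ^ (p - 1) := by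
    intro i hi
    rw [map_mul, map_pow, map_pow, ← h, ← pow_add]
    congr 1
    have := Finset.mem_range.mp hi
    omega
  rw [Finset.sum_congr rfl this, Finset.sum_const, Finset.card_range, nsmul_eq_mul,
    residue_natCast_prime hq, zero_mul]

/-- Addition of Teichmüller representatives modulo `π^2`: the sum of two `p`-th powers. -/
theorem sq_dvd_teichmuller_add_sub (hπ : Irreducible π)
    (hq : Fintype.card (ResidueField O) = p ^ f) (hT : HasTeichmuller O) (a b : ResidueField O) :
    π ^ 2 ∣ teichmuller (a ^ p + b ^ p) - (teichmuller a + teichmuller b) ^ p := by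
  have : CharP (ResidueField O) p :=
    (CharP.charP_iff_prime_eq_zero Fact.out).mpr (residue_natCast_prime hq)
  rw [← add_pow_char, teichmuller_pow hT]
  refine sq_dvd_pow_sub_pow hπ hq ?_
  rw [dvd_sub_iff_residue hπ, map_add, hT.residue, hT.residue, hT.residue]

theorem exists_pow_eq (hq : Fintype.card (ResidueField O) = p ^ f) (a : ResidueField O) :
    ∃ b, b ^ p = a := by
  have : CharP (ResidueField O) p :=
    (CharP.charP_iff_prime_eq_zero Fact.out).mpr (residue_natCast_prime hq)
  exact (Finite.injective_iff_surjective.mp (frobenius_inj (ResidueField O) p)) a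

/-- If `π^2` divides `p`, then Teichmüller representatives are additive modulo `π^2`. -/
theorem sq_dvd_add_sub_teichmuller (hπ : Irreducible π)
    (hq : Fintype.card (ResidueField O) = p ^ f) (hT : HasTeichmuller O) (hp : π ^ 2 ∣ (p : O))
    (a b : ResidueField O) : π ^ 2 ∣ teichmuller a + teichmuller b - teichmuller (a + b) := by
  obtain ⟨a, rfl⟩ := exists_pow_eq hq a
  obtain ⟨b, rfl⟩ := exists_pow_eq hq b
  have h1 := sq_dvd_teichmuller_add_sub hπ hq hT a b
  obtain ⟨c, hc⟩ := exists_add_pow_prime_eq (Fact.out : p.Prime) (teichmuller a : O) (teichmuller b)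
  rw [hc] at h1
  have h2 : π ^ 2 ∣ (p : O) * teichmuller a * teichmuller b * c :=
    Dvd.dvd.mul_right (Dvd.dvd.mul_right (Dvd.dvd.mul_right hp _) _) _
  rw [teichmuller_pow hT, teichmuller_pow hT]
  have h3 := dvd_add h1 h2
  rw [← dvd_neg]
  convert h3 using 1
  ring

/-- Adding `1` to a Teichmüller representative, modulo `π^2`. -/
theorem sq_dvd_carry (hπ : Irreducible π)
    (hq : Fintype.card (ResidueField O) = p ^ f) (hT : HasTeichmuller O) (a : ResidueField O) :
    π ^ 2 ∣ teichmuller (a ^ p + 1) - 1 - teichmuller (a ^ p) -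
      p * ∑ i ∈ Finset.range (p - 1), ((p.choose (i + 1) / p : ℕ) : O) * teichmuller a ^ (i + 1) := by
  have h1 := sq_dvd_teichmuller_add_sub hπ hq hT a 1
  rw [one_pow, teichmuller_one hT, add_pow] at h1
  obtain ⟨n, hn⟩ : ∃ n, p = n + 1 := ⟨p - 1, by have := (Fact.out : p.Prime).pos; omega⟩
  have h2 : ∀ i ∈ Finset.range (p - 1), (p : O) * (((p.choose (i + 1) / p : ℕ) : O) *
      teichmuller a ^ (i + 1)) = teichmuller a ^ (i + 1) * 1 ^ (p - (i + 1)) * (p.choose (i + 1) : O) := by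
    intro i hi
    have hd : p ∣ p.choose (i + 1) := (Fact.out : p.Prime).dvd_choose_self (by omega) (by
      have := Finset.mem_range.mp hi; omega)
    rw [one_pow, mul_one, ← mul_assoc, ← Nat.cast_mul, Nat.mul_div_cancel' hd, mul_comm]
  rw [Finset.mul_sum, Finset.sum_congr rfl h2, teichmuller_pow hT]
  rw [Finset.sum_range_succ, show Finset.range p = Finset.range ((p - 1) + 1) by
    rw [Nat.sub_add_cancel (Fact.out : p.Prime).one_le], Finset.sum_range_succ'] at h1
  convert h1 using 1
  simp
  ring

end Carry

section Digits

theorem digitSum_snoc {n : ℕ} (μ : Fin n → ResidueField O) (t : ResidueField O) :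
    digitSum π (Fin.snoc μ t : Fin (n + 1) → ResidueField O) =
      digitSum π μ + π ^ n * teichmuller t := by
  simp [digitSum, Fin.sum_univ_castSucc]

theorem eq_of_pow_dvd_digitSum_sub (hπ : Irreducible π) (hT : HasTeichmuller O) :
    ∀ {n : ℕ} {μ ν : Fin n → ResidueField O}, π ^ n ∣ digitSum π μ - digitSum π ν → μ = ν
  | 0, _, _, _ => Subsingleton.elim _ _
  | n + 1, μ, ν, h => by
    induction μ using Fin.snocCases with | _ μ t
    induction ν using Fin.snocCases with | _ ν t'
    rw [digitSum_snoc, digitSum_snoc] at h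
    have h1 : π ^ n ∣ digitSum π μ - digitSum π ν := by
      have h2 := (pow_dvd_pow π n.le_succ).trans h
      have h3 : π ^ n ∣ π ^ n * (teichmuller t - teichmuller t') := dvd_mul_right _ _
      have h4 := dvd_sub h2 h3
      convert h4 using 1
      ring
    obtain rfl := eq_of_pow_dvd_digitSum_sub hπ hT h1
    rw [add_sub_add_left_eq_sub, ← mul_sub, pow_succ,
      mul_dvd_mul_iff_left (pow_ne_zero n hπ.ne_zero), dvd_sub_iff_residue hπ, hT.residue,
      hT.residue] at h
    rw [h]

theorem exists_digits (hπ : Irreducible π) (hT : HasTeichmuller O) (n : ℕ) (x : O) :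
    ∃ μ : Fin n → ResidueField O, π ^ n ∣ x - digitSum π μ := by
  induction n with
  | zero => exact ⟨Fin.elim0, by simp⟩
  | succ n ih =>
    obtain ⟨μ, y, hy⟩ := ih
    refine ⟨Fin.snoc μ (residue O y), ?_⟩
    rw [digitSum_snoc, ← sub_sub, hy, ← mul_sub, pow_succ]
    refine mul_dvd_mul_left _ ?_
    rw [dvd_sub_iff_residue hπ, hT.residue]

theorem sum_snoc {M : Type*} [AddCommMonoid M] {κ : Type*} [Fintype κ] {n : ℕ}
    (G : (Fin (n + 1) → κ) → M) :
    ∑ μ : Fin (n + 1) → κ, G μ = ∑ μ : Fin n → κ, ∑ t : κ, G (Fin.snoc μ t) := by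
  rw [← Equiv.sum_comp (Fin.snocEquiv fun _ => κ), Fintype.sum_prod_type_right]
  rfl

/-- A sum over representatives modulo `π^n` may be reindexed by any map that is injective
modulo `π^n`. -/
theorem sum_digitSum_comp {M : Type*} [AddCommMonoid M] (hπ : Irreducible π)
    (hT : HasTeichmuller O) {n : ℕ} (Y : O → M) (hY : ∀ x y, π ^ n ∣ x - y → Y x = Y y)
    (σ : O → O) (hσ : ∀ x y, π ^ n ∣ σ x - σ y → π ^ n ∣ x - y) :
    ∑ μ : Fin n → ResidueField O, Y (σ (digitSum π μ)) =
      ∑ μ : Fin n → ResidueField O, Y (digitSum π μ) := by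
  choose dg hdg using exists_digits hπ hT n
  have hinj : Function.Injective fun μ : Fin n → ResidueField O => dg (σ (digitSum π μ)) := by
    intro μ ν h
    have h1 := hdg (σ (digitSum π μ))
    have h2 := hdg (σ (digitSum π ν))
    change dg (σ (digitSum π μ)) = dg (σ (digitSum π ν)) at h
    rw [h] at h1
    refine eq_of_pow_dvd_digitSum_sub hπ hT (hσ _ _ ?_)
    have := dvd_sub h1 h2
    rwa [sub_sub_sub_cancel_right] at this
  rw [← Equiv.sum_comp (Equiv.ofBijective _ (Finite.injective_iff_bijective.mp hinj))
    fun μ => Y (digitSum π μ)]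
  exact Finset.sum_congr rfl fun μ _ => hY _ _ (hdg _)

end Digits
end Teich

/-! ### Relations and linear independence in the quotient by `T` -/

section Hecke
variable {O F : Type*} [CommRing O] [IsDomain O] [IsDiscreteValuationRing O] [Field F]
  [Algebra O F] [IsFractionRing O F]
  {k : Type*} [Field k] {p : ℕ} [Fact p.Prime] [CharP k p] {f : ℕ}
  {π : O} {hπ : Irreducible π} {ι : ResidueField O →+* k} {r : Fin f → ℕ} {w : ℕ}
  [Fintype (ResidueField O)]

theorem cosetMat_mul_cosetMat (n : ℕ) (x y : O) :
    cosetMat F hπ n x * cosetMat F hπ 1 y = cosetMat F hπ (n + 1) (x + π ^ n * y) := by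
  ext i j
  fin_cases i <;> fin_cases j <;>
    simp [coe_cosetMat, Matrix.mul_apply, Fin.sum_univ_two, pow_succ, add_comm]

theorem sum_tensor_apply (hT : HasTeichmuller O) {n : ℕ} (W : (Fin n → ResidueField O) → SymSpace k r)
    (ν : Fin n → ResidueField O) :
    (∑ μ, tensor (F := F) p hπ ι r w (cosetMat F hπ n (digitSum π μ)) (W μ)).1
      (cosetMat F hπ n (digitSum π ν))⁻¹ = W ν := by
  have e : (∑ μ, tensor (F := F) p hπ ι r w (cosetMat F hπ n (digitSum π μ)) (W μ)).1
      (cosetMat F hπ n (digitSum π ν))⁻¹ = ∑ μ, (tensor (F := F) p hπ ι r w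
        (cosetMat F hπ n (digitSum π μ)) (W μ)).1 (cosetMat F hπ n (digitSum π ν))⁻¹ := by
    rw [← Finset.sum_apply]
    simp
  rw [e, Finset.sum_eq_single ν]
  · have h1 : (cosetMat F hπ n (digitSum π ν))⁻¹ * cosetMat F hπ n (digitSum π ν) ∈ subgroupKZ O F := by
      rw [inv_mul_cancel]; exact one_mem _
    rw [tensor, tens_apply_of_mem _ _ _ _ _ h1, sigma_apply (n := 0) (a := 1) (by simp), map_one,
      Module.End.one_apply]
  · intro μ _ hμ
    exact tens_apply_of_notMem _ _ _ _ _ fun h =>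
      hμ (eq_of_pow_dvd_digitSum_sub hπ hT (dvd_of_inv_cosetMat_mul_mem hπ h))
  · simp

theorem inBall_sum_tensor {n : ℕ} (W : (Fin n → ResidueField O) → SymSpace k r) :
    InBall (∑ μ, tensor (F := F) p hπ ι r w (cosetMat F hπ n (digitSum π μ)) (W μ)) (n + 1) :=
  InBall.sum _ fun _ _ => inBall_tensor (near_cosetMat hπ _ _) _

theorem mk_sum_tensor {n : ℕ} (W : (Fin n → ResidueField O) → SymSpace k r) :
    (Submodule.Quotient.mk
      (∑ μ, tensor (F := F) p hπ ι r w (cosetMat F hπ n (digitSum π μ)) (W μ)) :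
        IndModT F p hπ ι r w) =
      ∑ μ, cls p hπ ι r w (cosetMat F hπ n (digitSum π μ)) (W μ) :=
  map_sum (LinearMap.range (heckeT F p hπ ι r w)).mkQ _ _

theorem digitSum_zero (hT : HasTeichmuller O) (n : ℕ) :
    digitSum π (0 : Fin n → ResidueField O) = 0 := by
  simp [digitSum, teichmuller_zero hT]

/-- If the sum over a sphere of the classes of a constant vector vanishes, then the vector is a
multiple of the highest weight vector. -/
theorem exists_eq_smul_of_sum_cls_eq_zero (hq : Fintype.card (ResidueField O) = p ^ f)
    (hT : HasTeichmuller O) (hr : ∀ j, r j + 1 < p) {n : ℕ} {v : SymSpace k r}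
    (h : ∑ μ : Fin n → ResidueField O, cls (F := F) p hπ ι r w (cosetMat F hπ n (digitSum π μ)) v = 0) :
    ∃ c : k, v = c • highestVec r := by
  rw [← mk_sum_tensor (fun _ => v), Submodule.Quotient.mk_eq_zero] at h
  have h1 := sum_tensor_apply (F := F) (p := p) (hπ := hπ) (ι := ι) (w := w) hT
    (fun _ : Fin n → ResidueField O => v) 0
  rcases n with _ | n
  · rw [eq_zero_of_mem_range hq hr (inBall_sum_tensor _) h] at h1
    exact ⟨0, by rw [zero_smul, ← h1]; rfl⟩
  · obtain ⟨u, hu⟩ := exists_of_mem_range hq hr (inBall_sum_tensor _) h 0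
    rw [digitSum_zero hT] at h1
    have h2 := hu 0
    rw [mul_zero, add_zero, h1] at h2
    exact ⟨_, h2⟩

variable (F p hπ ι r w) in
/-- The combination `∑_t P(t) g_{n+1, x + π^n [t]} ⊗ ⨂_j x_j^{r_j}` over the outer neighbours of the
vertex `g_{n,x}`. -/
def fib (n : ℕ) (x : O) : (ResidueField O → k) →ₗ[k] IndModT F p hπ ι r w :=
  ∑ t : ResidueField O, (LinearMap.proj t : (ResidueField O → k) →ₗ[k] k).smulRight
    (cls p hπ ι r w (cosetMat F hπ (n + 1) (x + π ^ n * teichmuller t)) (highestVec r))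

theorem fib_apply (n : ℕ) (x : O) (P : ResidueField O → k) :
    fib F p hπ ι r w n x P = ∑ t : ResidueField O, P t •
      cls p hπ ι r w (cosetMat F hπ (n + 1) (x + π ^ n * teichmuller t)) (highestVec r) := by
  simp [fib]

theorem sum_fib (n : ℕ) (P : ResidueField O → k) :
    ∑ μ : Fin n → ResidueField O, fib F p hπ ι r w n (digitSum π μ) P =
      ∑ μ : Fin (n + 1) → ResidueField O,
        cls p hπ ι r w (cosetMat F hπ (n + 1) (digitSum π μ)) (P (μ (Fin.last n)) • highestVec r) := by
  rw [sum_snoc]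
  refine Finset.sum_congr rfl fun μ _ => ?_
  rw [fib_apply]
  refine Finset.sum_congr rfl fun t _ => ?_
  rw [digitSum_snoc, Fin.snoc_last, map_smul]

/-- If the sum of `fib` over a sphere vanishes, then `P` is a polynomial with exponents at most `r`. -/
theorem exists_expansion_of_sum_fib_eq_zero (hq : Fintype.card (ResidueField O) = p ^ f)
    (hT : HasTeichmuller O) (hr : ∀ j, r j + 1 < p) {n : ℕ} {P : ResidueField O → k}
    (h : ∑ μ : Fin n → ResidueField O, fib F p hπ ι r w n (digitSum π μ) P = 0) :
    ∃ u : Exps r → k, ∀ t, P t = ∑ b : Exps r, ι t ^ digVal p b.val • u b := by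
  rw [sum_fib, ← mk_sum_tensor (fun μ => P (μ (Fin.last n)) • highestVec r),
    Submodule.Quotient.mk_eq_zero] at h
  obtain ⟨u, hu⟩ := exists_of_mem_range hq hr (inBall_sum_tensor _) h 0
  refine ⟨u, fun t => ?_⟩
  have h1 := sum_tensor_apply (F := F) (p := p) (hπ := hπ) (ι := ι) (w := w) hT
    (fun μ : Fin (n + 1) → ResidueField O => P (μ (Fin.last n)) • highestVec (k := k) r)
    (Fin.snoc 0 t)
  rw [digitSum_snoc, digitSum_zero hT, hu, hT.residue, Fin.snoc_last] at h1
  have h2 := congrArg topCoef h1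
  rw [map_smul, map_smul, topCoef_highestVec, smul_eq_mul, mul_one, smul_eq_mul, mul_one] at h2
  exact h2.symm

theorem sigmaK_uniMat_highestVec (x : O) :
    sigmaK p ι r w (uniMat x) (highestVec r) = highestVec r := by
  rw [sigmaK, weightRep_upper_highestVec _ _ _ _ _ (by simp [uniMat, coe_mkGL])]
  simp [uniMat, coe_mkGL]

theorem cls_cosetMat_congr {n : ℕ} {x y : O} (h : π ^ n ∣ x - y) :
    cls (F := F) p hπ ι r w (cosetMat F hπ n x) (highestVec r) =
      cls p hπ ι r w (cosetMat F hπ n y) (highestVec r) := by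
  obtain ⟨z, hz⟩ := h
  rw [← sub_add_cancel x y, hz, add_comm, ← cosetMat_mul_uniMat, cls_mul_embK,
    sigmaK_uniMat_highestVec]

theorem fib_congr {n : ℕ} {x y : O} (h : π ^ (n + 1) ∣ x - y) :
    fib F p hπ ι r w n x = fib F p hπ ι r w n y := by
  refine LinearMap.ext fun P => ?_
  rw [fib_apply, fib_apply]
  refine Finset.sum_congr rfl fun t _ => ?_
  rw [cls_cosetMat_congr]
  rwa [add_sub_add_right_eq_sub]

/-- The classes in `fib` depend on the outer neighbour only, not on the chosen representative. -/
theorem cls_cosetMat_teichmuller (hT : HasTeichmuller O) (n : ℕ) (x y : O) :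
    cls (F := F) p hπ ι r w (cosetMat F hπ (n + 1) (x + π ^ n * y)) (highestVec r) =
      cls p hπ ι r w (cosetMat F hπ (n + 1) (x + π ^ n * teichmuller (residue O y))) (highestVec r) := by
  refine cls_cosetMat_congr ?_
  rw [add_sub_add_left_eq_sub, ← mul_sub, pow_succ]
  refine mul_dvd_mul_left _ ?_
  rw [dvd_sub_iff_residue hπ, hT.residue]

theorem fib_add_mul (hT : HasTeichmuller O) (n : ℕ) (x y : O) (P : ResidueField O → k) :
    fib F p hπ ι r w n (x + π ^ n * y) P = fib F p hπ ι r w n x fun t => P (t - residue O y) := by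
  rw [fib_apply, fib_apply]
  refine Fintype.sum_equiv (Equiv.addRight (residue O y)) _ _ fun t => ?_
  rw [Equiv.coe_addRight, add_sub_cancel_right, add_assoc, ← mul_add, cls_cosetMat_teichmuller hT,
    map_add, hT.residue, add_comm (residue O y)]

/-- The relation in the quotient given by `T (g_{n,x} ⊗ v)`. -/
theorem fib_relation (hT : HasTeichmuller O) (n : ℕ) (x : O) (v : SymSpace k r) :
    fib F p hπ ι r w n x (fun t => topCoef (sigmaK p ι r w (uniMat (-teichmuller t)) v)) +
      cls p hπ ι r w (cosetMat F hπ n x * (embK O F swapMat * cosetMat F hπ 1 0))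
        (topCoef (sigmaK p ι r w swapMat v) • highestVec r) = 0 := by
  have h1 : (Submodule.Quotient.mk (heckeT F p hπ ι r w (tensor p hπ ι r w (cosetMat F hπ n x) v)) :
      IndModT F p hπ ι r w) = 0 :=
    (Submodule.Quotient.mk_eq_zero _).mpr ⟨_, rfl⟩
  rw [heckeT_tensor teichmuller hT.residue, Submodule.Quotient.mk_add, mk_tensor] at h1
  rw [← h1]
  congr 1
  rw [fib_apply]
  refine Eq.trans ?_ (map_sum (LinearMap.range (heckeT F p hπ ι r w)).mkQ _ _).symm
  refine Finset.sum_congr rfl fun t _ => ?_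
  rw [← map_smul, cosetMat_mul_cosetMat]
  rfl

/-- The powers `t^i` with `i ≤ r`, `i ≠ r` are killed. -/
theorem fib_pow_eq_zero (hT : HasTeichmuller O) (n : ℕ) (x : O) {i : Fin f → ℕ} (hi : i ≤ r)
    (hne : i ≠ r) : fib F p hπ ι r w n x (fun t => ι t ^ digVal p i) = 0 := by
  have hrev : (Exps.mk i hi).rev.rev = Exps.mk i hi := Exps.rev_rev _
  have h := fib_relation (F := F) (p := p) (hπ := hπ) (ι := ι) (w := w) hT n x
    (monVec k (Exps.mk i hi).rev)
  have hs : topCoef (sigmaK p ι r w swapMat (monVec k (Exps.mk i hi).rev)) = 0 := by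
    rw [sigmaK, weightRep_swapMat, hrev, map_smul, topCoef_monVec, if_neg, smul_zero]
    intro e
    exact hne (congrArg Exps.val e)
  have hP : (fun t : ResidueField O => topCoef (sigmaK p ι r w (uniMat (-teichmuller t))
      (monVec k (Exps.mk i hi).rev))) = (-1 : k) ^ digVal p i • fun t => ι t ^ digVal p i := by
    funext t
    rw [sigmaK, topCoef_uniMat_monVec, hrev, Exps.val_mk, RingHom.comp_apply, map_neg, map_neg,
      hT.residue, neg_pow]
    rfl
  rw [hs, zero_smul, map_zero, add_zero, hP, map_smul] at h
  exact (smul_eq_zero.mp h).resolve_left (pow_ne_zero _ (neg_ne_zero.mpr one_ne_zero))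

theorem cls_scalar_mul (n : ℤ) (g : GL (Fin 2) F) (v : SymSpace k r) :
    cls p hπ ι r w (scalarUnif F hπ ^ n * g) v = cls p hπ ι r w g v := by
  rw [← mk_tensor, tensor_scalar_mul, mk_tensor]

/-- The power `t^r` leads back to the previous sphere. -/
theorem fib_succ_pow (hT : HasTeichmuller O) (n : ℕ) (x : O) :
    fib F p hπ ι r w (n + 1) x (fun t => ι t ^ digVal p r) =
      (-(-1) ^ digVal p r : k) • cls p hπ ι r w (cosetMat F hπ n x) (monVec k (Exps.top r).rev) := by
  have h := fib_relation (F := F) (p := p) (hπ := hπ) (ι := ι) (w := w) hT (n + 1) x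
    (monVec k (Exps.top r).rev)
  have hs : topCoef (sigmaK p ι r w swapMat (monVec k (Exps.top r).rev)) = (-1) ^ w := by
    rw [sigmaK, weightRep_swapMat, Exps.rev_rev, map_smul, topCoef_monVec, if_pos rfl, smul_eq_mul,
      mul_one]
  have hP : (fun t : ResidueField O => topCoef (sigmaK p ι r w (uniMat (-teichmuller t))
      (monVec k (Exps.top r).rev))) = (-1 : k) ^ digVal p r • fun t => ι t ^ digVal p r := by
    funext t
    rw [sigmaK, topCoef_uniMat_monVec, Exps.rev_rev, Exps.top, Exps.val_mk, RingHom.comp_apply,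
      map_neg, map_neg, hT.residue, neg_pow]
    rfl
  have hsq : ∀ m : ℕ, ((-1 : k) ^ m) * (-1) ^ m = 1 := fun m => by
    rw [← pow_add, Even.neg_one_pow ⟨m, rfl⟩]
  rw [hs, hP, cosetMat_succ_mul_swapMat, cls_scalar_mul, cls_mul_embK, map_smul, map_smul,
    ← monVec_top, sigmaK, weightRep_swapMat, smul_smul, hsq, one_smul, add_eq_zero_iff_eq_neg] at h
  have h2 := congrArg (fun z => (-1 : k) ^ digVal p r • z) h
  simp only [smul_smul, hsq, one_smul] at h2
  rw [h2, smul_neg, neg_smul]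

end Hecke

/-! ### Sums over residue rings with a Möbius action -/

section Mobius
variable {O : Type*} [CommRing O] [IsDomain O] [IsDiscreteValuationRing O]
  [Fintype (ResidueField O)] {k V : Type*} [Field k] {p f : ℕ} [Fact p.Prime] [CharP k p]
  [AddCommGroup V] [Module k V] {π : O} {ι : ResidueField O →+* k} {A : Fin f → ℕ}
  {ρ : Representation k (GL (Fin 2) O) V}

theorem add_pow_digVal (A : Fin f → ℕ) (x y : k) :
    (x + y) ^ digVal p A = ∑ b : Exps A, x ^ digVal p b.val *
      (y ^ digVal p (A - b.val) * (multiChoose A b.val : k)) := by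
  rw [← prod_pow_pow]
  simp only [add_pow_char_pow]
  simp only [add_pow_fin, Fintype.prod_sum]
  refine Finset.sum_congr rfl fun b _ => ?_
  rw [← prod_pow_pow, ← prod_pow_pow, multiChoose, Nat.cast_prod, ← Finset.prod_mul_distrib,
    ← Finset.prod_mul_distrib]
  exact Finset.prod_congr rfl fun j _ => mul_assoc _ _ _

open Classical in
/-- The involution that inverts units and fixes the other elements. -/
def invOrSelf (x : O) : O := if h : IsUnit x then ((h.unit⁻¹ : Oˣ) : O) else x

theorem invOrSelf_unit (x : Oˣ) : invOrSelf (x : O) = ((x⁻¹ : Oˣ) : O) := by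
  rw [invOrSelf, dif_pos x.isUnit]
  congr 2
  exact Units.ext rfl

theorem invOrSelf_of_not_isUnit {x : O} (h : ¬ IsUnit x) : invOrSelf x = x := dif_neg h

theorem isUnit_congr (hπ : Irreducible π) {x y : O} (h : π ∣ x - y) : IsUnit x ↔ IsUnit y := by
  rw [← residue_ne_zero_iff_isUnit, ← residue_ne_zero_iff_isUnit, (dvd_sub_iff_residue hπ).mp h]

theorem isUnit_invOrSelf (x : O) : IsUnit (invOrSelf x) ↔ IsUnit x := by
  by_cases h : IsUnit x
  · obtain ⟨u, rfl⟩ := h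
    rw [invOrSelf_unit]
    exact ⟨fun _ => u.isUnit, fun _ => u⁻¹.isUnit⟩
  · rw [invOrSelf_of_not_isUnit h]

theorem dvd_sub_of_invOrSelf (hπ : Irreducible π) {N : ℕ} {x y : O}
    (h : π ^ (N + 1) ∣ invOrSelf x - invOrSelf y) : π ^ (N + 1) ∣ x - y := by
  have h1 : IsUnit x ↔ IsUnit y := by
    rw [← isUnit_invOrSelf x, ← isUnit_invOrSelf y]
    exact isUnit_congr hπ ((dvd_pow_self π N.succ_ne_zero).trans h)
  by_cases hx : IsUnit x
  · obtain ⟨u, rfl⟩ := hx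
    obtain ⟨v, rfl⟩ := h1.mp u.isUnit
    rw [invOrSelf_unit, invOrSelf_unit] at h
    have e : (u : O) - v = -(u * v) * (((u⁻¹ : Oˣ) : O) - ((v⁻¹ : Oˣ) : O)) := by
      have hu : (u : O) * ((u⁻¹ : Oˣ) : O) = 1 := u.mul_inv
      have hv : (v : O) * ((v⁻¹ : Oˣ) : O) = 1 := v.mul_inv
      linear_combination (v : O) * hu - (u : O) * hv
    rw [e]
    exact Dvd.dvd.mul_left h _
  · rwa [invOrSelf_of_not_isUnit hx, invOrSelf_of_not_isUnit (fun h => hx (h1.mpr h))] at h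

/-- Let `Y` be a function modulo `π^(N+1)` on which the representatives `n(λ) s` of the big cell act
by Möbius transformations with weight `-A` on units, and unipotent lower triangular matrices by
Möbius transformations on non-units. Then the translates of `v = ∑_x Y(x)` by the big cell depend
polynomially on `λ`: up to a constant, they are `∑_x (λ - x)^A Y(x)`. -/
theorem exists_expansion_of_mobius (hπ : Irreducible π) (hT : HasTeichmuller O) {N : ℕ}
    (hA : digVal p A ≠ 0) (Y : O → V) (hY : ∀ x y, π ^ (N + 1) ∣ x - y → Y x = Y y)
    (hbig : ∀ (t : ResidueField O) (x : Oˣ), ρ (bigMat (teichmuller t)) (Y x) =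
      ι (residue O ((x⁻¹ : Oˣ) : O)) ^ digVal p A • Y (teichmuller t - ((x⁻¹ : Oˣ) : O)))
    (hlow : ∀ (t : ResidueField O) (x y : O), residue O x = 0 → y * (1 - teichmuller t * x) = x →
      ρ (lowMat (-teichmuller t)) (Y x) = Y y) :
    ∃ u : Exps A → V, ∀ t : ResidueField O, ρ (bigMat (teichmuller t))
      (∑ μ : Fin (N + 1) → ResidueField O, Y (digitSum π μ)) =
        ∑ b : Exps A, ι t ^ digVal p b.val • u b := by
  classical
  obtain ⟨W, hW⟩ : ∃ W : V, W = ∑ μ : Fin (N + 1) → ResidueField O,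
      if IsUnit (digitSum π μ) then 0 else ρ (bigMat 0) (Y (digitSum π μ)) := ⟨_, rfl⟩
  have hπN : π ∣ π ^ (N + 1) := dvd_pow_self π N.succ_ne_zero
  -- The units contribute the polynomial, the non-units a constant.
  have key : ∀ t : ResidueField O, ρ (bigMat (teichmuller t))
      (∑ μ : Fin (N + 1) → ResidueField O, Y (digitSum π μ)) =
        ∑ μ : Fin (N + 1) → ResidueField O,
          (ι t + -ι (residue O (digitSum π μ))) ^ digVal p A • Y (digitSum π μ) + W := by
    intro t
    have hunit : ∑ μ : Fin (N + 1) → ResidueField O, (if IsUnit (digitSum π μ) then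
        ρ (bigMat (teichmuller t)) (Y (digitSum π μ)) else 0) =
          ∑ μ : Fin (N + 1) → ResidueField O,
            (ι t + -ι (residue O (digitSum π μ))) ^ digVal p A • Y (digitSum π μ) := by
      rw [← sum_digitSum_comp hπ hT (fun x => (ι t + -ι (residue O x)) ^ digVal p A • Y x) _
        (fun x => teichmuller t - invOrSelf x)]
      · refine Finset.sum_congr rfl fun μ _ => ?_
        split_ifs with h
        · obtain ⟨x, hx⟩ := h
          rw [← hx, hbig, invOrSelf_unit, map_sub, hT.residue, map_sub, neg_sub, add_sub_cancel]
        · have h1 : residue O (digitSum π μ) = 0 := by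
            by_contra h1
            exact h ((residue_ne_zero_iff_isUnit _).mp h1)
          rw [invOrSelf_of_not_isUnit h, map_sub, hT.residue, h1, sub_zero, add_neg_cancel,
            zero_pow hA, zero_smul]
      · intro x y h
        rw [sub_sub_sub_cancel_left] at h
        rw [← dvd_neg, neg_sub]
        exact dvd_sub_of_invOrSelf hπ h
      · intro x y h
        rw [hY x y h, (dvd_sub_iff_residue hπ).mp (hπN.trans h)]
    have hnon : ∑ μ : Fin (N + 1) → ResidueField O, (if IsUnit (digitSum π μ) then 0 else
        ρ (bigMat (teichmuller t)) (Y (digitSum π μ))) = W := by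
      have hex : ∀ x : O, ∃ y : O, if IsUnit x then y = x else y * (1 - teichmuller t * x) = x := by
        intro x
        split_ifs with h
        · exact ⟨x, rfl⟩
        · have h1 : residue O x = 0 := by
            by_contra h1
            exact h ((residue_ne_zero_iff_isUnit _).mp h1)
          obtain ⟨e, he⟩ : IsUnit (1 - teichmuller t * x) := by
            rw [← residue_ne_zero_iff_isUnit, map_sub, map_mul, h1, mul_zero, sub_zero, map_one]
            exact one_ne_zero
          exact ⟨x * ((e⁻¹ : Oˣ) : O), by rw [← he, mul_assoc, Units.inv_mul, mul_one]⟩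
      choose L hL using hex
      have hLu : ∀ x, IsUnit x → L x = x := fun x hx => by have := hL x; rwa [if_pos hx] at this
      have hLn : ∀ x, ¬ IsUnit x → L x * (1 - teichmuller t * x) = x := fun x hx => by
        have := hL x; rwa [if_neg hx] at this
      have hLiff : ∀ x, IsUnit (L x) ↔ IsUnit x := by
        intro x
        by_cases hx : IsUnit x
        · rw [hLu x hx]
        · have h1 := hLn x hx
          refine iff_of_false (fun h => hx ?_) hx
          obtain ⟨e, he⟩ : IsUnit (1 - teichmuller t * x) := by
            have h0 : residue O x = 0 := by
              by_contra h1
              exact hx ((residue_ne_zero_iff_isUnit _).mp h1)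
            rw [← residue_ne_zero_iff_isUnit, map_sub, map_mul, h0, mul_zero, sub_zero, map_one]
            exact one_ne_zero
          rw [← h1, ← he]
          exact h.mul e.isUnit
      rw [hW, ← sum_digitSum_comp hπ hT (fun x => if IsUnit x then 0 else ρ (bigMat 0) (Y x)) _ L]
      · refine Finset.sum_congr rfl fun μ _ => ?_
        by_cases h : IsUnit (digitSum π μ)
        · rw [if_pos h, if_pos ((hLiff _).mpr h)]
        · have h1 : residue O (digitSum π μ) = 0 := by
            by_contra h1
            exact h ((residue_ne_zero_iff_isUnit _).mp h1)
          rw [if_neg h, if_neg (fun h' => h ((hLiff _).mp h')), ← hlow t _ _ h1 (hLn _ h),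
            ← Module.End.mul_apply, ← map_mul, ← zero_sub, bigMat_mul_lowMat]
      · intro x y h
        have h1 : IsUnit x ↔ IsUnit y := by
          rw [← hLiff x, ← hLiff y]
          exact isUnit_congr hπ (hπN.trans h)
        by_cases hx : IsUnit x
        · rwa [hLu x hx, hLu y (h1.mp hx)] at h
        · have e1 := hLn x hx
          have e2 := hLn y (fun h => hx (h1.mpr h))
          have e3 : IsUnit (1 + teichmuller t * L x) := by
            have h0 : residue O (L x) = 0 := by
              by_contra h1
              exact hx ((hLiff x).mp ((residue_ne_zero_iff_isUnit _).mp h1))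
            rw [← residue_ne_zero_iff_isUnit, map_add, map_mul, h0, mul_zero, add_zero, map_one]
            exact one_ne_zero
          rw [← e3.dvd_mul_right]
          have e4 : (x - y) * (1 + teichmuller t * L x) = (L x - L y) * (1 - teichmuller t * y) := by
            linear_combination -e1 + e2
          rw [e4]
          exact Dvd.dvd.mul_right h _
      · intro x y h
        rw [hY x y h]
        exact if_congr (isUnit_congr hπ (hπN.trans h)) rfl rfl
    rw [← hunit, ← hnon, ← Finset.sum_add_distrib, map_sum]
    refine Finset.sum_congr rfl fun μ _ => ?_
    split_ifs <;> simp
  refine ⟨fun b => ∑ μ : Fin (N + 1) → ResidueField O,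
    ((-ι (residue O (digitSum π μ))) ^ digVal p (A - b.val) * (multiChoose A b.val : k)) •
      Y (digitSum π μ) + if b.val = 0 then W else 0, fun t => ?_⟩
  have hconst : W = ∑ b : Exps A, ι t ^ digVal p b.val • (if b.val = 0 then W else 0) := by
    rw [Finset.sum_eq_single (Exps.mk 0 (fun _ => Nat.zero_le _))]
    · rw [Exps.val_mk, if_pos rfl]
      simp [digVal]
    · intro b _ hb
      have hb' : b.val ≠ 0 := fun h => hb (Exps.val_injective h)
      rw [if_neg hb', smul_zero]
    · simp
  rw [key t]
  conv_lhs => rw [hconst]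
  simp only [smul_add, Finset.sum_add_distrib, Finset.smul_sum, smul_smul]
  congr 1
  rw [Finset.sum_comm]
  refine Finset.sum_congr rfl fun μ _ => ?_
  rw [add_pow_digVal, Finset.sum_smul]

/-- Invariance under the substitutions `[s] ↦ [s] + π (α [s] + β [s]^2 + γ)` implies invariance under
`[s] ↦ [δ s + τ] + π (α [s] + β [s]^2 + γ)`. -/
theorem sum_comp_of_quadratic (hπ : Irreducible π) (hT : HasTeichmuller O) {n : ℕ} {Z : O → V}
    (hZ : ∀ x y, π ^ (n + 2) ∣ x - y → Z x = Z y)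
    (hquad : ∀ x α β γ : O, ∑ s : ResidueField O, Z (x + π ^ n * (teichmuller s +
      π * (α * teichmuller s + β * teichmuller s ^ 2 + γ))) =
        ∑ s : ResidueField O, Z (x + π ^ n * teichmuller s))
    (x : O) (φ : ResidueField O → O) {δ : ResidueField O} (hδ : δ ≠ 0) (τ : ResidueField O)
    (α β γ : O) (hφ : ∀ s, π ^ 2 ∣ φ s - (teichmuller (δ * s + τ) +
      π * (α * teichmuller s + β * teichmuller s ^ 2 + γ))) :
    ∑ s : ResidueField O, Z (x + π ^ n * φ s) =
      ∑ s : ResidueField O, Z (x + π ^ n * teichmuller s) := by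
  obtain ⟨d, hd⟩ : ∃ d : O, d = teichmuller δ⁻¹ := ⟨_, rfl⟩
  obtain ⟨e, he⟩ : ∃ e : O, e = teichmuller (δ⁻¹ * τ) := ⟨_, rfl⟩
  rw [← hquad x (α * d - 2 * β * d * e) (β * d ^ 2) (γ - α * e + β * e ^ 2)]
  refine Fintype.sum_equiv ((Equiv.mulLeft₀ δ hδ).trans (Equiv.addRight τ)) _ _ fun s => hZ _ _ ?_
  change _ ∣ _ - (x + π ^ n * (teichmuller (δ * s + τ) + π * ((α * d - 2 * β * d * e) *
    teichmuller (δ * s + τ) + β * d ^ 2 * teichmuller (δ * s + τ) ^ 2 + (γ - α * e + β * e ^ 2))))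
  rw [add_sub_add_left_eq_sub, ← mul_sub, pow_add]
  refine mul_dvd_mul_left _ ?_
  obtain ⟨c, hc⟩ : π ∣ d * teichmuller (δ * s + τ) - e - teichmuller s := by
    rw [dvd_sub_iff_residue hπ, map_sub, map_mul, hd, he, hT.residue, hT.residue, hT.residue,
      hT.residue, mul_add, inv_mul_cancel_left₀ hδ, add_sub_cancel_right]
  obtain ⟨c', hc'⟩ := hφ s
  generalize teichmuller (δ * s + τ) = y at *
  generalize teichmuller s = z at *
  refine ⟨c' - (α * c + β * c * (d * y - e + z)), ?_⟩
  linear_combination hc' - (π * α + π * β * (d * y - e + z)) * hc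

/-- The difference of two values of a Möbius transformation of determinant `1`. -/
theorem mobius_add (g : GL (Fin 2) O) (x y ε : O) (D E : Oˣ)
    (hg : (g : Matrix (Fin 2) (Fin 2) O).det = 1) (hD : (D : O) = g 1 0 * x + g 1 1)
    (hE : (E : O) = g 1 0 * (x + ε) + g 1 1) (hy : y * D = g 0 0 * x + g 0 1) :
    (y + ε * ((D⁻¹ : Oˣ) : O) * ((E⁻¹ : Oˣ) : O)) * E = g 0 0 * (x + ε) + g 0 1 := by
  rw [Matrix.det_fin_two] at hg
  have hDD : ((D⁻¹ : Oˣ) : O) * D = 1 := Units.inv_mul D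
  have hEE : ((E⁻¹ : Oˣ) : O) * E = 1 := Units.inv_mul E
  obtain ⟨c, hc⟩ : ∃ c : O, c = ((D⁻¹ : Oˣ) : O) := ⟨_, rfl⟩
  rw [← hc] at hDD ⊢
  have e1 : (E : O) = D + g 1 0 * ε := by rw [hE, hD]; ring
  have e2 : y = c * (g 0 0 * x + g 0 1) := by rw [← hy]; linear_combination (-y) * hDD
  have e3 : c * (g 1 0 * x + g 1 1) = 1 := by rw [← hD, hDD]
  have e4 : y * (E : O) = g 0 0 * x + g 0 1 + c * (g 0 0 * x + g 0 1) * g 1 0 * ε := by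
    rw [e1, mul_add, hy, e2]; ring
  rw [add_mul, e4]
  linear_combination (ε * c) * hEE - (ε * c) * hg + (ε * g 0 0) * e3

/-- Let `Z` be a function modulo `π^(n+2)` on which matrices of determinant `1` act by Möbius
transformations with weight `-A`. If the partial sums `∑_s Z(x + π^n [s])` are invariant under
quadratic perturbations and `π^2` divides `p`, then these partial sums are a function modulo `π^n`
with the same property, and `exists_expansion_of_mobius` applies to them. -/
theorem exists_expansion_of_quadratic (hπ : Irreducible π)
    (hq : Fintype.card (ResidueField O) = p ^ f) (hT : HasTeichmuller O)
    (hp : π ^ 2 ∣ (p : O)) {n : ℕ} (hA : digVal p A ≠ 0) (Z : O → V)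
    (hZ : ∀ x y, π ^ (n + 2) ∣ x - y → Z x = Z y)
    (hmob : ∀ (g : GL (Fin 2) O) (x y : O) (D : Oˣ), (g : Matrix (Fin 2) (Fin 2) O).det = 1 →
      (D : O) = g 1 0 * x + g 1 1 → y * D = g 0 0 * x + g 0 1 →
      ρ g (Z x) = ι (residue O ((D⁻¹ : Oˣ) : O)) ^ digVal p A • Z y)
    (hquad : ∀ x α β γ : O, ∑ s : ResidueField O, Z (x + π ^ n * (teichmuller s +
      π * (α * teichmuller s + β * teichmuller s ^ 2 + γ))) =
        ∑ s : ResidueField O, Z (x + π ^ n * teichmuller s)) :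
    ∃ u : Exps A → V, ∀ t : ResidueField O, ρ (bigMat (teichmuller t))
      (∑ μ : Fin (n + 1) → ResidueField O, Z (digitSum π μ)) =
        ∑ b : Exps A, ι t ^ digVal p b.val • u b := by
  have hdetb : ∀ x : O, ((bigMat x : GL (Fin 2) O) : Matrix (Fin 2) (Fin 2) O).det = 1 := fun x => by
    simp [bigMat, coe_mkGL]
  have hdetl : ∀ x : O, ((lowMat x : GL (Fin 2) O) : Matrix (Fin 2) (Fin 2) O).det = 1 := fun x => by
    simp [lowMat, coe_mkGL]
  have hone : ∀ t x : O, residue O x = 0 → ∃ D : Oˣ, (D : O) = 1 - t * x := by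
    intro t x hx
    rw [← IsUnit, ← residue_ne_zero_iff_isUnit, map_sub, map_mul, hx, mul_zero, sub_zero, map_one]
    exact one_ne_zero
  rcases n with _ | n
  · have hsum : ∑ μ : Fin (0 + 1) → ResidueField O, Z (digitSum π μ) =
        ∑ μ : Fin (0 + 1) → ResidueField O, Z (teichmuller (residue O (digitSum π μ))) := by
      refine Finset.sum_congr rfl fun μ _ => ?_
      have : digitSum π μ = teichmuller (μ 0) := by simp [digitSum]
      rw [this, hT.residue]
    rw [hsum]
    refine exists_expansion_of_mobius hπ hT hA (fun x => Z (teichmuller (residue O x))) ?_ ?_ ?_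
    · intro x y h
      rw [pow_one, dvd_sub_iff_residue hπ] at h
      rw [h]
    · intro t x
      have hx : residue O (teichmuller (residue O (x : O))) ≠ 0 := by
        rw [hT.residue]
        exact (residue_ne_zero_iff_isUnit _).mpr x.isUnit
      obtain ⟨D, hD⟩ := (residue_ne_zero_iff_isUnit _).mp hx
      have hres : residue O ((x⁻¹ : Oˣ) : O) = (residue O (x : O))⁻¹ := by
        refine eq_inv_of_mul_eq_one_left ?_
        rw [← map_mul, Units.inv_mul, map_one]
      have hDi : ((D⁻¹ : Oˣ) : O) = teichmuller (residue O ((x⁻¹ : Oˣ) : O)) := by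
        rw [Units.inv_eq_of_mul_eq_one_right]
        rw [hD, hres, ← teichmuller_mul hT, mul_inv_cancel₀ (by rwa [hT.residue] at hx),
          teichmuller_one hT]
      change ρ _ (Z (teichmuller (residue O (x : O)))) = _ • Z _
      rw [← hD, hmob _ _ (teichmuller t - ((D⁻¹ : Oˣ) : O)) D (hdetb _) (by simp [bigMat, coe_mkGL])
        (by simp [bigMat, coe_mkGL, sub_mul]; ring), hDi, hT.residue]
      congr 1
      apply hZ
      have h1 := sq_dvd_add_sub_teichmuller hπ hq hT hp (t - residue O ((x⁻¹ : Oˣ) : O))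
        (residue O ((x⁻¹ : Oˣ) : O))
      rw [sub_add_cancel] at h1
      rw [map_sub, hT.residue, zero_add, ← dvd_neg]
      convert h1 using 1
      ring
    · intro t x y hx hy
      have hy0 : residue O y = 0 := by
        have := congrArg (residue O) hy
        rwa [map_mul, map_sub, map_mul, hx, mul_zero, sub_zero, map_one, mul_one] at this
      change ρ _ (Z (teichmuller (residue O x))) = Z (teichmuller (residue O y))
      rw [hx, hy0, teichmuller_zero hT, hmob _ 0 0 1 (hdetl _) (by simp [lowMat, coe_mkGL])
        (by simp [lowMat, coe_mkGL])]
      simp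
  · obtain ⟨Y, hYdef⟩ : ∃ Y : O → V,
        ∀ x, Y x = ∑ s : ResidueField O, Z (x + π ^ (n + 1) * teichmuller s) := ⟨_, fun _ => rfl⟩
    have hsum : ∑ μ : Fin (n + 1 + 1) → ResidueField O, Z (digitSum π μ) =
        ∑ μ : Fin (n + 1) → ResidueField O, Y (digitSum π μ) := by
      rw [sum_snoc]
      refine Finset.sum_congr rfl fun μ _ => ?_
      rw [hYdef]
      refine Finset.sum_congr rfl fun t _ => ?_
      rw [digitSum_snoc]
    have hres1 : ∀ x z : O, residue O (x + π ^ (n + 1) * z) = residue O x := by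
      intro x z
      rw [← dvd_sub_iff_residue hπ, add_sub_cancel_left, pow_succ']
      exact ⟨π ^ n * z, by ring⟩
    have hYmob : ∀ (g : GL (Fin 2) O) (x y : O) (D : Oˣ),
        (g : Matrix (Fin 2) (Fin 2) O).det = 1 →
        (D : O) = g 1 0 * x + g 1 1 → y * D = g 0 0 * x + g 0 1 →
        ρ g (Y x) = ι (residue O ((D⁻¹ : Oˣ) : O)) ^ digVal p A • Y y := by
      intro g x y D hg hD hy
      have hunit : ∀ s : ResidueField O, ∃ E : Oˣ,
          (E : O) = g 1 0 * (x + π ^ (n + 1) * teichmuller s) + g 1 1 := by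
        intro s
        rw [← IsUnit, ← residue_ne_zero_iff_isUnit, map_add, map_mul, hres1, ← map_mul, ← map_add,
          ← hD]
        exact (residue_ne_zero_iff_isUnit _).mpr D.isUnit
      choose E hE using hunit
      have hresE : ∀ s, residue O (((E s)⁻¹ : Oˣ) : O) = residue O ((D⁻¹ : Oˣ) : O) := by
        intro s
        have h1 : residue O ((E s : Oˣ) : O) = residue O (D : O) := by
          rw [hE, map_add, map_mul, hres1, ← map_mul, ← map_add, ← hD]
        have h2 : ∀ e : Oˣ, residue O ((e⁻¹ : Oˣ) : O) = (residue O (e : O))⁻¹ := by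
          intro e
          refine eq_inv_of_mul_eq_one_left ?_
          rw [← map_mul, Units.inv_mul, map_one]
        rw [h2, h2, h1]
      obtain ⟨c, hc⟩ : ∃ c : O, c = ((D⁻¹ : Oˣ) : O) := ⟨_, rfl⟩
      have hcD : c * D = 1 := by rw [hc, Units.inv_mul]
      have hstep : ∀ s, ρ g (Z (x + π ^ (n + 1) * teichmuller s)) =
          ι (residue O ((D⁻¹ : Oˣ) : O)) ^ digVal p A •
            Z (y + π ^ (n + 1) * (teichmuller s * c * (((E s)⁻¹ : Oˣ) : O))) := by
        intro s
        rw [← hresE s]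
        rw [hc]
        exact hmob g _ _ (E s) hg (hE s) (by
          rw [← mul_assoc, ← mul_assoc]
          exact mobius_add g x y _ D (E s) hg hD (hE s) hy)
      rw [hYdef, map_sum, Finset.sum_congr rfl fun s _ => hstep s, ← Finset.smul_sum, hYdef]
      congr 1
      -- Modulo `π^2`, the factor `1 / (D E)` is a linear polynomial in `[s]`.
      obtain ⟨δ, hδ⟩ : ∃ δ : ResidueField O, δ = residue O (c ^ 2) := ⟨_, rfl⟩
      obtain ⟨η, hη⟩ : π ∣ c ^ 2 - teichmuller δ := by
        rw [dvd_sub_iff_residue hπ, hT.residue, hδ]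
      refine sum_comp_of_quadratic hπ hT hZ hquad y
        (fun s => teichmuller s * c * (((E s)⁻¹ : Oˣ) : O)) (δ := δ) ?_ 0 η
        (-(g 1 0 * π ^ n * c ^ 3)) 0 fun s => ?_
      · rw [hδ, hc]
        exact (residue_ne_zero_iff_isUnit _).mpr ((D⁻¹).isUnit.pow 2)
      · rw [add_zero, teichmuller_mul hT]
        obtain ⟨z, hz⟩ : ∃ z : O, z = teichmuller s := ⟨_, rfl⟩
        obtain ⟨e, he⟩ : ∃ e : O, e = (((E s)⁻¹ : Oˣ) : O) := ⟨_, rfl⟩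
        have heE : e * (D + g 1 0 * (π ^ (n + 1) * z)) = 1 := by
          rw [he, hz, ← Units.inv_mul (E s), hE, hD]; ring
        have e5 : e = c - g 1 0 * π ^ (n + 1) * z * c * e := by
          linear_combination (-e) * hcD + c * heE
        rw [← hz, ← he]
        refine ⟨g 1 0 ^ 2 * π ^ (2 * n) * z ^ 3 * c ^ 3 * e, ?_⟩
        have e6 : e = c - g 1 0 * π ^ (n + 1) * z * c * (c - g 1 0 * π ^ (n + 1) * z * c * e) := by
          rw [← e5]; exact e5
        linear_combination (z * c) * e6 + z * hη
    rw [hsum]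
    refine exists_expansion_of_mobius hπ hT hA Y ?_ ?_ ?_
    · rintro x y ⟨c, hc⟩
      rw [sub_eq_iff_eq_add'] at hc
      obtain ⟨γ, hγ⟩ : π ∣ c - teichmuller (residue O c) := by
        rw [dvd_sub_iff_residue hπ, hT.residue]
      rw [hYdef, hYdef, ← sum_comp_of_quadratic hπ hT hZ hquad y (fun s => c + teichmuller s)
        one_ne_zero (residue O c) 0 0 γ]
      · refine Finset.sum_congr rfl fun s _ => ?_
        rw [hc]
        congr 1
        ring
      · intro s
        have := sq_dvd_add_sub_teichmuller hπ hq hT hp s (residue O c)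
        rw [one_mul]
        convert this using 1
        linear_combination hγ
    · intro t x
      rw [hYmob _ _ (teichmuller t - ((x⁻¹ : Oˣ) : O)) x (hdetb _) (by simp [bigMat, coe_mkGL])
        (by simp [bigMat, coe_mkGL, sub_mul]; ring)]
    · intro t x y hx hy
      obtain ⟨D, hD⟩ := hone (teichmuller t) x hx
      rw [hYmob _ _ y D (hdetl _) (by rw [hD]; simp [lowMat, coe_mkGL]; ring)
        (by rw [hD, hy]; simp [lowMat, coe_mkGL])]
      have h1 : residue O ((D⁻¹ : Oˣ) : O) = 1 := by
        have h2 : residue O (D : O) = 1 := by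
          rw [hD, map_sub, map_mul, hx, mul_zero, sub_zero, map_one]
        have h3 : residue O ((D⁻¹ : Oˣ) : O) * residue O (D : O) = 1 := by
          rw [← map_mul, Units.inv_mul, map_one]
        rwa [h2, mul_one] at h3
      rw [h1, map_one, one_pow, one_smul]

end Mobius

/-! ### The action of `K` on the spheres -/

section Action
variable {O F : Type*} [CommRing O] [IsDomain O] [IsDiscreteValuationRing O] [Field F]
  [Algebra O F] [IsFractionRing O F]
  {k : Type*} [Field k] {p : ℕ} [Fact p.Prime] [CharP k p] {f : ℕ}
  {π : O} {hπ : Irreducible π} {ι : ResidueField O →+* k} {r : Fin f → ℕ} {w : ℕ}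
  [Fintype (ResidueField O)]

/-- The group `K` permutes the vertices `g_{n,x}` with `c x + d` a unit by Möbius transformations. -/
theorem embK_mul_cosetMat (hπ : Irreducible π) (a : GL (Fin 2) O) (n : ℕ) (x y : O) (D : Oˣ)
    (hD : (D : O) = a 1 0 * x + a 1 1) (hy : y * D = a 0 0 * x + a 0 1) :
    ∃ h : GL (Fin 2) O, embK O F a * cosetMat F hπ n x = cosetMat F hπ n y * embK O F h ∧
      (h : Matrix (Fin 2) (Fin 2) O) =
        !![(a : Matrix (Fin 2) (Fin 2) O).det * ((D⁻¹ : Oˣ) : O), 0; a 1 0 * π ^ n, D] := by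
  have hu : IsUnit !![(a : Matrix (Fin 2) (Fin 2) O).det * ((D⁻¹ : Oˣ) : O), 0;
      a 1 0 * π ^ n, (D : O)].det := by
    rw [Matrix.det_fin_two_of, zero_mul, sub_zero, mul_assoc, Units.inv_mul, mul_one]
    exact (Matrix.GeneralLinearGroup.det a).isUnit
  refine ⟨Matrix.GeneralLinearGroup.mk'' _ hu, ?_, rfl⟩
  have hDD : ((D⁻¹ : Oˣ) : O) * D = 1 := Units.inv_mul D
  have e1 : y * (a 1 0 * π ^ n) + π ^ n * ((a : Matrix (Fin 2) (Fin 2) O).det * ((D⁻¹ : Oˣ) : O)) =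
      a 0 0 * π ^ n := by
    apply D.isUnit.mul_left_injective
    change _ * (D : O) = _ * (D : O)
    rw [Matrix.det_fin_two]
    linear_combination (a 1 0 * π ^ n) * hy + (π ^ n * (a 0 0 * a 1 1 - a 0 1 * a 1 0)) * hDD -
      (a 0 0 * π ^ n) * hD
  ext i j
  fin_cases i <;> fin_cases j <;>
    simp only [Units.val_mul, coe_embK, coe_cosetMat, coe_mkGL, Matrix.mul_apply, Fin.sum_univ_two,
      Matrix.map_apply, Fin.zero_eta, Fin.mk_one, Matrix.of_apply, Matrix.cons_val', Matrix.cons_val_zero,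
      Matrix.cons_val_one, Matrix.cons_val_fin_one, mul_zero, zero_mul, add_zero, zero_add, mul_one,
      one_mul, map_zero, ← map_pow, ← map_mul, ← map_add]
  · rw [← e1]; congr 1; ring
  · rw [hy]
  · rw [hD]

theorem kRep_cls_cosetMat (a : GL (Fin 2) O) (n : ℕ) (x y : O) (D : Oˣ)
    (hD : (D : O) = a 1 0 * x + a 1 1) (hy : y * D = a 0 0 * x + a 0 1)
    (h0 : residue O (a 1 0 * π ^ n) = 0) (i : Fin f → ℕ) (hi) :
    kRep F p hπ ι r w a (cls p hπ ι r w (cosetMat F hπ n x) (symVec k r i hi)) =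
      (ι (residue O (a : Matrix (Fin 2) (Fin 2) O).det) ^ w *
        (ι (residue O ((a : Matrix (Fin 2) (Fin 2) O).det * ((D⁻¹ : Oˣ) : O))) ^ digVal p (r - i) *
          ι (residue O (D : O)) ^ digVal p i)) •
        cls p hπ ι r w (cosetMat F hπ n y) (symVec k r i hi) := by
  obtain ⟨h, e, hh⟩ := embK_mul_cosetMat (F := F) hπ a n x y D hD hy
  have hdet : (h : Matrix (Fin 2) (Fin 2) O).det = (a : Matrix (Fin 2) (Fin 2) O).det := by
    rw [hh, Matrix.det_fin_two_of, zero_mul, sub_zero, mul_assoc, Units.inv_mul, mul_one]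
  rw [kRep_cls, e, cls_mul_embK, sigmaK, weightRep_diag p _ r w h _ _ i hi, map_smul, hdet]
  · simp [hh]
  · rw [hh]
    simp only [Matrix.of_apply, Matrix.cons_val', Matrix.cons_val_zero, Matrix.cons_val_one,
      Matrix.cons_val_fin_one, RingHom.comp_apply, h0, map_zero]
  · simp [hh]

theorem embK_uniMat_mul_cosetMat (n : ℕ) (x y : O) :
    embK O F (uniMat y) * cosetMat F hπ n x = cosetMat F hπ n (x + y) := by
  ext i j
  fin_cases i <;> fin_cases j <;>
    simp [coe_cosetMat, coe_embK, uniMat, coe_mkGL, Matrix.mul_apply, Fin.sum_univ_two]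

theorem digVal_zero (p f : ℕ) : digVal p (0 : Fin f → ℕ) = 0 := by simp [digVal]

theorem kRep_uniMat_cls (n : ℕ) (x y : O) (v : SymSpace k r) :
    kRep F p hπ ι r w (uniMat y) (cls p hπ ι r w (cosetMat F hπ n x) v) =
      cls p hπ ι r w (cosetMat F hπ n (x + y)) v := by
  rw [kRep_cls, embK_uniMat_mul_cosetMat]

theorem kRep_uniMat_fib (n : ℕ) (x y : O) (P : ResidueField O → k) :
    kRep F p hπ ι r w (uniMat y) (fib F p hπ ι r w n x P) = fib F p hπ ι r w n (x + y) P := by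
  rw [fib_apply, fib_apply, map_sum]
  refine Finset.sum_congr rfl fun t _ => ?_
  rw [map_smul, kRep_uniMat_cls, add_right_comm]

theorem residue_inv (D : Oˣ) : residue O ((D⁻¹ : Oˣ) : O) = (residue O (D : O))⁻¹ := by
  refine eq_inv_of_mul_eq_one_left ?_
  rw [← map_mul, Units.inv_mul, map_one]

theorem residue_unit_ne_zero (D : Oˣ) : residue O (D : O) ≠ 0 :=
  (residue_ne_zero_iff_isUnit _).mpr D.isUnit

/-- Matrices of determinant `1` act on the sums `fib` over the neighbours of `g_{n+1,x}` by Möbius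
transformations, since the derivative of the transformation is a square modulo `π`. -/
theorem kRep_fib_mobius (hT : HasTeichmuller O) {m e : ℕ}
    (hm : ∀ x : ResidueField O, x ≠ 0 → ι x ^ (e + 2 * m) = ι x ^ digVal p r) (n : ℕ)
    (g : GL (Fin 2) O) (x y : O) (D : Oˣ) (hg : (g : Matrix (Fin 2) (Fin 2) O).det = 1)
    (hD : (D : O) = g 1 0 * x + g 1 1) (hy : y * D = g 0 0 * x + g 0 1) :
    kRep F p hπ ι r w g (fib F p hπ ι r w (n + 1) x (fun t => ι t ^ m)) =
      ι (residue O ((D⁻¹ : Oˣ) : O)) ^ e • fib F p hπ ι r w (n + 1) y (fun t => ι t ^ m) := by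
  have hpi : residue O π = 0 := (dvd_iff_residue hπ).mp dvd_rfl
  have hres1 : ∀ x z : O, residue O (x + π ^ (n + 1) * z) = residue O x := by
    intro x z
    rw [map_add, map_mul, map_pow, hpi, zero_pow n.succ_ne_zero, zero_mul, add_zero]
  have hunit : ∀ s : ResidueField O, ∃ E : Oˣ,
      (E : O) = g 1 0 * (x + π ^ (n + 1) * teichmuller s) + g 1 1 := by
    intro s
    rw [← IsUnit, ← residue_ne_zero_iff_isUnit, map_add, map_mul, hres1, ← map_mul, ← map_add, ← hD]
    exact residue_unit_ne_zero D
  choose E hE using hunit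
  have hresE : ∀ s, residue O ((E s : Oˣ) : O) = residue O (D : O) := by
    intro s
    rw [hE, map_add, map_mul, hres1, ← map_mul, ← map_add, ← hD]
  obtain ⟨c, hc⟩ : ∃ c : O, c = ((D⁻¹ : Oˣ) : O) := ⟨_, rfl⟩
  have hc0 : residue O c ≠ 0 := by rw [hc]; exact residue_unit_ne_zero _
  have hstep : ∀ s, kRep F p hπ ι r w g (cls p hπ ι r w
      (cosetMat F hπ (n + 1 + 1) (x + π ^ (n + 1) * teichmuller s)) (highestVec r)) =
        ι (residue O c) ^ digVal p r • cls p hπ ι r w (cosetMat F hπ (n + 1 + 1)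
          (y + π ^ (n + 1) * teichmuller (residue O c ^ 2 * s))) (highestVec r) := by
    intro s
    have h1 := kRep_cls_cosetMat (F := F) (p := p) (hπ := hπ) (ι := ι) (r := r) (w := w) g (n + 1 + 1)
      (x + π ^ (n + 1) * teichmuller s) _ (E s) (hE s) (mobius_add g x y _ D (E s) hg hD (hE s) hy)
      (by rw [map_mul, map_pow, hpi, zero_pow (Nat.succ_ne_zero _), mul_zero]) 0
      (fun _ => Nat.zero_le _)
    refine h1.trans ?_
    rw [hg, one_mul, map_one, map_one, one_pow, one_mul, residue_inv, hresE, ← residue_inv, ← hc,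
      tsub_zero, digVal_zero, pow_zero, mul_one]
    congr 1
    change cls p hπ ι r w _ (highestVec r) = _
    have e : residue O (teichmuller s * c * (((E s)⁻¹ : Oˣ) : O)) = residue O c ^ 2 * s := by
      rw [map_mul, map_mul, hT.residue, residue_inv, hresE, ← residue_inv, ← hc]
      ring
    rw [mul_assoc (π ^ (n + 1)), mul_assoc (π ^ (n + 1)), cls_cosetMat_teichmuller hT, e]
  rw [← hc]
  generalize residue O c = c₀ at hstep hc0 ⊢
  have hterm : ∀ s, kRep F p hπ ι r w g (ι s ^ m • cls p hπ ι r w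
      (cosetMat F hπ (n + 1 + 1) (x + π ^ (n + 1) * teichmuller s)) (highestVec r)) =
        ι c₀ ^ e • ι (c₀ ^ 2 * s) ^ m • cls p hπ ι r w (cosetMat F hπ (n + 1 + 1)
          (y + π ^ (n + 1) * teichmuller (c₀ ^ 2 * s))) (highestVec r) := by
    intro s
    rw [map_smul, hstep, smul_smul, smul_smul, map_mul, map_pow, mul_pow, ← hm _ hc0, pow_add,
      pow_mul]
    congr 1
    ring
  rw [fib_apply, map_sum, Finset.sum_congr rfl fun s _ => hterm s, ← Finset.smul_sum, fib_apply]
  congr 1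
  exact Equiv.sum_comp (Equiv.mulLeft₀ (c₀ ^ 2) (pow_ne_zero 2 hc0)) fun s => ι s ^ m •
    cls p hπ ι r w (cosetMat F hπ (n + 1 + 1) (y + π ^ (n + 1) * teichmuller s)) (highestVec r)

theorem teichmuller_mul_digitSum (hT : HasTeichmuller O) {n : ℕ} (τ : ResidueField O)
    (μ : Fin n → ResidueField O) :
    teichmuller τ * digitSum π μ = digitSum π (fun i => τ * μ i) := by
  rw [digitSum, digitSum, Finset.mul_sum]
  refine Finset.sum_congr rfl fun i _ => ?_
  rw [teichmuller_mul hT]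
  ring

/-- The torus acts by a character on an `I(1)`-invariant vector that is a sum over a sphere. -/
theorem kRep_diaMat_sum (hT : HasTeichmuller O) {n m : ℕ} {i : Fin f → ℕ} (hi) {a' d' : ℕ}
    (ha' : ∀ x : ResidueField O, x ≠ 0 → ι x ^ (a' + m) = ι x ^ (w + digVal p (r - i)))
    (hd' : d' = w + digVal p i + m) {v : IndModT F p hπ ι r w}
    (hv : v = ∑ μ : Fin (n + 1) → ResidueField O, cls p hπ ι r w (cosetMat F hπ (n + 1) (digitSum π μ))
      (ι (μ (Fin.last n)) ^ m • symVec k r i hi))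
    (hinv : IsI1Invariant F p hπ ι r w v) (a d : Oˣ) :
    kRep F p hπ ι r w (diaMat a d) v =
      (ι (residue O (a : O)) ^ a' * ι (residue O (d : O)) ^ d') • v := by
  have hlift : ∀ b : Oˣ, ∃ b' : Oˣ, (b' : O) = teichmuller (residue O (b : O)) := fun b => by
    rw [← IsUnit, ← residue_ne_zero_iff_isUnit, hT.residue]
    exact residue_unit_ne_zero b
  obtain ⟨a₀, ha₀⟩ := hlift a
  obtain ⟨d₀, hd₀⟩ := hlift d
  have hra : residue O (a₀ : O) = residue O (a : O) := by rw [ha₀, hT.residue]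
  have hrd : residue O (d₀ : O) = residue O (d : O) := by rw [hd₀, hT.residue]
  have e1 : diaMat a d = diaMat a₀ d₀ * diaMat (a₀⁻¹ * a) (d₀⁻¹ * d) := by
    ext i j
    fin_cases i <;> fin_cases j <;>
      simp [diaMat, coe_mkGL, Matrix.mul_apply, Fin.sum_univ_two]
  have hinv' : kRep F p hπ ι r w (diaMat (a₀⁻¹ * a) (d₀⁻¹ * d)) v = v := by
    refine hinv _ ?_ ?_ ?_
    · simp only [diaMat, coe_mkGL, Matrix.of_apply, Matrix.cons_val', Matrix.cons_val_zero,
        Matrix.cons_val_fin_one, Units.val_mul, map_mul, residue_inv, hra]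
      exact inv_mul_cancel₀ (residue_unit_ne_zero a)
    · simp [diaMat, coe_mkGL]
    · simp only [diaMat, coe_mkGL, Matrix.of_apply, Matrix.cons_val', Matrix.cons_val_one,
        Matrix.cons_val_fin_one, Units.val_mul, map_mul, residue_inv, hrd]
      exact inv_mul_cancel₀ (residue_unit_ne_zero d)
  rw [e1, map_mul, Module.End.mul_apply, hinv']
  obtain ⟨α, hα⟩ : ∃ α, α = residue O (a : O) := ⟨_, rfl⟩
  obtain ⟨δ, hδ⟩ : ∃ δ, δ = residue O (d : O) := ⟨_, rfl⟩
  have hα0 : α ≠ 0 := hα ▸ residue_unit_ne_zero a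
  have hδ0 : δ ≠ 0 := hδ ▸ residue_unit_ne_zero d
  have hτ : α * δ⁻¹ ≠ 0 := mul_ne_zero hα0 (inv_ne_zero hδ0)
  rw [← hα, ← hδ]
  rw [← hα] at ha₀ hra
  rw [← hδ] at hd₀ hrd
  rw [hv, map_sum, Finset.smul_sum]
  refine Fintype.sum_equiv (Equiv.piCongrRight fun _ => Equiv.mulLeft₀ _ hτ) _ _ fun μ => ?_
  have h1 := kRep_cls_cosetMat (F := F) (p := p) (hπ := hπ) (ι := ι) (r := r) (w := w) (diaMat a₀ d₀)
    (n + 1) (digitSum π μ) (digitSum π fun i => α * δ⁻¹ * μ i) d₀ (by simp [diaMat, coe_mkGL]) (by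
      rw [← teichmuller_mul_digitSum hT, hd₀, mul_right_comm, ← teichmuller_mul hT,
        inv_mul_cancel_right₀ hδ0, ← ha₀]
      simp [diaMat, coe_mkGL]) (by simp [diaMat, coe_mkGL]) i hi
  rw [map_smul, map_smul, h1]
  change _ = (ι α ^ a' * ι δ ^ d') • cls p hπ ι r w (cosetMat F hπ (n + 1)
    (digitSum π fun i => α * δ⁻¹ * μ i)) (ι (α * δ⁻¹ * μ (Fin.last n)) ^ m • symVec k r i hi)
  rw [map_smul, smul_smul, smul_smul]
  congr 1
  have hdet : ((diaMat a₀ d₀ : GL (Fin 2) O) : Matrix (Fin 2) (Fin 2) O).det = a₀ * d₀ := by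
    simp [diaMat, coe_mkGL]
  have hιδ : ι δ ≠ 0 := by rwa [Ne, map_eq_zero]
  have h2 : ι δ ^ d' * (ι δ⁻¹) ^ m = ι δ ^ w * ι δ ^ digVal p i := by
    rw [hd', pow_add, pow_add, map_inv₀, inv_pow, mul_inv_cancel_right₀ (pow_ne_zero _ hιδ)]
  have h3 : ι α ^ a' * ι α ^ m = ι α ^ w * ι α ^ digVal p (r - i) := by
    rw [← pow_add, ha' α hα0, pow_add]
  rw [hdet, mul_assoc (a₀ : O), Units.mul_inv, mul_one, map_mul, hra, hrd, map_mul, map_mul, map_mul]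
  linear_combination (-(ι (μ (Fin.last n)) ^ m * ι δ ^ w * ι δ ^ digVal p i)) * h3 -
    (ι (μ (Fin.last n)) ^ m * ι α ^ a' * ι α ^ m) * h2

/-- The recognition of a weight, for the `KZ`-submodule generated by an element of `ind σ`. -/
theorem genKZ_of_expansion (hq : Fintype.card (ResidueField O) = p ^ f) (hT : HasTeichmuller O)
    {A : Fin f → ℕ} (hA : ∀ j, A j + 1 < p) (w' : ℕ) (φ : indSigma F p hπ ι r w)
    (hne : (Submodule.Quotient.mk φ : IndModT F p hπ ι r w) ≠ 0)
    (hinv : IsI1Invariant F p hπ ι r w (Submodule.Quotient.mk φ))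
    (htor : ∀ a d : Oˣ, kRep F p hπ ι r w (diaMat a d) (Submodule.Quotient.mk φ) =
      (ι (residue O (a : O)) ^ (digVal p A + w') * ι (residue O (d : O)) ^ w') •
        (Submodule.Quotient.mk φ : IndModT F p hπ ι r w))
    (hexp : ∃ u : Exps A → IndModT F p hπ ι r w, ∀ t : ResidueField O,
      kRep F p hπ ι r w (bigMat (teichmuller t)) (Submodule.Quotient.mk φ) =
        ∑ b : Exps A, ι t ^ digVal p b.val • u b) :
    (genKZ F p hπ ι r w φ).toRepresentation.IsIrreducible ∧
      Module.finrank k (genKZ F p hπ ι r w φ).toSubmodule = ∏ j, (A j + 1) := by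
  obtain ⟨u, hu⟩ := hexp
  obtain ⟨θ, hθ, hθv, hequiv⟩ := exists_embedding_of_expansion p ι hq hA w' (kRep F p hπ ι r w)
    (Submodule.Quotient.mk φ) hne hinv htor teichmuller hT.residue u hu
  exact (genKZ_of_embedding hq hA w' φ θ hθ hθv hequiv).2

end Action

/-! ### Power sums that detect large digits -/

section PowerSums
variable {κ k : Type*} [Field κ] [Fintype κ] [Field k] (ι : κ →+* k) {p f : ℕ} [Fact p.Prime]

theorem mul_pow_le_card_sub_one (hq : Fintype.card κ = p ^ f) (j : Fin f) {i : ℕ} (hi : i < p) :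
    i * p ^ (j : ℕ) ≤ Fintype.card κ - 1 := by
  have h := digVal_lt_pow p (Pi.single j i) fun l => by
    rcases eq_or_ne l j with rfl | hl
    · rwa [Pi.single_eq_same]
    · rw [Pi.single_eq_of_ne hl]; exact (Fact.out : p.Prime).pos
  rw [digVal_single] at h
  omega

theorem sum_pow_mul_pow_digit (hq : Fintype.card κ = p ^ f) (j : Fin f) {i₀ i : ℕ} (h0 : 0 < i₀)
    (h1 : i₀ < p) (hi : i < p) :
    ∑ t : κ, ι t ^ (Fintype.card κ - 1 - i₀ * p ^ (j : ℕ)) * ι t ^ (i * p ^ (j : ℕ)) =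
      if i = i₀ then -1 else 0 := by
  have hp0 : 0 < p ^ (j : ℕ) := pow_pos (Fact.out : p.Prime).pos _
  have hle := mul_pow_le_card_sub_one hq j h1
  have hle' := mul_pow_le_card_sub_one hq j hi
  have hpos : 0 < i₀ * p ^ (j : ℕ) := Nat.mul_pos h0 hp0
  simp only [← pow_add]
  split_ifs with h
  · rw [h, Nat.sub_add_cancel hle, sum_map_pow_card_sub_one]
  · refine sum_map_pow_eq_zero ι (by omega) fun e => h ?_
    have : i * p ^ (j : ℕ) = i₀ * p ^ (j : ℕ) := by omega
    exact Nat.eq_of_mul_eq_mul_right hp0 this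

/-- Polynomials with exponents at most `r` have no terms whose `j`-th digit exceeds `r_j`. -/
theorem sum_pow_mul_expansion_eq_zero (hq : Fintype.card κ = p ^ f) {r : Fin f → ℕ}
    (hr : ∀ j, r j + 1 < p) (u : Exps r → k) (j : Fin f) {i₀ : ℕ} (h0 : r j < i₀) (h1 : i₀ < p) :
    ∑ t : κ, ι t ^ (Fintype.card κ - 1 - i₀ * p ^ (j : ℕ)) *
      ∑ b : Exps r, ι t ^ digVal p b.val • u b = 0 := by
  have hp0 : 0 < p ^ (j : ℕ) := pow_pos (Fact.out : p.Prime).pos _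
  have hle := mul_pow_le_card_sub_one hq j h1
  have hpos : 0 < i₀ * p ^ (j : ℕ) := Nat.mul_pos (Nat.zero_lt_of_lt h0) hp0
  simp only [Finset.mul_sum, smul_eq_mul, ← mul_assoc, ← pow_add]
  rw [Finset.sum_comm]
  refine Finset.sum_eq_zero fun b _ => ?_
  rw [← Finset.sum_mul, sum_map_pow_eq_zero ι, zero_mul]
  · have := digVal_lt_card_sub_one hq (i := b.val) fun l =>
      (Nat.succ_le_succ (b.val_le l)).trans_lt (hr l)
    omega
  · intro e
    have e1 : digVal p b.val = digVal p (Pi.single j i₀ : Fin f → ℕ) := by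
      rw [digVal_single]; omega
    have e2 := digVal_injOn p _ _ (fun l => ((b.val_le l).trans_lt (Nat.lt_succ_self _)).trans (hr l))
      (fun l => by
        rcases eq_or_ne l j with rfl | hl
        · rwa [Pi.single_eq_same]
        · rw [Pi.single_eq_of_ne hl]; exact (Fact.out : p.Prime).pos) e1
    have e3 := congrFun e2 j
    rw [Pi.single_eq_same] at e3
    have := b.val_le j
    exact absurd h0 (not_lt.mpr (e3 ▸ this))

end PowerSums

/-! ### The carry in the addition of Teichmüller representatives -/

section Carry
variable {O : Type*} [CommRing O] [IsDomain O] [IsDiscreteValuationRing O]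
  [Fintype (ResidueField O)] {k : Type*} [Field k] {p f : ℕ} [Fact p.Prime] [CharP k p]
  {π : O} {ι : ResidueField O →+* k} {r : Fin f → ℕ}

theorem residue_carry (hπ : Irreducible π) (hq : Fintype.card (ResidueField O) = p ^ f)
    (hT : HasTeichmuller O) {u z : O} (hu : (p : O) = π * u) {a : ResidueField O}
    (hz : teichmuller (a ^ p + 1) - 1 - teichmuller (a ^ p) = π * z) :
    residue O z = residue O u * ∑ i ∈ Finset.range (p - 1),
      ((p.choose (i + 1) / p : ℕ) : ResidueField O) * a ^ (i + 1) := by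
  have h := sq_dvd_carry hπ hq hT a
  rw [hz, hu, mul_assoc, ← mul_sub, sq, mul_dvd_mul_iff_left hπ.ne_zero, dvd_sub_iff_residue hπ] at h
  rw [h, map_mul, map_sum]
  congr 1
  refine Finset.sum_congr rfl fun i _ => ?_
  rw [map_mul, map_natCast, map_pow, hT.residue]

/-- If `p` is not divisible by `π^2`, then a Frobenius twist of the carry `z_s` in
`[s + 1] = [s] + 1 + π z_s` has a term with a digit `p - 1`. -/
theorem sq_dvd_of_carry_expansion (hπ : Irreducible π) (hq : Fintype.card (ResidueField O) = p ^ f)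
    (hT : HasTeichmuller O) (hr : ∀ j, r j + 1 < p) (j : Fin f) (z : ResidueField O → O)
    (hz : ∀ s, teichmuller (s + 1) - 1 - teichmuller s = π * z s) (v : Exps r → k)
    (hv : ∀ s, ι (residue O (z s)) ^ p ^ (j : ℕ) = ∑ b : Exps r, ι s ^ digVal p b.val • v b) :
    π ^ 2 ∣ (p : O) := by
  have hpp : 1 < p := (Fact.out : p.Prime).one_lt
  obtain ⟨u, hu⟩ : π ∣ (p : O) := by
    rw [dvd_iff_residue hπ, map_natCast, residue_natCast_prime hq]
  suffices h : residue O u = 0 by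
    rw [hu, sq]
    exact mul_dvd_mul_left _ ((dvd_iff_residue hπ).mpr h)
  -- The exponent of `s` obtained from the exponent `p^j` of `a`, where `s = a^p`.
  obtain ⟨j', hj'⟩ : ∃ j' : Fin f, ∀ a : ResidueField O, a ^ p ^ (j : ℕ) = (a ^ p) ^ p ^ (j' : ℕ) := by
    obtain ⟨j, hj⟩ := j
    rcases j with _ | j
    · refine ⟨⟨f - 1, by omega⟩, fun a => ?_⟩
      change a ^ p ^ 0 = (a ^ p) ^ p ^ (f - 1)
      rw [← pow_mul, ← pow_succ', Nat.sub_add_cancel hj, ← hq, FiniteField.pow_card, pow_zero, pow_one]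
    · refine ⟨⟨j, by omega⟩, fun a => ?_⟩
      change a ^ p ^ (j + 1) = (a ^ p) ^ p ^ j
      rw [← pow_mul, ← pow_succ']
  have key : ∀ s : ResidueField O, ∑ b : Exps r, ι s ^ digVal p b.val • v b =
      ι (residue O u) ^ p ^ (j : ℕ) * ∑ i ∈ Finset.range (p - 1),
        ι ((p.choose (i + 1) / p : ℕ) : ResidueField O) ^ p ^ (j : ℕ) *
          ι s ^ ((i + 1) * p ^ (j' : ℕ)) := by
    intro s
    obtain ⟨a, rfl⟩ := exists_pow_eq hq s
    rw [← hv, residue_carry hπ hq hT hu (hz _), map_mul, mul_pow, map_sum, sum_pow_char_pow]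
    congr 1
    refine Finset.sum_congr rfl fun i _ => ?_
    rw [map_mul, mul_pow]
    congr 1
    rw [← map_pow, ← map_pow, ← pow_mul, mul_comm (i + 1), pow_mul, hj', ← pow_mul, mul_comm (i + 1)]
  have h0 := sum_pow_mul_expansion_eq_zero ι hq hr v j' (i₀ := p - 1) (by have := hr j'; omega) (by omega)
  have h1 : ∑ t : ResidueField O, ι t ^ (Fintype.card (ResidueField O) - 1 - (p - 1) * p ^ (j' : ℕ)) *
      ∑ b : Exps r, ι t ^ digVal p b.val • v b = -ι (residue O u) ^ p ^ (j : ℕ) := by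
    simp only [key, Finset.mul_sum]
    rw [Finset.sum_comm, Finset.sum_eq_single (p - 2)]
    · have h2 : ∀ t : ResidueField O,
          ι t ^ (Fintype.card (ResidueField O) - 1 - (p - 1) * p ^ (j' : ℕ)) *
            (ι (residue O u) ^ p ^ (j : ℕ) * (ι ((p.choose (p - 2 + 1) / p : ℕ) : ResidueField O) ^
              p ^ (j : ℕ) * ι t ^ ((p - 2 + 1) * p ^ (j' : ℕ)))) =
          ι (residue O u) ^ p ^ (j : ℕ) *
            (ι t ^ (Fintype.card (ResidueField O) - 1 - (p - 1) * p ^ (j' : ℕ)) *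
              ι t ^ ((p - 1) * p ^ (j' : ℕ))) := by
        intro t
        have e : p - 2 + 1 = p - 1 := by omega
        have e2 : p.choose (p - 1) = p := by
          rw [Nat.choose_symm_of_eq_add (show p = (p - 1) + 1 by omega), Nat.choose_one_right]
        rw [e, e2, Nat.div_self (by omega), Nat.cast_one, map_one, one_pow, one_mul]
        ring
      rw [Finset.sum_congr rfl fun t _ => h2 t, ← Finset.mul_sum,
        sum_pow_mul_pow_digit ι hq j' (by omega) (by omega) (by omega), if_pos rfl, mul_neg_one]
    · intro i hi hne
      have hi' := Finset.mem_range.mp hi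
      have h2 : ∀ t : ResidueField O,
          ι t ^ (Fintype.card (ResidueField O) - 1 - (p - 1) * p ^ (j' : ℕ)) *
            (ι (residue O u) ^ p ^ (j : ℕ) * (ι ((p.choose (i + 1) / p : ℕ) : ResidueField O) ^
              p ^ (j : ℕ) * ι t ^ ((i + 1) * p ^ (j' : ℕ)))) =
          (ι (residue O u) ^ p ^ (j : ℕ) * ι ((p.choose (i + 1) / p : ℕ) : ResidueField O) ^
              p ^ (j : ℕ)) *
            (ι t ^ (Fintype.card (ResidueField O) - 1 - (p - 1) * p ^ (j' : ℕ)) *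
              ι t ^ ((i + 1) * p ^ (j' : ℕ))) := fun t => by ring
      rw [Finset.sum_congr rfl fun t _ => h2 t, ← Finset.mul_sum,
        sum_pow_mul_pow_digit ι hq j' (by omega) (by omega) (by omega), if_neg (by omega), mul_zero]
    · intro h
      exact absurd (Finset.mem_range.mpr (by omega)) h
  rw [h0, eq_comm, neg_eq_zero] at h1
  exact (map_eq_zero ι).mp (eq_zero_of_pow_eq_zero h1)

end Carry

/-! ### The elements `t_n^j` -/

section Hecke
variable {O F : Type*} [CommRing O] [IsDomain O] [IsDiscreteValuationRing O] [Field F]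
  [Algebra O F] [IsFractionRing O F]
  {k : Type*} [Field k] {p : ℕ} [Fact p.Prime] [CharP k p] {f : ℕ}
  {π : O} {hπ : Irreducible π} {ι : ResidueField O →+* k} {r : Fin f → ℕ} {w : ℕ}
  [Fintype (ResidueField O)]

theorem sigmaK_uniMat_single (j : Fin f) (h : ∀ i, (Pi.single j 1 : Fin f → ℕ) i ≤ r i) (x : O) :
    sigmaK p ι r w (uniMat x) (symVec k r (Pi.single j 1) h) =
      symVec k r (Pi.single j 1) h + ι (residue O x) ^ p ^ (j : ℕ) • highestVec r := by
  apply symIncl_injective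
  have hj : 1 ≤ r j := by simpa using h j
  have e0 : ι (residue O x) ^ p ^ (j : ℕ) = frobEmb p (ι.comp (residue O)) j x :=
    (frobEmb_apply _ _ _ _).symm
  rw [e0]
  rw [sigmaK, symIncl_weightRep, map_add, map_smul, highestVec, symIncl_symVec, symIncl_symVec,
    substHom_symMonomial]
  have hdet : ((uniMat x : GL (Fin 2) O) : Matrix (Fin 2) (Fin 2) O).det = 1 := by
    simp [uniMat, coe_mkGL]
  rw [hdet, map_one, one_pow, one_smul, symMonomial, symMonomial,
    ← Finset.mul_prod_erase _ _ (Finset.mem_univ j), ← Finset.mul_prod_erase _ _ (Finset.mem_univ j),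
    ← Finset.mul_prod_erase _ _ (Finset.mem_univ j)]
  have e : ∀ g : Fin f → MvPolynomial (Fin f × Fin 2) k, ∀ g' : Fin f → MvPolynomial (Fin f × Fin 2) k,
      (∀ i, i ≠ j → g i = g' i) → ∏ i ∈ Finset.univ.erase j, g i = ∏ i ∈ Finset.univ.erase j, g' i :=
    fun g g' h => Finset.prod_congr rfl fun i hi => h i (Finset.ne_of_mem_erase hi)
  rw [e _ (fun i => MvPolynomial.X (i, 0) ^ r i) fun i hi => by
      simp [uniMat, coe_mkGL, Pi.single_eq_of_ne hi],
    e (fun i => MvPolynomial.X (i, 0) ^ (r i - (Pi.single j 1 : Fin f → ℕ) i) * _)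
      (fun i => MvPolynomial.X (i, 0) ^ r i) fun i hi => by simp [Pi.single_eq_of_ne hi],
    e (fun i => MvPolynomial.X (i, 0) ^ (r i - (0 : Fin f → ℕ) i) * _)
      (fun i => MvPolynomial.X (i, 0) ^ r i) fun i hi => by simp]
  obtain ⟨n, hn⟩ : ∃ n, r j = n + 1 := ⟨r j - 1, by omega⟩
  simp [uniMat, coe_mkGL, hn, MvPolynomial.smul_eq_C_mul]
  ring

theorem highestVec_ne_zero (r : Fin f → ℕ) : highestVec (k := k) r ≠ 0 := fun h => by
  have := topCoef_highestVec (k := k) r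
  rw [h, map_zero] at this
  exact zero_ne_one this

end Hecke

section Hecke
variable {O F : Type*} [CommRing O] [IsDomain O] [IsDiscreteValuationRing O] [Field F]
  [Algebra O F] [IsFractionRing O F]
  {k : Type*} [Field k] {p : ℕ} [Fact p.Prime] [CharP k p] {f : ℕ}
  {π : O} {hπ : Irreducible π} {ι : ResidueField O →+* k} {r : Fin f → ℕ} {w : ℕ}
  [Fintype (ResidueField O)]

theorem cls_cosetMat_add_single (j : Fin f) (h : ∀ i, (Pi.single j 1 : Fin f → ℕ) i ≤ r i) (n : ℕ)
    (x y : O) :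
    cls (F := F) p hπ ι r w (cosetMat F hπ n (x + π ^ n * y)) (symVec k r (Pi.single j 1) h) =
      cls p hπ ι r w (cosetMat F hπ n x) (symVec k r (Pi.single j 1) h) +
        ι (residue O y) ^ p ^ (j : ℕ) • cls p hπ ι r w (cosetMat F hπ n x) (highestVec r) := by
  rw [← cosetMat_mul_uniMat, cls_mul_embK, sigmaK_uniMat_single, map_add, map_smul]

theorem sum_cls_single_add (j : Fin f) (h : ∀ i, (Pi.single j 1 : Fin f → ℕ) i ≤ r i) (n : ℕ)
    (x : O) (z : ResidueField O → O) :
    ∑ s : ResidueField O, cls (F := F) p hπ ι r w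
        (cosetMat F hπ (n + 1) (x + π ^ n * (teichmuller s + π * z s)))
        (symVec k r (Pi.single j 1) h) =
      ∑ s : ResidueField O, cls p hπ ι r w (cosetMat F hπ (n + 1) (x + π ^ n * teichmuller s))
        (symVec k r (Pi.single j 1) h) +
      fib F p hπ ι r w n x (fun s => ι (residue O (z s)) ^ p ^ (j : ℕ)) := by
  rw [fib_apply, ← Finset.sum_add_distrib]
  refine Finset.sum_congr rfl fun s _ => ?_
  rw [← cls_cosetMat_add_single, show x + π ^ n * (teichmuller s + π * z s) =
    x + π ^ n * teichmuller s + π ^ (n + 1) * z s by ring]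

/-- Only digits at most `2` occur in a Frobenius twist of a quadratic polynomial. -/
theorem fib_quadratic_pow_eq_zero (hT : HasTeichmuller O) (hr : ∀ j, 2 < r j) (n : ℕ) (x : O)
    (j : Fin f) (a b c : ResidueField O) :
    fib F p hπ ι r w n x (fun s => ι (a * s + b * s ^ 2 + c) ^ p ^ (j : ℕ)) = 0 := by
  have hle : ∀ i : ℕ, i ≤ 2 → (Pi.single j i : Fin f → ℕ) ≤ r ∧ (Pi.single j i : Fin f → ℕ) ≠ r := by
    intro i hi
    refine ⟨fun l => ?_, fun e => ?_⟩
    · rcases eq_or_ne l j with rfl | hl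
      · rw [Pi.single_eq_same]; exact hi.trans (hr l).le
      · rw [Pi.single_eq_of_ne hl]; exact Nat.zero_le _
    · have h1 := congrFun e j
      rw [Pi.single_eq_same] at h1
      have := hr j
      omega
  have hfib : ∀ i : ℕ, i ≤ 2 → fib F p hπ ι r w n x (fun s => ι s ^ (i * p ^ (j : ℕ))) = 0 := by
    intro i hi
    have := fib_pow_eq_zero (F := F) (p := p) (hπ := hπ) (ι := ι) (w := w) hT n x (hle i hi).1 (hle i hi).2
    rwa [digVal_single] at this
  have e : (fun s => ι (a * s + b * s ^ 2 + c) ^ p ^ (j : ℕ)) =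
      ι a ^ p ^ (j : ℕ) • (fun s : ResidueField O => ι s ^ (1 * p ^ (j : ℕ))) +
        ι b ^ p ^ (j : ℕ) • (fun s : ResidueField O => ι s ^ (2 * p ^ (j : ℕ))) +
        ι c ^ p ^ (j : ℕ) • (fun s : ResidueField O => ι s ^ (0 * p ^ (j : ℕ))) := by
    funext s
    simp only [Pi.add_apply, Pi.smul_apply, smul_eq_mul, map_add, map_mul, map_pow, one_mul, zero_mul,
      pow_zero, mul_one, pow_mul, add_pow_char_pow, mul_pow]
  rw [e, map_add, map_add, map_smul, map_smul, map_smul, hfib 1 (by omega), hfib 2 (by omega),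
    hfib 0 (by omega), smul_zero, smul_zero, smul_zero, add_zero, add_zero]

theorem isI1_uniMat {v : IndModT F p hπ ι r w} (h : IsI1Invariant F p hπ ι r w v) (x : O) :
    kRep F p hπ ι r w (uniMat x) v = v :=
  h _ (by simp [uniMat, coe_mkGL]) (by simp [uniMat, coe_mkGL]) (by simp [uniMat, coe_mkGL])

/-- The carries `z_s` in `[s + 1] = [s] + 1 + π z_s`. -/
theorem exists_carry (hπ : Irreducible π) (hT : HasTeichmuller O) :
    ∃ z : ResidueField O → O, ∀ s, teichmuller (s + 1) - 1 - teichmuller s = π * z s := by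
  have h : ∀ s : ResidueField O, π ∣ teichmuller (s + 1) - 1 - teichmuller s := fun s => by
    rw [dvd_sub_iff_residue hπ, map_sub, hT.residue, map_one, hT.residue, add_sub_cancel_right]
  choose z hz using h
  exact ⟨z, hz⟩

/-- Translation by `-π^n` of a sum over a sphere, in terms of carries. -/
theorem sum_sub_pow {z : ResidueField O → O}
    (hz : ∀ s, teichmuller (s + 1) - 1 - teichmuller s = π * z s) {M : Type*} [AddCommMonoid M]
    (n : ℕ) (Z : O → M) :
    ∑ μ : Fin (n + 1) → ResidueField O, Z (digitSum π μ + -π ^ n) =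
      ∑ μ : Fin n → ResidueField O, ∑ s : ResidueField O,
        Z (digitSum π μ + π ^ n * (teichmuller s + π * z s)) := by
  rw [sum_snoc]
  refine Finset.sum_congr rfl fun μ _ => ?_
  rw [← Equiv.sum_comp (Equiv.addRight (1 : ResidueField O))]
  refine Finset.sum_congr rfl fun s _ => ?_
  rw [digitSum_snoc, Equiv.coe_addRight, ← hz]
  congr 1
  ring

theorem mk_tElt (n : ℕ) (j : Fin f) (hj : 1 ≤ r j) (h : ∀ i, (Pi.single j 1 : Fin f → ℕ) i ≤ r i) :
    (Submodule.Quotient.mk (tElt F p hπ ι r w n j hj) : IndModT F p hπ ι r w) =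
      ∑ μ : Fin n → ResidueField O, cls p hπ ι r w (cosetMat F hπ n (digitSum π μ))
        (symVec k r (Pi.single j 1) h) := by
  rw [tElt, finsum_eq_sum_of_fintype, mk_sum_tensor]

/-- If `t_{n+1}^j` is invariant under translation by `π^n`, then `p` is divisible by `π^2`: the
carries contribute exponents that are too large to be killed. -/
theorem sq_dvd_of_tElt_invariant (hq : Fintype.card (ResidueField O) = p ^ f)
    (hT : HasTeichmuller O) (hr : ∀ j, r j + 1 < p) (n : ℕ) (j : Fin f) (hj : 1 ≤ r j)
    (hinv : IsI1Invariant F p hπ ι r w (Submodule.Quotient.mk (tElt F p hπ ι r w (n + 1) j hj))) :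
    π ^ 2 ∣ (p : O) := by
  have h : ∀ i, (Pi.single j 1 : Fin f → ℕ) i ≤ r i := fun i => by
    rcases eq_or_ne i j with rfl | hl
    · rwa [Pi.single_eq_same]
    · rw [Pi.single_eq_of_ne hl]; exact Nat.zero_le _
  obtain ⟨z, hz⟩ := exists_carry hπ hT
  have h1 := isI1_uniMat hinv (-π ^ n)
  rw [mk_tElt n.succ j hj h, map_sum] at h1
  simp only [kRep_uniMat_cls] at h1
  rw [sum_sub_pow hz n (fun x => cls (F := F) p hπ ι r w (cosetMat F hπ (n + 1) x)
    (symVec k r (Pi.single j 1) h)), sum_snoc] at h1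
  simp only [sum_cls_single_add, digitSum_snoc, Finset.sum_add_distrib, add_eq_left] at h1
  obtain ⟨u, hu⟩ := exists_expansion_of_sum_fib_eq_zero hq hT hr h1
  exact sq_dvd_of_carry_expansion hπ hq hT hr j z hz u hu

theorem tElt_ne_zero (hq : Fintype.card (ResidueField O) = p ^ f)
    (hT : HasTeichmuller O) (hr : ∀ j, r j + 1 < p) (n : ℕ) (j : Fin f) (hj : 1 ≤ r j) :
    (Submodule.Quotient.mk (tElt F p hπ ι r w n j hj) : IndModT F p hπ ι r w) ≠ 0 := by
  have h : ∀ i, (Pi.single j 1 : Fin f → ℕ) i ≤ r i := fun i => by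
    rcases eq_or_ne i j with rfl | hl
    · rwa [Pi.single_eq_same]
    · rw [Pi.single_eq_of_ne hl]; exact Nat.zero_le _
  rw [mk_tElt n j hj h]
  intro h0
  obtain ⟨c, hc⟩ := exists_eq_smul_of_sum_cls_eq_zero hq hT hr h0
  -- The vector is not fixed by `n(1)`.
  have h1 := sigmaK_uniMat_single (p := p) (ι := ι) (w := w) j h 1
  rw [hc, map_smul, sigmaK_uniMat_highestVec, map_one, map_one, one_pow, one_smul, left_eq_add] at h1
  exact highestVec_ne_zero r h1

/-- The submodule generated by `t_n^j` is the weight with exponent `r_j - 2` instead of `r_j`. -/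
theorem genKZ_tElt (hq : Fintype.card (ResidueField O) = p ^ f) (hT : HasTeichmuller O)
    (hr : ∀ j, 2 < r j ∧ r j + 3 < p) (n : ℕ) (hn : 1 ≤ n) (j : Fin f) (hj : 1 ≤ r j)
    (hinv : IsI1Invariant F p hπ ι r w (Submodule.Quotient.mk (tElt F p hπ ι r w n j hj))) :
    (genKZ F p hπ ι r w (tElt F p hπ ι r w n j hj)).toRepresentation.IsIrreducible ∧
      Module.finrank k (genKZ F p hπ ι r w (tElt F p hπ ι r w n j hj)).toSubmodule =
        (∏ i with i ≠ j, (r i + 1)) * (r j - 1) := by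
  obtain ⟨n, rfl⟩ : ∃ m, n = m + 1 := ⟨n - 1, by omega⟩
  have hr1 : ∀ j, r j + 1 < p := fun j => by have := hr j; omega
  have h : ∀ i, (Pi.single j 1 : Fin f → ℕ) i ≤ r i := fun i => by
    rcases eq_or_ne i j with rfl | hl
    · rwa [Pi.single_eq_same]
    · rw [Pi.single_eq_of_ne hl]; exact Nat.zero_le _
  have hp := sq_dvd_of_tElt_invariant hq hT hr1 n j hj hinv
  have hpi : residue O π = 0 := (dvd_iff_residue hπ).mp dvd_rfl
  obtain ⟨A, hA⟩ : ∃ A : Fin f → ℕ, A = r - Pi.single j 2 := ⟨_, rfl⟩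
  have hAj : A j = r j - 2 := by rw [hA, Pi.sub_apply, Pi.single_eq_same]
  have hAi : ∀ i, i ≠ j → A i = r i := fun i hi => by
    rw [hA, Pi.sub_apply, Pi.single_eq_of_ne hi, Nat.sub_zero]
  have hA1 : ∀ i, A i + 1 < p := fun i => by
    have := hr i
    rcases eq_or_ne i j with rfl | hl
    · rw [hAj]; omega
    · rw [hAi i hl]; omega
  have hr2 : r - Pi.single j 1 = A + Pi.single j 1 := by
    funext i
    have := hr i
    rcases eq_or_ne i j with rfl | hl
    · simp only [Pi.sub_apply, Pi.add_apply, Pi.single_eq_same, hAj]; omega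
    · simp only [Pi.sub_apply, Pi.add_apply, Pi.single_eq_of_ne hl, hAi i hl]; omega
  have hdig : digVal p (r - Pi.single j 1) = digVal p A + p ^ (j : ℕ) := by
    rw [hr2, digVal_add, digVal_single, one_mul]
  have hA0 : digVal p A ≠ 0 := by
    have h1 : A j * p ^ (j : ℕ) ≤ digVal p A :=
      Finset.single_le_sum (f := fun l => A l * p ^ (l : ℕ)) (fun _ _ => Nat.zero_le _) (Finset.mem_univ j)
    have h2 : 0 < A j * p ^ (j : ℕ) := Nat.mul_pos (by have := hr j; omega)
      (pow_pos (Fact.out : p.Prime).pos _)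
    omega
  have hmk := mk_tElt (F := F) (p := p) (hπ := hπ) (ι := ι) (w := w) (n + 1) j hj h
  have hfin : ∏ i, (A i + 1) = (∏ i with i ≠ j, (r i + 1)) * (r j - 1) := by
    rw [← Finset.prod_filter_mul_prod_filter_not Finset.univ (· ≠ j)]
    congr 1
    · exact Finset.prod_congr rfl fun i hi => by rw [hAi i (Finset.mem_filter.mp hi).2]
    · have e : Finset.univ.filter (fun i => ¬ i ≠ j) = {j} := by ext i; simp
      rw [e, Finset.prod_singleton, hAj]
      have := hr j
      omega
  rw [← hfin]
  refine genKZ_of_expansion hq hT hA1 (w + p ^ (j : ℕ)) _ (tElt_ne_zero hq hT hr1 _ j hj) hinv ?_ ?_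
  · intro a d
    refine kRep_diaMat_sum hT (n := n) (m := 0) h ?_ ?_ ?_ hinv a d
    · intro x _
      rw [hdig]
      congr 1
      omega
    · rw [digVal_single, one_mul, add_zero]
    · rw [hmk]
      simp only [pow_zero, one_smul]
  · rw [hmk]
    refine exists_expansion_of_quadratic hπ hq hT hp hA0 (fun x => cls (F := F) p hπ ι r w
      (cosetMat F hπ (n + 1) x) (symVec k r (Pi.single j 1) h)) ?_ ?_ ?_
    · rintro x y ⟨c, hc⟩
      change cls p hπ ι r w _ _ = cls p hπ ι r w _ _
      rw [show x = y + π ^ (n + 1) * (π * c) by linear_combination hc, cls_cosetMat_add_single, map_mul,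
        hpi, zero_mul, map_zero, zero_pow (pow_pos (Fact.out : p.Prime).pos _).ne', zero_smul, add_zero]
    · intro g x y D hg hD hy
      have h1 := kRep_cls_cosetMat (F := F) (p := p) (hπ := hπ) (ι := ι) (r := r) (w := w) g (n + 1) x y D
        hD hy (by rw [map_mul, map_pow, hpi, zero_pow n.succ_ne_zero, mul_zero]) _ h
      refine h1.trans ?_
      rw [hg, one_mul, map_one, map_one, one_pow, one_mul, hdig, digVal_single, one_mul, pow_add,
        mul_assoc, ← mul_pow, ← map_mul, ← map_mul, Units.inv_mul, map_one, map_one, one_pow, mul_one]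
    · intro x α β γ
      have h1 := sum_cls_single_add (F := F) (p := p) (hπ := hπ) (ι := ι) (w := w) j h n x
        (fun s => α * teichmuller s + β * teichmuller s ^ 2 + γ)
      refine h1.trans ?_
      have h2 : (fun s : ResidueField O => ι (residue O (α * teichmuller s + β * teichmuller s ^ 2 + γ)) ^
          p ^ (j : ℕ)) = fun s => ι (residue O α * s + residue O β * s ^ 2 + residue O γ) ^ p ^ (j : ℕ) := by
        funext s
        simp only [map_add, map_mul, map_pow, hT.residue]
      rw [h2, fib_quadratic_pow_eq_zero hT (fun i => (hr i).1), add_zero]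

/-! ### The generator `Id ⊗ x^r` -/

/-- The weight itself embeds in the quotient by `T`. -/
theorem genKZ_elt₀ (hq : Fintype.card (ResidueField O) = p ^ f) (hr : ∀ j, r j + 1 < p) :
    Nonempty ((sigma F p hπ ι r w).Equiv
        (genKZ F p hπ ι r w (elt₀ F p hπ ι r w)).toRepresentation) ∧
      (genKZ F p hπ ι r w (elt₀ F p hπ ι r w)).toRepresentation.IsIrreducible ∧
      Module.finrank k (genKZ F p hπ ι r w (elt₀ F p hπ ι r w)).toSubmodule = ∏ j, (r j + 1) := by
  refine genKZ_of_embedding hq hr w _ (cls p hπ ι r w 1) ?_ (mk_tensor _ _).symm ?_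
  · rw [injective_iff_map_eq_zero]
    intro v hv
    rw [← mk_tensor, Submodule.Quotient.mk_eq_zero] at hv
    have h1 := eq_zero_of_mem_range hq hr (inBall_tensor (near_zero_of_mem hπ (one_mem _)) v) hv
    have h2 : (1 : GL (Fin 2) F) * 1 ∈ subgroupKZ O F := by rw [mul_one]; exact one_mem _
    have h3 : (tensor (F := F) p hπ ι r w 1 v).1 1 = v := by
      rw [tensor, tens_apply_of_mem _ _ _ _ _ h2, sigma_apply (n := 0) (a := 1) (by simp), map_one,
        Module.End.one_apply]
    rw [← h3, h1]
    rfl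
  · intro a x
    rw [kRep_cls, mul_one, ← cls_mul_embK, one_mul]

end Hecke

/-! ### The elements `s_n^m` -/

section Hecke
variable {O F : Type*} [CommRing O] [IsDomain O] [IsDiscreteValuationRing O] [Field F]
  [Algebra O F] [IsFractionRing O F]
  {k : Type*} [Field k] {p : ℕ} [Fact p.Prime] [CharP k p] {f : ℕ}
  {π : O} {hπ : Irreducible π} {ι : ResidueField O →+* k} {r : Fin f → ℕ} {w : ℕ}
  [Fintype (ResidueField O)]

theorem mk_sElt_cls (n : ℕ) (hn : 1 ≤ n + 1) (m : ℕ) :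
    (Submodule.Quotient.mk (sElt F p hπ ι r w (n + 1) hn m) : IndModT F p hπ ι r w) =
      ∑ μ : Fin (n + 1) → ResidueField O, cls p hπ ι r w (cosetMat F hπ (n + 1) (digitSum π μ))
        (ι (μ (Fin.last n)) ^ m • highestVec r) := by
  rw [sElt, finsum_eq_sum_of_fintype,
    mk_sum_tensor (fun μ : Fin (n + 1) → ResidueField O => ι (μ ⟨n + 1 - 1, _⟩) ^ m • highestVec r)]
  rfl

theorem mk_sElt (n : ℕ) (hn : 1 ≤ n + 1) (m : ℕ) :
    (Submodule.Quotient.mk (sElt F p hπ ι r w (n + 1) hn m) : IndModT F p hπ ι r w) =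
      ∑ μ : Fin n → ResidueField O, fib F p hπ ι r w n (digitSum π μ) (fun t => ι t ^ m) := by
  rw [mk_sElt_cls, sum_fib]

theorem sElt_ne_zero (hq : Fintype.card (ResidueField O) = p ^ f) (hT : HasTeichmuller O)
    (hr : ∀ j, r j + 1 < p) (n : ℕ) (hn : 1 ≤ n + 1) (j : Fin f) {M : ℕ} (hM : r j < M) (hMp : M < p) :
    (Submodule.Quotient.mk (sElt F p hπ ι r w (n + 1) hn (p ^ (j : ℕ) * M)) : IndModT F p hπ ι r w) ≠
      0 := by
  rw [mk_sElt]
  intro h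
  obtain ⟨u, hu⟩ := exists_expansion_of_sum_fib_eq_zero hq hT hr h
  have h1 := sum_pow_mul_expansion_eq_zero ι hq hr u j hM hMp
  simp only [← hu, mul_comm (p ^ (j : ℕ)) M] at h1
  rw [sum_pow_mul_pow_digit ι hq j (Nat.zero_lt_of_lt hM) hMp hMp, if_pos rfl] at h1
  exact neg_ne_zero.mpr one_ne_zero h1

theorem sub_pow_digit (ι : ResidueField O →+* k) (s : ResidueField O) (j M : ℕ)
    (c : ResidueField O) :
    ι (s - c) ^ (p ^ j * M) = ∑ i ∈ Finset.range (M + 1),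
      ((-ι c) ^ p ^ j) ^ (M - i) * (M.choose i : k) * ι s ^ (i * p ^ j) := by
  rw [sub_eq_add_neg, map_add, map_neg, pow_mul, add_pow_char_pow, add_pow]
  refine Finset.sum_congr rfl fun i _ => ?_
  rw [← pow_mul, mul_comm i]
  ring

/-- Invariance under translation by `π^n` forces the exponent to be the smallest one. -/
theorem eq_succ_of_sElt_invariant (hq : Fintype.card (ResidueField O) = p ^ f)
    (hT : HasTeichmuller O) (hr : ∀ j, r j + 1 < p) (n : ℕ) (hn : 1 ≤ n + 1) (j : Fin f) {M : ℕ}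
    (hM : r j < M) (hMp : M < p) (hinv : IsI1Invariant F p hπ ι r w
      (Submodule.Quotient.mk (sElt F p hπ ι r w (n + 1) hn (p ^ (j : ℕ) * M)))) : M = r j + 1 := by
  by_contra hne
  have h1 := isI1_uniMat hinv (π ^ n)
  rw [mk_sElt, map_sum] at h1
  have h2 : ∀ μ : Fin n → ResidueField O, kRep F p hπ ι r w (uniMat (π ^ n))
      (fib F p hπ ι r w n (digitSum π μ) (fun t => ι t ^ (p ^ (j : ℕ) * M))) =
        fib F p hπ ι r w n (digitSum π μ) (fun t => ι (t - 1) ^ (p ^ (j : ℕ) * M)) := by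
    intro μ
    have h3 := fib_add_mul (F := F) (p := p) (hπ := hπ) (ι := ι) (r := r) (w := w) hT n (digitSum π μ) 1
      (fun t => ι t ^ (p ^ (j : ℕ) * M))
    rw [mul_one, map_one] at h3
    rw [kRep_uniMat_fib, h3]
  rw [Finset.sum_congr rfl fun μ _ => h2 μ, ← sub_eq_zero, ← Finset.sum_sub_distrib] at h1
  simp only [← map_sub] at h1
  obtain ⟨u, hu⟩ := exists_expansion_of_sum_fib_eq_zero hq hT hr h1
  have h3 := sum_pow_mul_expansion_eq_zero ι hq hr u j (Nat.lt_succ_self (r j)) (hr j)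
  simp only [← hu, Pi.sub_apply, mul_sub, Finset.sum_sub_distrib] at h3
  simp only [sub_pow_digit ι, Finset.mul_sum] at h3
  rw [Finset.sum_comm] at h3
  simp only [mul_left_comm _ (_ * _) (_ ^ _), ← Finset.mul_sum] at h3
  rw [Finset.sum_congr (g := fun i => ((-ι (1 : ResidueField O)) ^ p ^ (j : ℕ)) ^ (M - i) *
      (M.choose i : k) * if i = r j + 1 then -1 else 0) rfl fun i hi => by
    rw [sum_pow_mul_pow_digit ι hq j (Nat.succ_pos _) (hr j)
      (by have := Finset.mem_range.mp hi; omega)]] at h3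
  simp only [mul_comm (p ^ (j : ℕ)) M] at h3
  rw [sum_pow_mul_pow_digit ι hq j (Nat.succ_pos _) (hr j) hMp, if_neg hne, sub_zero,
    Finset.sum_eq_single_of_mem (r j + 1) (Finset.mem_range.mpr (by omega))
      (fun i _ hi => by rw [if_neg hi, mul_zero]), if_pos rfl, mul_neg_one, neg_eq_zero,
    mul_eq_zero, map_one] at h3
  rcases h3 with h3 | h3
  · exact pow_ne_zero _ (pow_ne_zero _ (neg_ne_zero.mpr one_ne_zero)) h3
  · rw [CharP.cast_eq_zero_iff k p] at h3
    have h4 : p ∣ M.factorial := by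
      rw [← Nat.choose_mul_factorial_mul_factorial (show r j + 1 ≤ M by omega), mul_assoc]
      exact Dvd.dvd.mul_right h3 _
    exact absurd ((Fact.out : p.Prime).dvd_factorial.mp h4) (not_le.mpr hMp)

end Hecke

/-! ### The elements `s_n^m` for `f > 1` -/

section Hecke
variable {O F : Type*} [CommRing O] [IsDomain O] [IsDiscreteValuationRing O] [Field F]
  [Algebra O F] [IsFractionRing O F]
  {k : Type*} [Field k] {p : ℕ} [Fact p.Prime] [CharP k p] {f : ℕ}
  {π : O} {hπ : Irreducible π} {ι : ResidueField O →+* k} {r : Fin f → ℕ} {w : ℕ}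
  [Fintype (ResidueField O)]

/-- The powers `t^(i p^j)` with `i ≤ r_j` are killed if `r` has another nonzero digit. -/
theorem fib_pow_digit_eq_zero (hT : HasTeichmuller O) (n : ℕ) (x : O) {j j' : Fin f} (hjj : j' ≠ j)
    (hr : 0 < r j') {i : ℕ} (hi : i ≤ r j) :
    fib F p hπ ι r w n x (fun t => ι t ^ (i * p ^ (j : ℕ))) = 0 := by
  have h1 : (Pi.single j i : Fin f → ℕ) ≤ r := fun l => by
    rcases eq_or_ne l j with rfl | hl
    · rwa [Pi.single_eq_same]
    · rw [Pi.single_eq_of_ne hl]; exact Nat.zero_le _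
  have h2 : (Pi.single j i : Fin f → ℕ) ≠ r := fun e => by
    have h3 := congrFun e j'
    rw [Pi.single_eq_of_ne hjj] at h3
    omega
  have := fib_pow_eq_zero (F := F) (p := p) (hπ := hπ) (ι := ι) (w := w) hT n x h1 h2
  rwa [digVal_single] at this

/-- Hence the sum with exponent `(r_j + 1) p^j` depends only on the inner vertex. -/
theorem fib_pow_digit_succ_congr (hT : HasTeichmuller O) (n : ℕ) {j j' : Fin f} (hjj : j' ≠ j)
    (hr : 0 < r j') (x y : O) (h : π ^ n ∣ x - y) :
    fib F p hπ ι r w n x (fun t => ι t ^ (p ^ (j : ℕ) * (r j + 1))) =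
      fib F p hπ ι r w n y (fun t => ι t ^ (p ^ (j : ℕ) * (r j + 1))) := by
  obtain ⟨z, hz⟩ := h
  rw [show x = y + π ^ n * z by rw [← hz, add_sub_cancel], fib_add_mul hT]
  have e : (fun t : ResidueField O => ι (t - residue O z) ^ (p ^ (j : ℕ) * (r j + 1))) =
      ∑ i ∈ Finset.range (r j + 1 + 1),
        (((-ι (residue O z)) ^ p ^ (j : ℕ)) ^ (r j + 1 - i) * ((r j + 1).choose i : k)) •
          fun t : ResidueField O => ι t ^ (i * p ^ (j : ℕ)) := by
    funext t
    rw [sub_pow_digit ι, Finset.sum_apply]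
    rfl
  rw [e, map_sum, Finset.sum_range_succ, Finset.sum_eq_zero fun i hi => by
    rw [map_smul, fib_pow_digit_eq_zero hT n y hjj hr (Nat.lt_succ_iff.mp (Finset.mem_range.mp hi)),
      smul_zero]]
  simp [mul_comm]

/-- The action of the big cell on vectors supported on the first sphere is given by a polynomial in the
Teichmüller representative. -/
theorem kRep_bigMat_fib_zero (hT : HasTeichmuller O) {m : ℕ} {D : Fin f → ℕ}
    (hD0 : digVal p D ≠ 0) (hD : ∀ x : ResidueField O, x ≠ 0 → ι x ^ (digVal p D + m) = ι x ^ digVal p r)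
    (hm : m ≠ 0) (t : ResidueField O) :
    kRep F p hπ ι r w (bigMat (teichmuller t)) (fib F p hπ ι r w 0 0 (fun x => ι x ^ m)) =
      ∑ b : Exps D, ι t ^ digVal p b.val • ((multiChoose D b.val : k) * (-1) ^ digVal p (D - b.val)) •
        fib F p hπ ι r w 0 0 (fun x => ι x ^ digVal p (D - b.val)) := by
  classical
  have hpi : residue O π = 0 := (dvd_iff_residue hπ).mp dvd_rfl
  have hterm : ∀ x : ResidueField O, kRep F p hπ ι r w (bigMat (teichmuller t)) (ι x ^ m •
      cls p hπ ι r w (cosetMat F hπ 1 (teichmuller x)) (highestVec r)) =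
        ι x⁻¹ ^ digVal p D • cls p hπ ι r w (cosetMat F hπ 1 (teichmuller (t - x⁻¹))) (highestVec r) := by
    intro x
    rcases eq_or_ne x 0 with rfl | hx
    · rw [map_zero, zero_pow hm, zero_smul, map_zero, inv_zero, map_zero, zero_pow hD0, zero_smul]
    obtain ⟨E, hE⟩ : IsUnit (teichmuller x : O) := by
      rw [← residue_ne_zero_iff_isUnit, hT.residue]
      exact hx
    have h1 := kRep_cls_cosetMat (F := F) (p := p) (hπ := hπ) (ι := ι) (r := r) (w := w)
      (bigMat (teichmuller t)) 1 (teichmuller x) (teichmuller t - ((E⁻¹ : Oˣ) : O)) E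
      (by simp [bigMat, coe_mkGL, hE]) (by
        rw [sub_mul, Units.inv_mul, hE]
        simp [bigMat, coe_mkGL, sub_eq_add_neg])
      (by rw [pow_one, map_mul, hpi, mul_zero]) 0 (fun _ => Nat.zero_le _)
    have hdet : ((bigMat (teichmuller t) : GL (Fin 2) O) : Matrix (Fin 2) (Fin 2) O).det = 1 := by
      simp [bigMat, coe_mkGL]
    have hcong : cls (F := F) p hπ ι r w (cosetMat F hπ 1 (teichmuller t - ((E⁻¹ : Oˣ) : O)))
        (highestVec r) = cls p hπ ι r w (cosetMat F hπ 1 (teichmuller (t - x⁻¹))) (highestVec r) := by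
      refine cls_cosetMat_congr ?_
      rw [pow_one, dvd_sub_iff_residue hπ, map_sub, hT.residue, residue_inv, hE, hT.residue, hT.residue]
    rw [hdet, one_mul, map_one, map_one, one_pow, one_mul, residue_inv, hE, hT.residue, tsub_zero,
      digVal_zero, pow_zero, mul_one] at h1
    change kRep F p hπ ι r w _ (cls p hπ ι r w _ (highestVec r)) =
      _ • cls p hπ ι r w _ (highestVec r) at h1
    rw [map_smul, h1, hcong, smul_smul, ← hD _ (inv_ne_zero hx), pow_add, mul_left_comm, ← mul_pow,
      ← map_mul, mul_inv_cancel₀ hx, map_one, one_pow, mul_one]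
  have hfib : ∀ P : ResidueField O → k, fib F p hπ ι r w 0 0 P = ∑ x : ResidueField O,
      P x • cls p hπ ι r w (cosetMat F hπ 1 (teichmuller x)) (highestVec r) := by
    intro P
    rw [fib_apply]
    simp only [pow_zero, one_mul, zero_add]
  rw [hfib, map_sum, Finset.sum_congr rfl fun x _ => hterm x]
  have h2 : ∑ x : ResidueField O, ι x⁻¹ ^ digVal p D •
      cls (F := F) p hπ ι r w (cosetMat F hπ 1 (teichmuller (t - x⁻¹))) (highestVec r) =
        ∑ x : ResidueField O, (ι t + -ι x) ^ digVal p D •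
          cls p hπ ι r w (cosetMat F hπ 1 (teichmuller x)) (highestVec r) := by
    refine Fintype.sum_equiv ((Equiv.inv (ResidueField O)).trans (Equiv.subLeft t)) _ _ fun x => ?_
    change _ = (ι t + -ι (t - x⁻¹)) ^ _ • cls p hπ ι r w (cosetMat F hπ 1 (teichmuller (t - x⁻¹))) _
    rw [map_sub, neg_sub, add_sub_cancel]
  rw [h2]
  simp only [add_pow_digVal, Finset.sum_smul, hfib, Finset.smul_sum, smul_smul]
  rw [Finset.sum_comm]
  refine Finset.sum_congr rfl fun b _ => Finset.sum_congr rfl fun x _ => ?_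
  rw [neg_pow (ι x)]
  congr 1
  ring

/-- If `f > 1`, the submodule generated by `s_n^{p^j (r_j + 1)}` is the weight whose exponents are
`p - 2 - r_j` at `j`, `r_{j'} - 1` at the next place `j'`, and `r_i` at the other places. -/
theorem genKZ_sElt_of_ne (hq : Fintype.card (ResidueField O) = p ^ f) (hT : HasTeichmuller O)
    (hr : ∀ j, 2 < r j ∧ r j + 3 < p) (n : ℕ) (hn : 1 ≤ n) {j j' : Fin f} (hjj : j' ≠ j)
    (hfrob : ∀ x : ResidueField O, x ^ p ^ (j' : ℕ) = (x ^ p ^ (j : ℕ)) ^ p)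
    (hinv : IsI1Invariant F p hπ ι r w
      (Submodule.Quotient.mk (sElt F p hπ ι r w n hn (p ^ (j : ℕ) * (r j + 1))))) :
    (genKZ F p hπ ι r w (sElt F p hπ ι r w n hn (p ^ (j : ℕ) * (r j + 1)))).toRepresentation.IsIrreducible ∧
      Module.finrank k
        (genKZ F p hπ ι r w (sElt F p hπ ι r w n hn (p ^ (j : ℕ) * (r j + 1)))).toSubmodule =
        (∏ i with i ≠ j ∧ i ≠ j', (r i + 1)) * (p - r j - 1) * r j' := by
  obtain ⟨n, rfl⟩ : ∃ m, n = m + 1 := ⟨n - 1, by omega⟩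
  have hr1 : ∀ j, r j + 1 < p := fun j => by have := hr j; omega
  have hrj := hr j
  have hrj' := hr j'
  have hpj : 0 < p ^ (j : ℕ) := pow_pos (Fact.out : p.Prime).pos _
  obtain ⟨m, hm⟩ : ∃ m, m = p ^ (j : ℕ) * (r j + 1) := ⟨_, rfl⟩
  have hm0 : m ≠ 0 := by rw [hm]; positivity
  -- The exponents of the weight, with an arbitrary digit at `j`.
  obtain ⟨A, hA⟩ : ∃ A : ℕ → Fin f → ℕ, A = fun a i => if i = j then a else if i = j' then r i - 1
    else r i := ⟨_, rfl⟩
  have hAj : ∀ a, A a j = a := fun a => by rw [hA]; exact if_pos rfl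
  have hAj' : ∀ a, A a j' = r j' - 1 := fun a => by
    rw [hA]; exact (if_neg hjj).trans (if_pos rfl)
  have hAi : ∀ a i, i ≠ j → i ≠ j' → A a i = r i := fun a i h1 h2 => by
    rw [hA]; exact (if_neg h1).trans (if_neg h2)
  have hAlt : ∀ a, a + 1 < p → ∀ i, A a i + 1 < p := fun a ha i => by
    have := hr i
    rcases eq_or_ne i j with rfl | h1
    · rwa [hAj]
    rcases eq_or_ne i j' with rfl | h2
    · rw [hAj']; omega
    · rw [hAi a i h1 h2]; omega
  have hA0 : ∀ a, digVal p (A a) ≠ 0 := fun a => by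
    have h1 : A a j' * p ^ (j' : ℕ) ≤ digVal p (A a) :=
      Finset.single_le_sum (f := fun l => A a l * p ^ (l : ℕ)) (fun _ _ => Nat.zero_le _)
        (Finset.mem_univ j')
    have h2 : 0 < A a j' * p ^ (j' : ℕ) := Nat.mul_pos (by rw [hAj']; omega)
      (pow_pos (Fact.out : p.Prime).pos _)
    omega
  have hApow : ∀ a c, a + c = r j + p → ∀ x : ResidueField O, x ≠ 0 →
      ι x ^ (digVal p (A a) + p ^ (j : ℕ) * c) = ι x ^ digVal p r := by
    intro a c hac x hx
    have e : A a + Pi.single j' 1 + Pi.single j c = r + Pi.single j p := by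
      funext i
      have := hr i
      rcases eq_or_ne i j with rfl | h1
      · simp only [Pi.add_apply, Pi.single_eq_same, Pi.single_eq_of_ne hjj.symm, hAj]; omega
      rcases eq_or_ne i j' with rfl | h2
      · simp only [Pi.add_apply, Pi.single_eq_same, Pi.single_eq_of_ne h1, hAj']; omega
      · simp only [Pi.add_apply, Pi.single_eq_of_ne h2, Pi.single_eq_of_ne h1, hAi a i h1 h2,
          add_zero]
    have e1 := congrArg (digVal p) e
    rw [digVal_add, digVal_add, digVal_add, digVal_single, digVal_single, digVal_single, one_mul] at e1
    have e2 : ι x ^ p ^ (j' : ℕ) = ι x ^ (p * p ^ (j : ℕ)) := by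
      rw [← map_pow, hfrob, ← pow_mul, map_pow, mul_comm]
    have h0 : ι x ^ p ^ (j' : ℕ) ≠ 0 := pow_ne_zero _ ((map_ne_zero ι).mpr hx)
    apply mul_left_injective₀ h0
    change _ * _ = _ * _
    conv_rhs => rw [e2]
    rw [← pow_add, ← pow_add, ← e1]
    congr 1
    ring
  obtain ⟨B, hB⟩ : ∃ B, B = p - 2 - r j := ⟨_, rfl⟩
  have hfin : ∏ i, (A B i + 1) = (∏ i with i ≠ j ∧ i ≠ j', (r i + 1)) * (p - r j - 1) * r j' := by
    rw [← Finset.prod_filter_mul_prod_filter_not Finset.univ (fun i => i ≠ j ∧ i ≠ j'), mul_assoc]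
    congr 1
    · exact Finset.prod_congr rfl fun i hi => by
        rw [hAi B i (Finset.mem_filter.mp hi).2.1 (Finset.mem_filter.mp hi).2.2]
    · have e : Finset.univ.filter (fun i => ¬ (i ≠ j ∧ i ≠ j')) = {j, j'} := by
        ext i
        simp only [Finset.mem_filter, Finset.mem_univ, true_and, Finset.mem_insert,
          Finset.mem_singleton]
        tauto
      rw [e, Finset.prod_pair hjj.symm, hAj, hAj', hB]
      congr 1 <;> omega
  rw [← hfin]
  refine genKZ_of_expansion hq hT (hAlt B (by omega)) (w + m) _
    (sElt_ne_zero hq hT hr1 n hn j (Nat.lt_succ_self _) (hr1 j)) hinv ?_ ?_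
  · intro a d
    refine kRep_diaMat_sum hT (n := n) (m := m) (i := 0) (fun _ => Nat.zero_le _) ?_ ?_ ?_ hinv a d
    · intro x hx
      rw [tsub_zero, pow_add _ w, ← hApow B (r j + 1 + (r j + 1)) (by omega) x hx, ← pow_add, hm]
      congr 1
      ring
    · rw [digVal_zero, add_zero]
    · rw [mk_sElt_cls, hm]
      rfl
  · rw [mk_sElt, ← hm]
    rcases n with _ | n
    · have e : ∑ μ : Fin 0 → ResidueField O, fib F p hπ ι r w 0 (digitSum π μ) (fun t => ι t ^ m) =
          fib F p hπ ι r w 0 0 (fun t => ι t ^ m) := by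
        rw [Fintype.sum_unique]
        simp [digitSum]
      -- The digits of the exponents at `j` range up to `p - 1` at first.
      have hBD : A B ≤ A (p - 1) := fun i => by
        change A B i ≤ A (p - 1) i
        rcases eq_or_ne i j with rfl | h1
        · rw [hAj, hAj]; omega
        rcases eq_or_ne i j' with rfl | h2
        · rw [hAj', hAj']
        · rw [hAi _ i h1 h2, hAi _ i h1 h2]
      refine ⟨fun b => ((multiChoose (A (p - 1)) b.val : k) * (-1) ^ digVal p (A (p - 1) - b.val)) •
        fib F p hπ ι r w 0 0 (fun x => ι x ^ digVal p (A (p - 1) - b.val)), fun t => ?_⟩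
      rw [e, kRep_bigMat_fib_zero hT (hA0 (p - 1))
        (fun x hx => by rw [hm]; exact hApow (p - 1) (r j + 1) (by omega) x hx) hm0]
      symm
      refine Finset.sum_of_injOn (fun b : Exps (A B) => (Exps.mk b.val (b.val_le.trans hBD) :
        Exps (A (p - 1)))) ?_ (fun _ _ => Finset.mem_coe.mpr (Finset.mem_univ _)) ?_ fun _ _ => rfl
      · intro b _ c _ h
        exact Exps.val_injective (f := f) (congrArg (Exps.val (A := A (p - 1))) h)
      · intro b _ hb
        have hbj : B < b.val j := by
          by_contra hle
          refine hb ⟨Exps.mk b.val fun i => ?_, Finset.mem_coe.mpr (Finset.mem_univ _), Exps.val_injective rfl⟩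
          have h0 := b.val_le i
          rcases eq_or_ne i j with rfl | h1
          · rw [hAj]; exact not_lt.mp hle
          rcases eq_or_ne i j' with rfl | h2
          · rw [hAj'] at h0 ⊢; exact h0
          · rw [hAi _ i h1 h2] at h0 ⊢; exact h0
        rw [fib_pow_eq_zero hT 0 0 (i := A (p - 1) - b.val), smul_zero, smul_zero]
        · intro i
          change A (p - 1) i - b.val i ≤ r i
          rcases eq_or_ne i j with rfl | h1
          · rw [hAj]; omega
          rcases eq_or_ne i j' with rfl | h2
          · rw [hAj']; omega
          · rw [hAi _ i h1 h2]; omega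
        · intro h
          have h3 := congrFun h j'
          rw [Pi.sub_apply, hAj'] at h3
          omega
    · have hY : ∀ x y : O, π ^ (n + 1) ∣ x - y → fib F p hπ ι r w (n + 1) x (fun t => ι t ^ m) =
          fib F p hπ ι r w (n + 1) y (fun t => ι t ^ m) := by
        rw [hm]
        exact fib_pow_digit_succ_congr hT (n + 1) hjj (by omega)
      have hmob := kRep_fib_mobius (F := F) (hπ := hπ) (w := w) hT (m := m) (e := digVal p (A B))
        (fun x hx => by
          rw [← hApow B (r j + 1 + (r j + 1)) (by omega) x hx, hm]
          congr 1
          ring) n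
      refine exists_expansion_of_mobius hπ hT (hA0 B)
        (fun x => fib F p hπ ι r w (n + 1) x (fun t => ι t ^ m)) hY ?_ ?_
      · intro t x
        refine hmob _ x _ x (by simp [bigMat, coe_mkGL]) (by simp [bigMat, coe_mkGL]) ?_
        rw [sub_mul, Units.inv_mul]
        simp [bigMat, coe_mkGL, sub_eq_add_neg]
      · intro t x y hx hy
        obtain ⟨D, hD⟩ : IsUnit (1 - teichmuller t * x) := by
          rw [← residue_ne_zero_iff_isUnit, map_sub, map_mul, hx, mul_zero, sub_zero, map_one]
          exact one_ne_zero
        have h1 := hmob (lowMat (-teichmuller t)) x y D (by simp [lowMat, coe_mkGL])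
          (by rw [hD]; simp [lowMat, coe_mkGL]; ring) (by rw [hD, hy]; simp [lowMat, coe_mkGL])
        rw [residue_inv, hD, map_sub, map_mul, hx, mul_zero, sub_zero, map_one, inv_one, map_one, one_pow,
          one_smul] at h1
        exact h1

end Hecke

/-! ### The elements `s_n^m` for `f = 1` -/

section Hecke
variable {O F : Type*} [CommRing O] [IsDomain O] [IsDiscreteValuationRing O] [Field F]
  [Algebra O F] [IsFractionRing O F]
  {k : Type*} [Field k] {p : ℕ} [Fact p.Prime] [CharP k p] {π : O} {hπ : Irreducible π}
  {ι : ResidueField O →+* k} {r : Fin 1 → ℕ} {w : ℕ} [Fintype (ResidueField O)]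

theorem digVal_fin_one (i : Fin 1 → ℕ) : digVal p i = i 0 := by simp [digVal]

theorem evalYLin_uniMat {f : ℕ} {r : Fin f → ℕ} (x : O) (v : SymSpace k r) :
    evalYLin k r (sigmaK p ι r w (uniMat x) v) = evalYLin k r v := by
  have h := evalY_substHom p (ι.comp (residue O)) ((uniMat x : GL (Fin 2) O) : Matrix (Fin 2) (Fin 2) O)
    (by simp [uniMat, coe_mkGL]) r v.2
  change evalY k f ((ι.comp (residue O)) ((uniMat x : GL (Fin 2) O) : Matrix (Fin 2) (Fin 2) O).det ^ w •
    substHom p f _ _ v.1) = evalY k f v.1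
  rw [map_smul, h]
  simp [uniMat, coe_mkGL]

/-- Translation of the sum with exponent `r + 1` on the sphere of radius `n + 2` leads to the
sphere of radius `n`: the next lower exponent `r` can be moved inwards. -/
theorem fib_succ_add_mul (hT : HasTeichmuller O) (n : ℕ) (x y : O) :
    fib F p hπ ι r w (n + 1) (x + π ^ (n + 1) * y) (fun t => ι t ^ (r 0 + 1)) =
      fib F p hπ ι r w (n + 1) x (fun t => ι t ^ (r 0 + 1)) +
        (((r 0 + 1 : ℕ) : k) * (-1) ^ r 0 * ι (residue O y)) •
          cls p hπ ι r w (cosetMat F hπ n x) (monVec k (Exps.top r).rev) := by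
  have hlow : ∀ i, i < r 0 → fib F p hπ ι r w (n + 1) x (fun t => ι t ^ i) = 0 := by
    intro i hi
    have h := fib_pow_eq_zero (F := F) (p := p) (hπ := hπ) (ι := ι) (w := w) hT (n + 1) x
      (i := fun _ => i) (fun l => by rw [Subsingleton.elim l 0]; exact hi.le)
      (fun e => hi.ne (congrFun e 0))
    rwa [digVal_fin_one] at h
  have htop := fib_succ_pow (F := F) (p := p) (hπ := hπ) (ι := ι) (r := r) (w := w) hT n x
  rw [digVal_fin_one] at htop
  rw [fib_add_mul hT]
  have e : (fun t : ResidueField O => ι (t - residue O y) ^ (r 0 + 1)) =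
      ∑ i ∈ Finset.range (r 0 + 1 + 1),
        ((-ι (residue O y)) ^ (r 0 + 1 - i) * ((r 0 + 1).choose i : k)) •
          fun t : ResidueField O => ι t ^ i := by
    funext t
    have := sub_pow_digit (p := p) ι t 0 (r 0 + 1) (residue O y)
    simp only [pow_zero, one_mul, pow_one, mul_one] at this
    rw [this, Finset.sum_apply]
    rfl
  rw [e, map_sum, Finset.sum_range_succ, Finset.sum_range_succ, Finset.sum_eq_zero fun i hi => by
    rw [map_smul, hlow i (Finset.mem_range.mp hi), smul_zero], zero_add, map_smul, map_smul, htop,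
    Nat.sub_self, pow_zero, Nat.choose_self, Nat.cast_one, one_mul, one_smul, add_comm, smul_smul,
    Nat.add_sub_cancel_left, pow_one, Nat.choose_succ_self_right]
  congr 2
  ring

theorem sum_fib_succ_add_mul (hT : HasTeichmuller O) (n : ℕ) (x : O) (z : ResidueField O → O) :
    ∑ s : ResidueField O, fib F p hπ ι r w (n + 1) (x + π ^ n * (teichmuller s + π * z s))
        (fun t => ι t ^ (r 0 + 1)) =
      ∑ s : ResidueField O, fib F p hπ ι r w (n + 1) (x + π ^ n * teichmuller s)
        (fun t => ι t ^ (r 0 + 1)) +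
      (((r 0 + 1 : ℕ) : k) * (-1) ^ r 0) • cls p hπ ι r w (cosetMat F hπ n x)
        (∑ s : ResidueField O, ι (residue O (z s)) •
          sigmaK p ι r w (uniMat (teichmuller s)) (monVec k (Exps.top r).rev)) := by
  rw [map_sum, Finset.smul_sum, ← Finset.sum_add_distrib]
  refine Finset.sum_congr rfl fun s _ => ?_
  rw [show x + π ^ n * (teichmuller s + π * z s) =
    x + π ^ n * teichmuller s + π ^ (n + 1) * z s by ring, fib_succ_add_mul hT,
    ← cosetMat_mul_uniMat, cls_mul_embK, map_smul, smul_smul]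

/-- Quadratic polynomials do not contribute, as `r + 2 < p - 1`. -/
theorem sum_quadratic_smul_uniMat (hq : Fintype.card (ResidueField O) = p ^ 1)
    (hT : HasTeichmuller O) (hr : r 0 + 3 < p) (a b c : ResidueField O) :
    ∑ s : ResidueField O, ι (a * s + b * s ^ 2 + c) •
      sigmaK p ι r w (uniMat (teichmuller s)) (monVec k (Exps.top r).rev) = 0 := by
  obtain ⟨u, -, hu⟩ := weightRep_uniMat_monVec p (ι.comp (residue O)) r w (Exps.top r).rev
  have h0 : ∀ i, i ≤ r 0 + 2 → ∑ s : ResidueField O, ι s ^ i = 0 := fun i hi =>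
    sum_map_pow_eq_zero ι (by rw [hq, pow_one]; omega) (by rw [hq, pow_one]; omega)
  simp only [sigmaK, hu, RingHom.comp_apply, hT.residue, Finset.smul_sum, smul_smul]
  rw [Finset.sum_comm]
  refine Finset.sum_eq_zero fun e _ => ?_
  rw [← Finset.sum_smul]
  have he : digVal p e.val ≤ r 0 := by
    rw [digVal_fin_one]
    exact (e.val_le 0).trans (Nat.sub_le _ _)
  generalize digVal p e.val = i at he
  have h1 : ∀ s : ResidueField O, ι (a * s + b * s ^ 2 + c) * ι s ^ i =
      ι a * ι s ^ (i + 1) + ι b * ι s ^ (i + 2) + ι c * ι s ^ i := fun s => by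
    simp only [map_add, map_mul, map_pow]
    ring
  simp only [h1, Finset.sum_add_distrib, ← Finset.mul_sum]
  rw [h0 _ (by omega), h0 _ (by omega), h0 _ (by omega), mul_zero, mul_zero, mul_zero, add_zero,
    add_zero, zero_smul]

/-- If `s_{n+2}^{r+1}` is invariant under translation by `π^n`, then `p` is divisible by `π^2`: the
sum of the carries `z_s` is `-p / π`. -/
theorem sq_dvd_of_sElt_invariant (hq : Fintype.card (ResidueField O) = p ^ 1)
    (hT : HasTeichmuller O) (hr0 : 0 < r 0) (hr : r 0 + 3 < p) (n : ℕ) (hn : 1 ≤ n + 2)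
    (hinv : IsI1Invariant F p hπ ι r w
      (Submodule.Quotient.mk (sElt F p hπ ι r w (n + 2) hn (r 0 + 1)))) : π ^ 2 ∣ (p : O) := by
  have hr1 : ∀ j, r j + 1 < p := fun j => by rw [Subsingleton.elim j 0]; omega
  obtain ⟨z, hz⟩ := exists_carry hπ hT
  have h1 := isI1_uniMat hinv (-π ^ n)
  rw [mk_sElt, map_sum] at h1
  simp only [kRep_uniMat_fib] at h1
  rw [sum_sub_pow hz n (fun x => fib F p hπ ι r w (n + 1) x (fun t => ι t ^ (r 0 + 1))), sum_snoc] at h1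
  simp only [sum_fib_succ_add_mul hT, digitSum_snoc, Finset.sum_add_distrib, add_eq_left] at h1
  have hc : ((r 0 + 1 : ℕ) : k) * (-1) ^ r 0 ≠ 0 := by
    refine mul_ne_zero ?_ (pow_ne_zero _ (neg_ne_zero.mpr one_ne_zero))
    rw [Ne, CharP.cast_eq_zero_iff k p]
    exact fun h => absurd (Nat.le_of_dvd (Nat.succ_pos _) h) (not_le.mpr (hr1 0))
  rw [← Finset.smul_sum, smul_eq_zero_iff_right hc] at h1
  obtain ⟨c, hc'⟩ := exists_eq_smul_of_sum_cls_eq_zero hq hT hr1 h1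
  have hY : evalYLin k r (monVec k (Exps.top r).rev) = 1 := by
    rw [evalYLin_monVec_rev, topCoef_monVec, if_pos rfl]
  have hX : evalYLin k r (highestVec r) = 0 := by
    rw [← monVec_top, ← Exps.rev_rev (Exps.top r), evalYLin_monVec_rev, topCoef_monVec, if_neg]
    intro h
    have h2 := congrFun (congrArg Exps.val h) 0
    rw [Exps.rev_val, Pi.sub_apply, Exps.top, Exps.val_mk] at h2
    omega
  have h2 := congrArg (evalYLin k r) hc'
  simp only [map_sum, map_smul, evalYLin_uniMat, hY, hX, smul_eq_mul, mul_one, mul_zero] at h2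
  rw [← map_sum, ← map_sum, map_eq_zero, ← dvd_iff_residue hπ] at h2
  obtain ⟨d, hd⟩ := h2
  have h3 : π * ∑ s : ResidueField O, z s = -(p : O) := by
    rw [Finset.mul_sum, Finset.sum_congr rfl fun s _ => (hz s).symm, Finset.sum_sub_distrib,
      Finset.sum_sub_distrib, Fintype.sum_equiv (Equiv.addRight (1 : ResidueField O)) (fun s => teichmuller (s + 1))
        (fun s => (teichmuller s : O)) fun _ => rfl]
    simp [hq]
  rw [← dvd_neg, ← h3, hd]
  exact ⟨d, by ring⟩

/-- If `f = 1`, the submodule generated by `s_n^{r+1}` is the weight with exponent `p - 3 - r`. -/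
theorem genKZ_sElt_of_eq_one (hq : Fintype.card (ResidueField O) = p ^ 1) (hT : HasTeichmuller O)
    (hr0 : 0 < r 0) (hr : r 0 + 3 < p) (n : ℕ) (hn : 1 ≤ n + 2)
    (hinv : IsI1Invariant F p hπ ι r w
      (Submodule.Quotient.mk (sElt F p hπ ι r w (n + 2) hn (r 0 + 1)))) :
    (genKZ F p hπ ι r w (sElt F p hπ ι r w (n + 2) hn (r 0 + 1))).toRepresentation.IsIrreducible ∧
      Module.finrank k (genKZ F p hπ ι r w (sElt F p hπ ι r w (n + 2) hn (r 0 + 1))).toSubmodule =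
        p - r 0 - 2 := by
  have hr1 : ∀ j, r j + 1 < p := fun j => by rw [Subsingleton.elim j 0]; omega
  have hp := sq_dvd_of_sElt_invariant hq hT hr0 hr n hn hinv
  have hne := sElt_ne_zero (F := F) (p := p) (hπ := hπ) (ι := ι) (r := r) (w := w) hq hT hr1 (n + 1) hn 0
    (Nat.lt_succ_self (r 0)) (hr1 0)
  rw [Fin.val_zero, pow_zero, one_mul] at hne
  have hfin : ∏ i : Fin 1, ((fun _ : Fin 1 => p - 3 - r 0) i + 1) = p - r 0 - 2 := by
    rw [Fin.prod_univ_one]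
    change p - 3 - r 0 + 1 = _
    omega
  have hA : digVal p (fun _ : Fin 1 => p - 3 - r 0) = p - 3 - r 0 := digVal_fin_one _
  have hpow : ∀ x : ResidueField O, x ≠ 0 →
      ι x ^ (digVal p (fun _ : Fin 1 => p - 3 - r 0) + 2 * (r 0 + 1)) = ι x ^ digVal p r := by
    intro x hx
    have h1 : ι x ^ (p - 1) = 1 := by
      have h2 := FiniteField.pow_card_sub_one_eq_one x hx
      rw [hq, pow_one] at h2
      rw [← map_pow, h2, map_one]
    rw [hA, digVal_fin_one, show p - 3 - r 0 + 2 * (r 0 + 1) = r 0 + (p - 1) by omega, pow_add, h1, mul_one]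
  rw [← hfin]
  refine genKZ_of_expansion hq hT (fun _ => by omega) (w + (r 0 + 1)) _ hne hinv ?_ ?_
  · intro a d
    refine kRep_diaMat_sum hT (n := n + 1) (m := r 0 + 1) (i := 0) (fun _ => Nat.zero_le _) ?_ ?_ ?_
      hinv a d
    · intro x hx
      rw [tsub_zero, pow_add _ w, ← hpow x hx, ← pow_add]
      congr 1
      ring
    · rw [digVal_zero, add_zero]
    · rw [mk_sElt_cls]
      rfl
  · rw [mk_sElt]
    refine exists_expansion_of_quadratic hπ hq hT hp (by rw [hA]; omega)
      (fun x => fib F p hπ ι r w (n + 1) x (fun t => ι t ^ (r 0 + 1))) ?_ ?_ ?_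
    · intro x y h
      rw [fib_congr h]
    · exact kRep_fib_mobius hT hpow n
    · intro x α β γ
      have h1 := sum_fib_succ_add_mul (F := F) (p := p) (hπ := hπ) (ι := ι) (r := r) (w := w) hT n x
        (fun s => α * teichmuller s + β * teichmuller s ^ 2 + γ)
      refine h1.trans ?_
      simp only [map_add (residue O), map_mul (residue O), map_pow (residue O), hT.residue]
      rw [sum_quadratic_smul_uniMat hq hT hr, map_zero, smul_zero, add_zero]

end Hecke

/-! ### Existence of Teichmüller representatives -/

section Complete

/-- Finite modules over complete rings are complete. -/
theorem isPrecomplete_of_finite {R M : Type*} [CommRing R] [AddCommGroup M] [Module R M] (I : Ideal R)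
    [IsPrecomplete I R] [Module.Finite R M] : IsPrecomplete I M := by
  rw [← AdicCompletion.of_surjective_iff]
  intro y
  obtain ⟨z, rfl⟩ := AdicCompletion.ofTensorProduct_surjective_of_finite I M y
  induction z using TensorProduct.induction_on with
  | zero => exact ⟨0, by simp⟩
  | tmul a m =>
    obtain ⟨a, rfl⟩ := AdicCompletion.of_surjective I R a
    refine ⟨a • m, ?_⟩
    rw [AdicCompletion.ofTensorProduct_tmul, map_smul]
    ext n
    simp
    rfl
  | add x y hx hy =>
    obtain ⟨x', hx⟩ := hx
    obtain ⟨y', hy⟩ := hy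
    exact ⟨x' + y', by rw [map_add, map_add, hx, hy]⟩

variable {O : Type*} [CommRing O] [IsDomain O] [IsDiscreteValuationRing O] {π : O}

theorem pow_card_sub_pow_card (hπ : Irreducible π) [Finite (ResidueField O)] {i : ℕ} {a b : O}
    (h : π ^ (i + 1) ∣ a - b) :
    π ^ (i + 2) ∣ a ^ Nat.card (ResidueField O) - b ^ Nat.card (ResidueField O) := by
  have := Fintype.ofFinite (ResidueField O)
  have hab : residue O a = residue O b :=
    (dvd_sub_iff_residue hπ).mp ((dvd_pow_self π i.succ_ne_zero).trans h)
  rw [← (Commute.all a b).geom_sum₂_mul, mul_comm, pow_succ π (i + 1)]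
  refine mul_dvd_mul h ?_
  rw [dvd_iff_residue hπ, map_sum, Nat.card_eq_fintype_card]
  simp only [map_mul, map_pow, hab, ← pow_add]
  rw [Finset.sum_congr rfl fun j hj => by
    rw [Nat.add_sub_cancel' (Nat.le_sub_one_of_lt (Finset.mem_range.mp hj))]]
  rw [Finset.sum_const, Finset.card_range, nsmul_eq_mul, FiniteField.cast_card_eq_zero, zero_mul]

/-- If `O` is complete for a nonzero ideal `(a)`, Hensel's lemma gives the Teichmüller
representatives: a high power of a lift is close enough to a root of `X^q - X`. -/
theorem hasTeichmuller_of_isAdicComplete (hπ : Irreducible π) [Finite (ResidueField O)] {a : O} (ha : a ≠ 0)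
    (hres : residue O a = 0) [IsAdicComplete (Ideal.span {a}) O] : HasTeichmuller O := by
  have := Fintype.ofFinite (ResidueField O)
  intro μ
  obtain ⟨x, rfl⟩ := residue_surjective μ
  obtain ⟨q, hq⟩ : ∃ q, q = Nat.card (ResidueField O) := ⟨_, rfl⟩
  have hqF : q = Fintype.card (ResidueField O) := hq.trans Nat.card_eq_fintype_card
  have hq1 : 1 < q := by rw [hqF]; exact Fintype.one_lt_card
  have hq0 : residue O ((q : ℕ) : O) = 0 := by rw [map_natCast, hqF, FiniteField.cast_card_eq_zero]
  have hpow : ∀ y : ResidueField O, y ^ q = y := fun y => by rw [hqF, FiniteField.pow_card]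
  rw [← hq]
  obtain ⟨N, u, hu⟩ := IsDiscreteValuationRing.eq_unit_mul_pow_irreducible ha hπ
  have hiter : ∀ i : ℕ, π ^ (i + 1) ∣ (x ^ q ^ i) ^ q - x ^ q ^ i := by
    intro i
    induction i with
    | zero => rw [pow_zero, zero_add, pow_one, pow_one, dvd_sub_iff_residue hπ, map_pow, hpow]
    | succ i ih =>
      have h := pow_card_sub_pow_card hπ ih
      rw [← hq] at h
      rwa [← pow_mul x (q ^ i) q, ← pow_succ] at h
  obtain ⟨y, hy⟩ : ∃ y, y = x ^ q ^ N := ⟨_, rfl⟩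
  have hyx : residue O y = residue O x := by
    rw [hy, map_pow]
    have : ∀ i : ℕ, residue O x ^ q ^ i = residue O x := fun i => by
      induction i with
      | zero => rw [pow_zero, pow_one]
      | succ i ih => rw [pow_succ, pow_mul, ih, hpow]
    exact this N
  have hmem : y ^ q - y ∈ Ideal.span {a} := by
    rw [Ideal.mem_span_singleton, hu, hy]
    refine (Units.mul_left_dvd).mpr ((pow_dvd_pow π N.le_succ).trans (hiter N))
  have hder : IsUnit ((Polynomial.X ^ q - Polynomial.X : Polynomial O).derivative.eval y) := by
    rw [← residue_ne_zero_iff_isUnit]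
    simp only [Polynomial.derivative_sub, Polynomial.derivative_X_pow, Polynomial.derivative_X,
      Polynomial.eval_sub, Polynomial.eval_mul, Polynomial.eval_C, Polynomial.eval_pow,
      Polynomial.eval_X, Polynomial.eval_one, map_sub, map_mul, map_one, hq0, zero_mul, zero_sub]
    exact neg_ne_zero.mpr one_ne_zero
  obtain ⟨z, hz, hzy⟩ := HenselianRing.is_henselian (I := Ideal.span {a})
    (Polynomial.X ^ q - Polynomial.X : Polynomial O)
    (Polynomial.monic_X_pow_sub (by rw [Polynomial.degree_X]; exact_mod_cast hq1)) y
    (by simpa using hmem) (hder.map _)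
  refine ⟨z, ?_, ?_⟩
  · rw [Polynomial.IsRoot.def] at hz
    simpa [sub_eq_zero] using hz
  · rw [← hyx, ← sub_eq_zero, ← map_sub]
    obtain ⟨c, hc⟩ := Ideal.mem_span_singleton.mp hzy
    rw [hc, map_mul, hres, zero_mul]

theorem hasTeichmuller_padicRingOfIntegers (p : ℕ) [Fact p.Prime] (F : Type*) [Field F]
    [Algebra ℚ_[p] F] [FiniteDimensional ℚ_[p] F] [Algebra ℤ_[p] F] [IsScalarTower ℤ_[p] ℚ_[p] F]
    {π : PadicRingOfIntegers p F} (hπ : Irreducible π) {f : ℕ}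
    (hf : Nat.card (ResidueField (PadicRingOfIntegers p F)) = p ^ f) :
    HasTeichmuller (PadicRingOfIntegers p F) := by
  have := Fintype.ofFinite (ResidueField (PadicRingOfIntegers p F))
  have hres : residue (PadicRingOfIntegers p F) (p : PadicRingOfIntegers p F) = 0 := by
    rw [map_natCast, residue_natCast_prime (hf ▸ Nat.card_eq_fintype_card.symm)]
  have h0 : (p : PadicRingOfIntegers p F) ≠ 0 := by
    intro h
    have h1 : algebraMap (PadicRingOfIntegers p F) F p = 0 := by rw [h, map_zero]
    have h2 : algebraMap ℚ_[p] F (p : ℚ_[p]) = 0 := by rwa [map_natCast] at h1 ⊢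
    rw [map_eq_zero] at h2
    exact (Fact.out : p.Prime).ne_zero (by exact_mod_cast h2)
  have hspan : (maximalIdeal ℤ_[p]).map (algebraMap ℤ_[p] (PadicRingOfIntegers p F)) =
      Ideal.span {(p : PadicRingOfIntegers p F)} := by
    rw [PadicInt.maximalIdeal_eq_span_p, Ideal.map_span, Set.image_singleton, map_natCast]
  have hpre : IsPrecomplete (Ideal.span {(p : PadicRingOfIntegers p F)}) (PadicRingOfIntegers p F) := by
    rw [← hspan, IsPrecomplete.map_algebraMap_iff]
    exact isPrecomplete_of_finite _
  have hne : Ideal.span {(p : PadicRingOfIntegers p F)} ≠ ⊤ := by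
    rw [Ne, Ideal.span_singleton_eq_top, ← residue_ne_zero_iff_isUnit, not_not]
    exact hres
  have hhaus := IsHausdorff.of_isLocalRing (M := PadicRingOfIntegers p F) _ hne
  have : IsAdicComplete (Ideal.span {(p : PadicRingOfIntegers p F)}) (PadicRingOfIntegers p F) := { }
  exact hasTeichmuller_of_isAdicComplete hπ h0 hres

end Complete

end SerreWeight

theorem proposition3p7 (p : ℕ) [Fact p.Prime]
    (F : Type*) [Field F] [Algebra ℚ_[p] F] [FiniteDimensional ℚ_[p] F]
    [Algebra ℤ_[p] F] [IsScalarTower ℤ_[p] ℚ_[p] F]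
    (π : PadicRingOfIntegers p F) (hπ : Irreducible π)
    (f : ℕ) (hf : Nat.card (ResidueField (PadicRingOfIntegers p F)) = p ^ f)
    (ι : ResidueField (PadicRingOfIntegers p F) →+* AlgebraicClosure (ZMod p))
    (r : Fin f → ℕ) (hr : ∀ j, 2 < r j ∧ r j + 3 < p)
    (w : ℕ) (hw : w + 2 ≤ p ^ f) :
    (Nonempty ((SerreWeight.sigma F p hπ ι r w).Equiv
        (SerreWeight.genKZ F p hπ ι r w (SerreWeight.elt₀ F p hπ ι r w)).toRepresentation) ∧
      (SerreWeight.genKZ F p hπ ι r w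
          (SerreWeight.elt₀ F p hπ ι r w)).toRepresentation.IsIrreducible ∧
        Module.finrank (AlgebraicClosure (ZMod p))
          (SerreWeight.genKZ F p hπ ι r w
            (SerreWeight.elt₀ F p hπ ι r w)).toSubmodule =
          ∏ j, (r j + 1)) ∧
    (1 < f → ∀ (n : ℕ) (hn : 1 ≤ n) (j : Fin f) (t : ℕ), 1 ≤ t → r j + t ≤ p - 1 →
      SerreWeight.IsI1Invariant F p hπ ι r w (Submodule.Quotient.mk
        (SerreWeight.sElt F p hπ ι r w n hn (p ^ (j : ℕ) * (r j + t)))) →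
      (SerreWeight.genKZ F p hπ ι r w
          (SerreWeight.sElt F p hπ ι r w n hn (p ^ (j : ℕ) * (r j + t)))).toRepresentation.IsIrreducible ∧
        Module.finrank (AlgebraicClosure (ZMod p))
          (SerreWeight.genKZ F p hπ ι r w
            (SerreWeight.sElt F p hπ ι r w n hn (p ^ (j : ℕ) * (r j + t)))).toSubmodule =
          (∏ i with i ≠ j ∧ i ≠ finRotate f j, (r i + 1)) * (p - r j - t) * r (finRotate f j)) ∧
    (f = 1 → ∀ (n : ℕ) (hn : 2 ≤ n) (j : Fin f) (t : ℕ), 1 ≤ t → r j + t ≤ p - 1 →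
      SerreWeight.IsI1Invariant F p hπ ι r w (Submodule.Quotient.mk
        (SerreWeight.sElt F p hπ ι r w n (one_le_two.trans hn) (p ^ (j : ℕ) * (r j + t)))) →
      (SerreWeight.genKZ F p hπ ι r w
          (SerreWeight.sElt F p hπ ι r w n (one_le_two.trans hn) (p ^ (j : ℕ) * (r j + t)))).toRepresentation.IsIrreducible ∧
        Module.finrank (AlgebraicClosure (ZMod p))
          (SerreWeight.genKZ F p hπ ι r w
            (SerreWeight.sElt F p hπ ι r w n (one_le_two.trans hn) (p ^ (j : ℕ) * (r j + t)))).toSubmodule =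
          p - r j - t - 1) ∧
    (∀ (n : ℕ) (_ : 1 ≤ n) (j : Fin f) (hj : 1 ≤ r j),
      SerreWeight.IsI1Invariant F p hπ ι r w (Submodule.Quotient.mk
        (SerreWeight.tElt F p hπ ι r w n j hj)) →
      (SerreWeight.genKZ F p hπ ι r w
          (SerreWeight.tElt F p hπ ι r w n j hj)).toRepresentation.IsIrreducible ∧
        Module.finrank (AlgebraicClosure (ZMod p))
          (SerreWeight.genKZ F p hπ ι r w
            (SerreWeight.tElt F p hπ ι r w n j hj)).toSubmodule =
          (∏ i with i ≠ j, (r i + 1)) * (r j - 1)) := by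
  have := Fintype.ofFinite (ResidueField (PadicRingOfIntegers p F))
  have hq : Fintype.card (ResidueField (PadicRingOfIntegers p F)) = p ^ f := by
    rw [← Nat.card_eq_fintype_card, hf]
  have hT := SerreWeight.hasTeichmuller_padicRingOfIntegers p F hπ hf
  have hr1 : ∀ j, r j + 1 < p := fun j => by have := hr j; omega
  -- The hypothesis that `s_n^m` is invariant leaves only the case `t = 1`.
  have ht1 : ∀ (n : ℕ) (hn : 1 ≤ n) (j : Fin f) (t : ℕ), 1 ≤ t → r j + t ≤ p - 1 →
      SerreWeight.IsI1Invariant F p hπ ι r w (Submodule.Quotient.mk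
        (SerreWeight.sElt F p hπ ι r w n hn (p ^ (j : ℕ) * (r j + t)))) → t = 1 := by
    intro n hn j t ht htp hinv
    obtain ⟨n, rfl⟩ : ∃ m, n = m + 1 := ⟨n - 1, by omega⟩
    have := SerreWeight.eq_succ_of_sElt_invariant hq hT hr1 n hn j (by omega)
      (by have := hr1 j; omega) hinv
    omega
  refine ⟨SerreWeight.genKZ_elt₀ hq hr1, ?_, ?_, fun n hn j hj hinv =>
    SerreWeight.genKZ_tElt hq hT hr n hn j hj hinv⟩
  · intro hf1 n hn j t ht htp hinv
    obtain rfl := ht1 n hn j t ht htp hinv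
    obtain ⟨f, rfl⟩ : ∃ f', f = f' + 2 := ⟨f - 2, by omega⟩
    refine SerreWeight.genKZ_sElt_of_ne hq hT hr n hn ?_ ?_ hinv
    · rw [finRotate_apply]
      simp
    · intro x
      rw [← pow_mul, ← pow_succ]
      rcases eq_or_ne j (Fin.last _) with rfl | hj
      · rw [finRotate_last, Fin.val_zero, pow_zero, pow_one, Fin.val_last, ← hq, FiniteField.pow_card]
      · rw [coe_finRotate_of_ne_last hj]
  · intro hf1 n hn j t ht htp hinv
    obtain rfl := ht1 n _ j t ht htp hinv
    subst hf1
    obtain ⟨n, rfl⟩ : ∃ m, n = m + 2 := ⟨n - 2, by omega⟩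
    obtain rfl := Subsingleton.elim j 0
    have h0 : p ^ ((0 : Fin 1) : ℕ) * (r 0 + 1) = r 0 + 1 := by rw [Fin.val_zero, pow_zero, one_mul]
    rw [h0] at hinv ⊢
    exact SerreWeight.genKZ_sElt_of_eq_one hq hT (by have := hr 0; omega) (hr 0).2 n _ hinv

end
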